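/- **Conventions.** An *arrowed binary sequence* (ABS) $S=(\tilde S,\delta,\pi)$ is a finite totally ordered set $\tilde S$ with a map $\delta:\tilde S\to\{0,1\}$ and a bijection $\pi:\tilde S\to\tilde S$. Its *length* is $\ell(S)=\#\{(t',t)\mid \delta(t')=0,\ \delta(t)=1,\ t'<t\}$. The *binary expansion* of $t$ is $b(t)=0.b_1b_2\cdots$ with $b_k=\delta(\pi^{-k}(t))$; digit sequences are compared lexicographically. The *dual ABS* $S_D$ is $\tilde S$ with the reversed order, the symbols $0$ and $1$ exchanged, and the same $\pi$. For coprime non-negative integers $m,n$ and $h=m+n$, let $N_{m,n}$ be the ABS on $t_1<\cdots<t_h$ with $\delta(t_i)=1$ iff $i\le m$, and $\pi(t_i)=t_{i-m \bmod h}$. Let $(m_1,n_1)$ and $(m_2,n_2)$ be pairs of coprime non-negative integers, $h_r=m_r+n_r$, $\lambda_r=n_r/h_r$, with $\lambda_2<1/2<\lambda_1$. Let $A=N_{m_1,n_1}$, $B=N_{m_2,n_2}$, and let $S=A\oplus B=(\tilde S,\delta,\pi_0)$ be their disjoint union, ordered by binary expansion. For $\tau\in\{0,1\}$, $\tau^A_i$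 and $\tau^B_j$ denote the $i$-th element of $A$ and the $j$-th element of $B$, $\tau$ being its symbol. *Exchange.* Given $0^A_i$ and $1^B_j$ with $0^A_i<1^B_j$, let $\pi$ be the *small modification*: $\pi(\pi_0^{-1}(0^A_i))=1^B_j$, $\pi(\pi_0^{-1}(1^B_j))=0^A_i$, and $\pi=\pi_0$ elsewhere. The ABS $S'=S'(i,j)$ obtained by exchanging $0^A_i$ and $1^B_j$ is $\tilde S$ with $\delta$ and $\pi$, ordered by the binary expansions determined by $\delta$ and $\pi$. (Elements with equal expansions have equal symbols, so $\ell(S')$ does not depend on how ties are broken.) The exchange is *good* if $\ell(S')=\ell(S)-1$. *The sets $\mathcal A^{(n)}$ and $\mathcal B^{(n)}$.* Put $\alpha_n=\pi^n(0^A_i)$ and $\beta_n=\pi^n(1^B_j)$. Let $S^{(0)}$ be $\tilde S$ with the places of $0^A_i$ and $1^B_j$ in the order interchanged. Let $$\mathcal A^{(n)}=\{t\in A\mid t<\alpha_n,\ \alpha_{n+1}<\pi(t)\text{ in }S^{(n)},\ \delta(t)=\delta(\alpha_n)\}.$$ While $\mathcal A^{(n-1)}\neq\emptyset$, $S^{(n)}$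 is obtained from $S^{(n-1)}$ by moving $\alpha_n$ immediately to the right of $\pi(t_{\max})$, where $t_{\max}=\max\mathcal A^{(n-1)}$ in $S^{(n-1)}$. Let $a$ be the least number with $\mathcal A^{(a)}=\emptyset$; the construction of the $\mathcal A^{(n)}$ stops there. Next let $$\mathcal B^{(n)}=\{t\in \tilde S\mid \beta_n<t,\ \pi(t)<\beta_{n+1}\text{ in }S^{(a+n)},\ \delta(t)=\delta(\beta_n)\}.$$ While $\mathcal B^{(n-1)}\neq\emptyset$, $S^{(a+n)}$ is obtained from $S^{(a+n-1)}$ by moving $\beta_n$ immediately to the left of $\pi(t_{\min})$, where $t_{\min}=\min\mathcal B^{(n-1)}$ in $S^{(a+n-1)}$; the construction stops when $\mathcal B^{(n)}=\emptyset$. **Proposition.** (i) For $m_1<i\le n_1$ and $1\le j\le n_2$, $\ell(S')=\ell(S)-1$ if and only if there is no $n\ge 0$ such that $\mathcal A^{(n)}$ contains $0^A_{i+m_1}$ or $\mathcal B^{(n)}$ contains $0^B_{j+m_2}$. (ii) Assume $m_1>0$ or $n_2>0$. For $m_1<i\le n_1$ and $n_2<j\le m_2$, $\ell(S')<\ell(S)-1$.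 (iii) For $n_1<i\le h_1$ and $n_2<j\le m_2$, $\ell(S')=\ell(S)-1$ if and only if the dual ABS's satisfy $\ell(S'_D)=\ell(S_D)-1$. Equivalently, the exchange of $0^A_i$ and $1^B_j$ in $S$ is good if and only if the dual exchange, of the $(h_2-j+1)$-st element of the first summand and the $(h_1-i+1)$-st element of the second summand of $N_{n_2,m_2}\oplus N_{n_1,m_1}$, is good. -/

import Mathlib

/-- An arrowed binary sequence (ABS) on a set `T`: a total order on `T`, a map `δ : T → {0, 1}`
and a bijection `π : T → T`. The order is a field and not an instance, since one and the same set
carries many orders below. -/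
structure ABS (T : Type) where
  ord : LinearOrder T
  δ : T → Fin 2
  π : Equiv.Perm T

namespace ABS

noncomputable section

open Classical in
/-- The length `ℓ(S) = #{(t', t) | δ(t') = 0, δ(t) = 1, t' < t}`. -/
def length {T : Type} [Fintype T] (S : ABS T) : ℕ :=
  (Finset.univ.filter fun p : T × T =>
    S.δ p.1 = 0 ∧ S.δ p.2 = 1 ∧ S.ord.lt p.1 p.2).card

/-- The binary expansion `b(t) = 0.b₁b₂…` with `b_k = δ(π^{-k}(t))`, as the sequence of its digits
(`b_{k+1}` in position `k`); such sequences are compared lexicographically. -/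
def binExp {T : Type} (δ : T → Fin 2) (π : Equiv.Perm T) (t : T) : Lex (ℕ → Fin 2) :=
  toLex fun k => δ ((π⁻¹ ^ (k + 1)) t)

/-- The total order on `T` by increasing values of `b`; elements with the same value of `b` are
left in the order `o`. -/
@[reducible] def sortBy {T : Type} (o : LinearOrder T) (b : T → Lex (ℕ → Fin 2)) : LinearOrder T :=
  letI := o
  LinearOrder.lift' (fun t => (toLex (b t, t) : Lex (ℕ → Fin 2) ×ₗ T))
    (fun s t h => by simpa using congrArg (fun z => (ofLex z).2) h)

/-- The ABS of `N_{m,n}`: on `t_1 < ⋯ < t_h`, `h = m + n` (here `t_{k+1}` is `k : Fin (m + n)`),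
`δ(t_i) = 1` iff `i ≤ m`, and `π(t_i) = t_{i - m mod h}`; so `π` sends the first `m` elements to the
last `m` positions and the last `n` elements to the first `n` positions, preserving order. -/
def simple (m n : ℕ) : ABS (Fin (m + n)) where
  ord := inferInstance
  δ := fun k => if (k : ℕ) < m then 1 else 0
  π := finAddFlip.trans (finCongr (Nat.add_comm n m))

/-- The direct sum `A ⊕ B`: the disjoint union with `δ` and `π` taken from `A` and `B`, ordered by
binary expansion. Elements with the same expansion, if any, keep their order inside `A` and inside
`B`, those of `A` coming first. -/
def directSum {U V : Type} (A : ABS U) (B : ABS V) : ABS (U ⊕ V) :=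
  let δ : U ⊕ V → Fin 2 := Sum.elim A.δ B.δ
  let π : Equiv.Perm (U ⊕ V) := Equiv.sumCongr A.π B.π
  { ord := sortBy
      (letI := A.ord
       letI := B.ord
       LinearOrder.lift' (toLex : U ⊕ V → U ⊕ₗ V) toLex.injective)
      (binExp δ π)
    δ := δ
    π := π }

/-- The dual ABS. If `e_1, …, e_h` is a standard basis of a `DM₁` `N` with ABS `S`, then, since
transposition exchanges `F` and `V`, the dual basis in the reverse order is a standard basis of
the dual `N^D`: the order is reversed, `0` and `1` are exchanged, and `π` is the same map. -/
def dual {T : Type} (S : ABS T) : ABS T where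
  ord := letI := S.ord
    LinearOrder.lift' (OrderDual.toDual : T → Tᵒᵈ) OrderDual.toDual.injective
  δ := fun t => 1 - S.δ t
  π := S.π

/-- The small modification by `x` and `y` of `π₀`: `π(π₀⁻¹(x)) = y`, `π(π₀⁻¹(y)) = x`, and
`π(t) = π₀(t)` for the other `t`. -/
def smallMod {T : Type} [DecidableEq T] (π₀ : Equiv.Perm T) (x y : T) : Equiv.Perm T :=
  π₀.trans (Equiv.swap x y)

/-- The ABS `S' = (T, <', δ, π)` obtained from `S` by exchanging `x` and `y`: `π` is the small
modification, and `<'` orders `T` by the binary expansions determined by `δ` and `π`.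
If these expansions are pairwise distinct, `<'` is the unique order with `t <' t' → b(t) ≤ b(t')`,
and `δ(t) = δ(t')` implies `t <' t' ↔ π(t) <' π(t')` (`spec_ord_unique`, `spec_lt_iff_map_lt`).
Elements with the same expansion have the same symbol, so that the sequence of symbols along `<'`
and the length do not depend on how ties are broken (`length_eq_length_spec`). -/
def spec {T : Type} [DecidableEq T] (S : ABS T) (x y : T) : ABS T where
  ord := sortBy S.ord (binExp S.δ (smallMod S.π x y))
  δ := S.δ
  π := smallMod S.π x y

/-- `(S^{(0)}, δ, π)`: `π` is the small modification by `x` and `y`, and the two elements `x` and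
`y` change places in the order. -/
def initial {T : Type} [DecidableEq T] (S : ABS T) (x y : T) : ABS T where
  ord := letI := S.ord
    LinearOrder.lift' (Equiv.swap x y) (Equiv.swap x y).injective
  δ := S.δ
  π := smallMod S.π x y

/-- Move `u` to the place immediately to the right of `v`. -/
def moveRight {T : Type} [DecidableEq T] (S : ABS T) (u v : T) : ABS T where
  ord := letI := S.ord
    LinearOrder.lift'
      (fun t => (toLex (if t = u then (v, 1) else (t, 0)) : T ×ₗ Fin 2))
      (fun s t h => by
        have h' : (if s = u then (v, (1 : Fin 2)) else (s, 0)) = if t = u then (v, 1) else (t, 0) :=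
          h
        split_ifs at h' <;> simp_all)
  δ := S.δ
  π := S.π

/-- Move `u` to the place immediately to the left of `v`. -/
def moveLeft {T : Type} [DecidableEq T] (S : ABS T) (u v : T) : ABS T where
  ord := letI := S.ord
    LinearOrder.lift'
      (fun t => (toLex (if t = u then (v, 0) else (t, 1)) : T ×ₗ Fin 2))
      (fun s t h => by
        have h' : (if s = u then (v, (0 : Fin 2)) else (s, 1)) = if t = u then (v, 0) else (t, 1) :=
          h
        split_ifs at h' <;> simp_all)
  δ := S.δ
  π := S.π

open Classical in
/-- For an ABS `R` (in the role of `S^{(n)}`), a set `A` and `α` (in the role of `α_n`):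
`{t ∈ A | t < α, π(α) < π(t), δ(t) = δ(α)}`. -/
def setA {T : Type} [Fintype T] (R : ABS T) (A : Set T) (α : T) : Finset T :=
  Finset.univ.filter fun t =>
    t ∈ A ∧ R.ord.lt t α ∧ R.ord.lt (R.π α) (R.π t) ∧ R.δ t = R.δ α

open Classical in
/-- For an ABS `R` (in the role of `S^{(a+n)}`) and `β` (in the role of `β_n`):
`{t | β < t, π(t) < π(β), δ(t) = δ(β)}`. -/
def setB {T : Type} [Fintype T] (R : ABS T) (β : T) : Finset T :=
  Finset.univ.filter fun t =>
    R.ord.lt β t ∧ R.ord.lt (R.π t) (R.π β) ∧ R.δ t = R.δ β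

/-- The pairs `(S^{(n)}, 𝒜^{(n)})` for the small modification `π` of `S` by `x` and `y`, where `A` is
the set of elements of the first summand and `α_n = π^n(x)`: while `𝒜^{(n)}` is not empty, with
maximum `t_max` in `S^{(n)}`, move `α_{n+1}` to the right of `π(t_max)`. Once `𝒜^{(n)}` is empty,
the construction has stopped and nothing changes any more. -/
def stageA {T : Type} [Fintype T] [DecidableEq T] (S : ABS T) (A : Set T) (x y : T) :
    ℕ → ABS T × Finset T
  | 0 => (S.initial x y, (S.initial x y).setA A x)
  | n + 1 =>
    let R := (stageA S A x y n).1
    let E := (stageA S A x y n).2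
    let α := (R.π ^ (n + 1)) x
    if h : E.Nonempty then
      let R' := R.moveRight α (R.π (@Finset.max' T R.ord E h))
      (R', R'.setA A α)
    else (R, ∅)

/-- The smallest `a` with `𝒜^{(a)} = ∅`. -/
def stopA {T : Type} [Fintype T] [DecidableEq T] (S : ABS T) (A : Set T) (x y : T) : ℕ :=
  sInf {n | (stageA S A x y n).2 = ∅}

/-- The pairs `(S^{(a+n)}, ℬ^{(n)})`, where `a` is the smallest number with `𝒜^{(a)} = ∅` and
`β_n = π^n(y)`: while `ℬ^{(n)}` is not empty, with minimum `t_min` in `S^{(a+n)}`, move `β_{n+1}` to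
the left of `π(t_min)`. Once `ℬ^{(n)}` is empty, the construction has stopped. -/
def stageB {T : Type} [Fintype T] [DecidableEq T] (S : ABS T) (A : Set T) (x y : T) :
    ℕ → ABS T × Finset T
  | 0 =>
    let R := (stageA S A x y (stopA S A x y)).1
    (R, R.setB y)
  | n + 1 =>
    let R := (stageB S A x y n).1
    let E := (stageB S A x y n).2
    let β := (R.π ^ (n + 1)) y
    if h : E.Nonempty then
      let R' := R.moveLeft β (R.π (@Finset.min' T R.ord E h))
      (R', R'.setB β)
    else (R, ∅)

/-- The ABS `A ⊕ B` of the minimal `DM₁` `N_ξ`, `ξ = (m₁, n₁) + (m₂, n₂)`, where `A` and `B` are the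
ABS's of `N_{m₁,n₁}` and `N_{m₂,n₂}`. -/
def twoSegment (m₁ n₁ m₂ n₂ : ℕ) : ABS (Fin (m₁ + n₁) ⊕ Fin (m₂ + n₂)) :=
  directSum (simple m₁ n₁) (simple m₂ n₂)

/-- `symA i` is the `i`-th element `τ^A_i` of `A` (numbered from `1`) in the set of `A ⊕ B`. -/
def symA {h₁ h₂ : ℕ} (i : ℕ) (hi : 1 ≤ i ∧ i ≤ h₁) : Fin h₁ ⊕ Fin h₂ :=
  Sum.inl ⟨i - 1, by omega⟩

/-- `symB j` is the `j`-th element `τ^B_j` of `B` (numbered from `1`) in the set of `A ⊕ B`. -/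
def symB {h₁ h₂ : ℕ} (j : ℕ) (hj : 1 ≤ j ∧ j ≤ h₂) : Fin h₁ ⊕ Fin h₂ :=
  Sum.inr ⟨j - 1, by omega⟩

/-- The sets `𝒜^{(n)}` for the small modification by `x` and `y` of the `π₀` of `A ⊕ B`. -/
def calA (m₁ n₁ m₂ n₂ : ℕ) (x y : Fin (m₁ + n₁) ⊕ Fin (m₂ + n₂)) (n : ℕ) :
    Finset (Fin (m₁ + n₁) ⊕ Fin (m₂ + n₂)) :=
  (stageA (twoSegment m₁ n₁ m₂ n₂) (Set.range Sum.inl) x y n).2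

/-- The sets `ℬ^{(n)}` for the small modification by `x` and `y` of the `π₀` of `A ⊕ B`. -/
def calB (m₁ n₁ m₂ n₂ : ℕ) (x y : Fin (m₁ + n₁) ⊕ Fin (m₂ + n₂)) (n : ℕ) :
    Finset (Fin (m₁ + n₁) ⊕ Fin (m₂ + n₂)) :=
  (stageB (twoSegment m₁ n₁ m₂ n₂) (Set.range Sum.inl) x y n).2

end

/-! Facts showing that `spec` is what it should be. -/

theorem spec_lt_iff {T : Type} [DecidableEq T] (S : ABS T) (x y s t : T) :
    (S.spec x y).ord.lt s t ↔
      binExp S.δ (smallMod S.π x y) s < binExp S.δ (smallMod S.π x y) t ∨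
        binExp S.δ (smallMod S.π x y) s = binExp S.δ (smallMod S.π x y) t ∧ S.ord.lt s t := by
  let := S.ord
  exact Prod.Lex.lt_iff (x := (toLex (binExp S.δ (smallMod S.π x y) s, s)))
    (y := (toLex (binExp S.δ (smallMod S.π x y) t, t)))

theorem spec_ord_unique {T : Type} [DecidableEq T] (S : ABS T) (x y : T)
    (hb : Function.Injective (binExp S.δ (smallMod S.π x y))) (o : LinearOrder T)
    (ho : ∀ s t, o.lt s t →
      binExp S.δ (smallMod S.π x y) s ≤ binExp S.δ (smallMod S.π x y) t) (s t : T) :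
    o.lt s t ↔ (S.spec x y).ord.lt s t := by
  rw [spec_lt_iff]
  constructor
  · intro h
    rcases (ho s t h).lt_or_eq with h1 | h1
    · exact Or.inl h1
    · exact absurd (hb h1) (@ne_of_lt T o.toPreorder s t h)
  · rintro (h | ⟨h, h'⟩)
    · rcases @lt_trichotomy T o s t with h1 | h1 | h1
      · exact h1
      · subst h1; exact absurd h (lt_irrefl _)
      · exact absurd h (not_lt.mpr (ho t s h1))
    · exact absurd (hb h) (@ne_of_lt T S.ord.toPreorder s t h')

/-- The expansion of `π t` is the digit `δ t` followed by the expansion of `t`. -/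
theorem binExp_map_lt_iff {T : Type} (δ : T → Fin 2) (π : Equiv.Perm T) (s t : T)
    (h : δ s = δ t) : binExp δ π (π s) < binExp δ π (π t) ↔ binExp δ π s < binExp δ π t := by
  have e : ∀ (u : T) (k : ℕ), (π⁻¹ ^ (k + 1)) (π u) = (π⁻¹ ^ k) u := by
    intro u k
    rw [pow_succ, Equiv.Perm.mul_apply]
    simp
  change (∃ k, _) ↔ (∃ k, _)
  constructor
  · rintro ⟨k, h1, h2⟩
    cases k with
    | zero =>
      have h3 : δ ((π⁻¹ ^ (0 + 1)) (π s)) < δ ((π⁻¹ ^ (0 + 1)) (π t)) := h2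
      rw [e, e] at h3
      exact absurd h3 (by simp [h])
    | succ k =>
      refine ⟨k, fun j hj => ?_, ?_⟩
      · have h3 : δ ((π⁻¹ ^ (j + 1 + 1)) (π s)) = δ ((π⁻¹ ^ (j + 1 + 1)) (π t)) :=
          h1 (j + 1) (Nat.succ_lt_succ hj)
        rw [e, e] at h3
        exact h3
      · have h3 : δ ((π⁻¹ ^ (k + 1 + 1)) (π s)) < δ ((π⁻¹ ^ (k + 1 + 1)) (π t)) := h2
        rw [e, e] at h3
        exact h3
  · rintro ⟨k, h1, h2⟩
    refine ⟨k + 1, fun j hj => ?_, ?_⟩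
    · change δ ((π⁻¹ ^ (j + 1)) (π s)) = δ ((π⁻¹ ^ (j + 1)) (π t))
      rw [e, e]
      cases j with
      | zero => simpa using h
      | succ j => exact h1 j (Nat.lt_of_succ_lt_succ hj)
    · change δ ((π⁻¹ ^ (k + 1 + 1)) (π s)) < δ ((π⁻¹ ^ (k + 1 + 1)) (π t))
      rw [e, e]
      exact h2

theorem spec_lt_iff_map_lt {T : Type} [DecidableEq T] (S : ABS T) (x y : T)
    (hb : Function.Injective (binExp S.δ (smallMod S.π x y))) (s t : T) (h : S.δ s = S.δ t) :
    (S.spec x y).ord.lt s t ↔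
      (S.spec x y).ord.lt ((S.spec x y).π s) ((S.spec x y).π t) := by
  have key : ∀ u v, (S.spec x y).ord.lt u v ↔
      binExp S.δ (smallMod S.π x y) u < binExp S.δ (smallMod S.π x y) v := by
    intro u v
    rw [spec_lt_iff]
    refine ⟨?_, Or.inl⟩
    rintro (h | ⟨h, h'⟩)
    · exact h
    · exact absurd (hb h) (@ne_of_lt T S.ord.toPreorder u v h')
  rw [key, key]
  exact (binExp_map_lt_iff S.δ (smallMod S.π x y) s t h).symm

/-- Elements with the same expansion carry the same symbol. -/
theorem δ_eq_of_binExp_eq {T : Type} [Finite T] (δ : T → Fin 2) (π : Equiv.Perm T) (s t : T)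
    (h : binExp δ π s = binExp δ π t) : δ s = δ t := by
  obtain ⟨n, hn, hp⟩ := (isOfFinOrder_of_finite π⁻¹).exists_pow_eq_one
  obtain ⟨k, rfl⟩ : ∃ k, n = k + 1 := ⟨n - 1, by omega⟩
  have h1 : δ ((π⁻¹ ^ (k + 1)) s) = δ ((π⁻¹ ^ (k + 1)) t) := congrFun (congrArg ofLex h) k
  simpa [hp] using h1

/-- Every ordering by expansions gives the same length. -/
theorem length_eq_length_spec {T : Type} [Fintype T] [DecidableEq T] (S : ABS T) (x y : T)
    (R : ABS T) (hδ : R.δ = S.δ)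
    (hR : ∀ s t, R.ord.lt s t →
      binExp S.δ (smallMod S.π x y) s ≤ binExp S.δ (smallMod S.π x y) t) :
    R.length = (S.spec x y).length := by
  unfold length
  congr 1
  ext p
  simp only [Finset.mem_filter, Finset.mem_univ, true_and]
  rw [hδ]
  change (S.δ p.1 = 0 ∧ S.δ p.2 = 1 ∧ _) ↔ (S.δ p.1 = 0 ∧ S.δ p.2 = 1 ∧ _)
  refine and_congr_right fun h0 => and_congr_right fun h1 => ?_
  have hne : binExp S.δ (smallMod S.π x y) p.1 ≠ binExp S.δ (smallMod S.π x y) p.2 := by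
    intro h
    have := δ_eq_of_binExp_eq _ _ _ _ h
    rw [h0, h1] at this
    exact absurd this (by decide)
  rw [spec_lt_iff]
  constructor
  · intro h
    exact Or.inl (lt_of_le_of_ne (hR _ _ h) hne)
  · rintro (h | ⟨h, -⟩)
    · rcases @lt_trichotomy T R.ord p.1 p.2 with h2 | h2 | h2
      · exact h2
      · rw [h2] at h; exact absurd h (lt_irrefl _)
      · exact absurd h (not_lt.mpr (hR _ _ h2))
    · exact absurd h hne

end ABS

namespace ABS

/-! Write x and y for the exchanged elements, κ for the position in A ⊕ B, k for the position after
x and y have changed places, and b for the expansion with respect to the modified π. Since π is π₀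
followed by a transposition, k(π t) = κ(π₀ t). So π carries the equal-symbol pairs that are
increasing for κ and decreasing for b bijectively onto all pairs that are increasing for k and
decreasing for b. Comparing the inversions of b against κ with those against k gives ℓ(S) - ℓ(S') =
1 + 2W + L + L'. Here W counts the (0,1)-pairs lost in S' that the interchange does not reverse, L
the equal-symbol pairs that the interchange reverses and b does not, and L' ≤ L those of the latter
that b orders strictly. Hence `count_drop`: the length drops, and by exactly one iff `IsGood` holds.

The order of A ⊕ B consists of four zones: the first n₁ elements of A, the first n₂ of B, the last
m₁ of A, the last m₂ of B (`twoSegment_lt_iff`). Let w and v be the π₀-predecessors of x and y.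

For (ii), suppose the exchange is good. If m₁ > 0, then w is a zero between x and y, so b must
reverse the pair (x, w). Under π, w goes to y, which leaves an element of A in front of an element
of B with expansions in the wrong order. Following this pair along π, one finds either a lost
(0,1)-pair or a pair that b had to reverse and did not. If m₁ = 0, the predecessor v of y plays the
same role.

For (i), the elements between x and y are zeros of A and ones of B. Each is followed along π as long
as its symbols agree with those met from x, respectively y; what remains are the `survivors`. If
neither w nor v ever survives, a pair on which b contradicts k lies inside one summand, where ones
precede zeros, so no (0,1)-pair is lost and the exchange is good. If w or v survives, a
contradiction as in (ii) results. The link with 𝒜 and ℬ is `MoveProcess.invariant`: until the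
predecessor occurs, the n-th set is the set of survivors of level n, because each move passes
exactly the images of survivors. The sets ℬ obey the same law in the reversed order.

For (iii), length is a count of pairs compared by expansions (`binCount`), which an isomorphism
exchanging the two symbols preserves. -/

/-! ### Counting the drop in length. -/

open Finset in
theorem card_filter_split {α : Type*} [Fintype α] (P Q : α → Prop) [DecidablePred P]
    [DecidablePred Q] :
    (univ.filter P).card
      = (univ.filter fun a => P a ∧ Q a).card + (univ.filter fun a => P a ∧ ¬ Q a).card := by
  rw [← filter_filter, ← filter_filter, card_filter_add_card_filter_not]

/-- A position function `κ` compatible with `δ` and `π₀`: images of zeros precede images of ones,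
and `π₀` preserves the order of elements with equal symbols. -/
structure IsStable {T : Type} (κ : T → ℕ) (δ : T → Fin 2) (π₀ : Equiv.Perm T) : Prop where
  inj : Function.Injective κ
  zero_one : ∀ s t, δ s = 0 → δ t = 1 → κ (π₀ s) < κ (π₀ t)
  same : ∀ s t, δ s = δ t → (κ (π₀ s) < κ (π₀ t) ↔ κ s < κ t)

theorem fin_two_cases (a : Fin 2) : a = 0 ∨ a = 1 := by omega

theorem binExp_zero_one {T : Type} (δ : T → Fin 2) (π : Equiv.Perm T) {s t : T}
    (hs : δ s = 0) (ht : δ t = 1) : binExp δ π (π s) < binExp δ π (π t) := by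
  change ∃ k, _
  refine ⟨0, fun j hj => absurd hj (Nat.not_lt_zero _), ?_⟩
  change δ ((π⁻¹ ^ (0 + 1)) (π s)) < δ ((π⁻¹ ^ (0 + 1)) (π t))
  simp [hs, ht]

variable {T : Type}

/-- The position in the order in which `x` and `y` are interchanged. -/
def swapPos [DecidableEq T] (κ : T → ℕ) (x y : T) (t : T) : ℕ := κ (Equiv.swap x y t)

theorem swapPos_smallMod [DecidableEq T] (κ : T → ℕ) (π₀ : Equiv.Perm T) (x y t : T) :
    swapPos κ x y (smallMod π₀ x y t) = κ (π₀ t) := by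
  simp [swapPos, smallMod]

theorem swapPos_left [DecidableEq T] (κ : T → ℕ) (x y : T) : swapPos κ x y x = κ y := by
  simp [swapPos]

theorem swapPos_right [DecidableEq T] (κ : T → ℕ) (x y : T) : swapPos κ x y y = κ x := by
  simp [swapPos]

theorem swapPos_of_ne [DecidableEq T] (κ : T → ℕ) {x y t : T} (hx : t ≠ x) (hy : t ≠ y) :
    swapPos κ x y t = κ t := by
  simp [swapPos, Equiv.swap_apply_of_ne_of_ne hx hy]

theorem swapPos_injective [DecidableEq T] {κ : T → ℕ} (hκ : Function.Injective κ) (x y : T) :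
    Function.Injective (swapPos κ x y) :=
  hκ.comp (Equiv.swap x y).injective

/-- The pairs whose order is reversed by interchanging `x` and `y`. -/
theorem reversed_cases [DecidableEq T] {κ : T → ℕ} (hκ : Function.Injective κ) {x y : T}
    (hxy : κ x < κ y) {s t : T} :
    (κ s < κ t ∧ swapPos κ x y t < swapPos κ x y s) ↔
      (s = x ∧ κ x < κ t ∧ κ t ≤ κ y) ∨ (t = y ∧ κ x < κ s ∧ κ s < κ y) := by
  have hne : x ≠ y := fun h => by simp [h] at hxy
  have e1 : ∀ u, (u = x ∧ u ≠ y ∧ swapPos κ x y u = κ y ∧ κ u = κ x) ∨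
      (u = y ∧ u ≠ x ∧ swapPos κ x y u = κ x ∧ κ u = κ y) ∨
      (u ≠ x ∧ u ≠ y ∧ swapPos κ x y u = κ u ∧ κ u ≠ κ x ∧ κ u ≠ κ y) := by
    intro u
    by_cases h1 : u = x
    · subst h1; exact Or.inl ⟨rfl, hne, swapPos_left κ u y, rfl⟩
    by_cases h2 : u = y
    · subst h2; exact Or.inr (Or.inl ⟨rfl, hne.symm, swapPos_right κ x u, rfl⟩)
    · exact Or.inr (Or.inr ⟨h1, h2, swapPos_of_ne κ h1 h2, fun h => h1 (hκ h), fun h => h2 (hκ h)⟩)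
  rcases e1 s with ⟨s1, s2, s3, s4⟩ | ⟨s1, s2, s3, s4⟩ | ⟨s1, s2, s3, s4, s5⟩ <;>
    rcases e1 t with ⟨t1, t2, t3, t4⟩ | ⟨t1, t2, t3, t4⟩ | ⟨t1, t2, t3, t4, t5⟩ <;>
    simp only [s3, t3] <;> grind

/-- The two conditions which together say that the length drops by exactly one. -/
structure IsGood [DecidableEq T] (κ : T → ℕ) (δ : T → Fin 2) (π₀ : Equiv.Perm T) (x y : T) :
    Prop where
  no_loss : ∀ s t, κ s < κ t → δ s = 0 → δ t = 1 →
    binExp δ (smallMod π₀ x y) t < binExp δ (smallMod π₀ x y) s →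
    swapPos κ x y t < swapPos κ x y s
  reversed : ∀ s t, κ s < κ t → swapPos κ x y t < swapPos κ x y s → δ s = δ t →
    binExp δ (smallMod π₀ x y) t < binExp δ (smallMod π₀ x y) s

-- Each z strictly between x and y accounts for one pair of each kind: if z is a one, (z, y) has
-- equal symbols and (x, z) is a (0,1)-pair, and if z is a zero the roles are exchanged. The surplus
-- is the pair (x, y) itself.
open Finset Classical in
theorem card_reversed [Fintype T] [DecidableEq T] {κ : T → ℕ} (hκ : Function.Injective κ)
    {δ : T → Fin 2} {x y : T} (hxy : κ x < κ y) (hx : δ x = 0) (hy : δ y = 1) :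
    (univ.filter fun p : T × T => (κ p.1 < κ p.2 ∧ swapPos κ x y p.2 < swapPos κ x y p.1) ∧
        (δ p.1 = 0 ∧ δ p.2 = 1)).card
      = (univ.filter fun p : T × T => (κ p.1 < κ p.2 ∧ swapPos κ x y p.2 < swapPos κ x y p.1) ∧
        δ p.1 = δ p.2).card + 1 := by
  set Z := univ.filter fun z : T => κ x < κ z ∧ κ z < κ y with hZ
  have hyZ : y ∉ Z := by simp [hZ]
  have hxZ : x ∉ Z := by simp [hZ]
  have hne : x ≠ y := fun h => by simp [h] at hxy
  have h1 : (univ.filter fun p : T × T => (κ p.1 < κ p.2 ∧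
      swapPos κ x y p.2 < swapPos κ x y p.1) ∧ δ p.1 = δ p.2)
      = Z.image fun z => if δ z = 1 then (z, y) else (x, z) := by
    ext ⟨s, t⟩
    simp only [mem_filter, mem_univ, true_and, mem_image, reversed_cases hκ hxy, hZ]
    constructor
    · rintro ⟨⟨rfl, h1, h2⟩ | ⟨rfl, h1, h2⟩, h3⟩
      · have h4 : t ≠ y := by rintro rfl; simp [hx, hy] at h3
        have h5 := fun h => h4 (hκ h)
        refine ⟨t, ⟨h1, lt_of_le_of_ne h2 h5⟩, ?_⟩
        rw [← h3, hx]; simp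
      · exact ⟨s, ⟨h1, h2⟩, by rw [h3, hy]; simp⟩
    · rintro ⟨z, ⟨h1, h2⟩, h3⟩
      split_ifs at h3 with h4 <;> obtain ⟨rfl, rfl⟩ := Prod.mk.inj h3
      · exact ⟨Or.inr ⟨rfl, h1, h2⟩, by rw [h4, hy]⟩
      · exact ⟨Or.inl ⟨rfl, h1, h2.le⟩, hx.trans ((fin_two_cases _).resolve_right h4).symm⟩
  have h2 : (univ.filter fun p : T × T => (κ p.1 < κ p.2 ∧
      swapPos κ x y p.2 < swapPos κ x y p.1) ∧ (δ p.1 = 0 ∧ δ p.2 = 1))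
      = (insert y Z).image fun z => if δ z = 1 then (x, z) else (z, y) := by
    ext ⟨s, t⟩
    simp only [mem_filter, mem_univ, true_and, mem_image, mem_insert, reversed_cases hκ hxy, hZ]
    constructor
    · rintro ⟨⟨rfl, h1, h2⟩ | ⟨rfl, h1, h2⟩, h3, h4⟩
      · refine ⟨t, ?_, by simp [h4]⟩
        rcases h2.lt_or_eq with h | h
        · exact Or.inr ⟨h1, h⟩
        · exact Or.inl (hκ h)
      · exact ⟨s, Or.inr ⟨h1, h2⟩, by simp [h3]⟩
    · rintro ⟨z, h, h3⟩
      have hz : κ x < κ z ∧ κ z ≤ κ y := by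
        rcases h with rfl | h
        · exact ⟨hxy, le_rfl⟩
        · exact ⟨h.1, h.2.le⟩
      split_ifs at h3 with h4 <;> obtain ⟨rfl, rfl⟩ := Prod.mk.inj h3
      · exact ⟨Or.inl ⟨rfl, hz⟩, hx, h4⟩
      · rcases h with rfl | h
        · exact absurd hy h4
        · exact ⟨Or.inr ⟨rfl, h⟩, (fin_two_cases _).resolve_right h4, hy⟩
  rw [h1, h2, card_image_of_injOn, card_image_of_injOn, card_insert_of_notMem hyZ]
  · intro a ha b hb hab
    have ha' : a ≠ x ∧ a ≠ y := ⟨fun h => hxZ (h ▸ ha), fun h => hyZ (h ▸ ha)⟩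
    have hb' : b ≠ x ∧ b ≠ y := ⟨fun h => hxZ (h ▸ hb), fun h => hyZ (h ▸ hb)⟩
    dsimp only at hab
    split_ifs at hab <;> simp_all
  · intro a ha b hb hab
    have key : ∀ c ∈ insert y Z, c ≠ x := by
      intro c hc h
      rcases mem_insert.1 hc with h' | h'
      · exact hne (h ▸ h')
      · exact hxZ (h ▸ h')
    have ha' := key a ha
    have hb' := key b hb
    dsimp only at hab
    split_ifs at hab with h1 h2 h2
    · simpa using hab
    · exact absurd (Prod.mk.inj hab).1.symm hb'
    · exact absurd (Prod.mk.inj hab).1 ha'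
    · exact (Prod.mk.inj hab).1

open Finset Classical in
/-- The length drops by at least one, and by exactly one iff `IsGood`. -/
theorem count_drop [Fintype T] [DecidableEq T] {κ : T → ℕ} {δ : T → Fin 2} {π₀ : Equiv.Perm T}
    (hS : IsStable κ δ π₀) {x y : T} (hxy : κ x < κ y) (hx : δ x = 0) (hy : δ y = 1) :
    (univ.filter fun p : T × T => δ p.1 = 0 ∧ δ p.2 = 1 ∧
        binExp δ (smallMod π₀ x y) p.1 < binExp δ (smallMod π₀ x y) p.2).card + 1
      ≤ (univ.filter fun p : T × T => δ p.1 = 0 ∧ δ p.2 = 1 ∧ κ p.1 < κ p.2).card ∧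
    ((univ.filter fun p : T × T => δ p.1 = 0 ∧ δ p.2 = 1 ∧
        binExp δ (smallMod π₀ x y) p.1 < binExp δ (smallMod π₀ x y) p.2).card + 1
      = (univ.filter fun p : T × T => δ p.1 = 0 ∧ δ p.2 = 1 ∧ κ p.1 < κ p.2).card ↔
      IsGood κ δ π₀ x y) := by
  set π := smallMod π₀ x y with hπ
  set b := binExp δ π with hb
  set k := swapPos κ x y with hk
  have hkinj : Function.Injective k := swapPos_injective hS.inj x y
  have tie : ∀ {s t}, δ s = 0 → δ t = 1 → b s ≠ b t := by
    intro s t h0 h1 h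
    have := δ_eq_of_binExp_eq _ _ _ _ h
    rw [h0, h1] at this
    exact absurd this (by decide)
  have hκne : ∀ {s t}, δ s = 0 → δ t = 1 → κ s ≠ κ t := by
    intro s t h0 h1 h
    have := hS.inj h
    rw [this, h1] at h0
    exact absurd h0 (by decide)
  let c := fun P : T × T → Prop => (univ.filter P).card
  have F : ∀ P Q : T × T → Prop, c P = c (fun p => P p ∧ Q p) + c (fun p => P p ∧ ¬ Q p) := by
    intro P Q
    have := card_filter_split P Q
    simp only [c]
    convert this
  have hc0 : ∀ P : T × T → Prop, c P = 0 ↔ ∀ p, ¬ P p := by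
    intro P
    simp only [c, card_eq_zero, filter_eq_empty_iff, mem_univ, true_implies]
  have cc : ∀ P Q : T × T → Prop, (∀ p, P p ↔ Q p) → c P = c Q := by
    intro P Q h
    have : P = Q := funext fun p => propext (h p)
    rw [this]
  -- `R` counts the (0,1)-pairs kept, `P` those lost and `Q` those gained, so the drop is `P - Q`.
  let R := c fun p => (δ p.1 = 0 ∧ δ p.2 = 1 ∧ κ p.1 < κ p.2) ∧ b p.1 < b p.2
  let P := c fun p => (δ p.1 = 0 ∧ δ p.2 = 1 ∧ κ p.1 < κ p.2) ∧ ¬ b p.1 < b p.2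
  let Q := c fun p => (δ p.1 = 0 ∧ δ p.2 = 1 ∧ b p.1 < b p.2) ∧ ¬ κ p.1 < κ p.2
  have hN : c (fun p => δ p.1 = 0 ∧ δ p.2 = 1 ∧ κ p.1 < κ p.2) = R + P := F _ _
  have hN' : c (fun p => δ p.1 = 0 ∧ δ p.2 = 1 ∧ b p.1 < b p.2) = R + Q := by
    rw [show R = c fun p => (δ p.1 = 0 ∧ δ p.2 = 1 ∧ b p.1 < b p.2) ∧ κ p.1 < κ p.2 from
      cc _ _ fun p => by tauto]
    exact F _ _
  let I := c fun p => κ p.1 < κ p.2 ∧ b p.2 < b p.1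
  let Ie := c fun p => (κ p.1 < κ p.2 ∧ b p.2 < b p.1) ∧ δ p.1 = δ p.2
  have hI : I = Ie + P + Q := by
    have h1 : I = Ie + _ := F _ _
    have h2 : c (fun p => (κ p.1 < κ p.2 ∧ b p.2 < b p.1) ∧ ¬ δ p.1 = δ p.2) = _ + _ :=
      F _ fun p => δ p.1 = 0
    have h3 : P = c fun p => ((κ p.1 < κ p.2 ∧ b p.2 < b p.1) ∧ ¬ δ p.1 = δ p.2) ∧ δ p.1 = 0 := by
      refine cc _ _ fun p => ⟨?_, ?_⟩
      · rintro ⟨⟨a1, a2, a3⟩, a4⟩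
        exact ⟨⟨⟨a3, lt_of_le_of_ne (not_lt.1 a4) (tie a1 a2).symm⟩, by rw [a1, a2]; decide⟩, a1⟩
      · rintro ⟨⟨⟨a1, a2⟩, a3⟩, a4⟩
        exact ⟨⟨a4, by omega, a1⟩, not_lt.2 a2.le⟩
    have h4 : Q = c fun p => ((κ p.1 < κ p.2 ∧ b p.2 < b p.1) ∧ ¬ δ p.1 = δ p.2) ∧
        ¬ δ p.1 = 0 := by
      refine card_bij' (fun p _ => p.swap) (fun p _ => p.swap) ?_ ?_ ?_ ?_
      · rintro ⟨s, t⟩ h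
        simp only [mem_filter, mem_univ, true_and, Prod.swap] at h ⊢
        obtain ⟨⟨a1, a2, a3⟩, a4⟩ := h
        have := hκne a1 a2
        exact ⟨⟨⟨by omega, a3⟩, by rw [a1, a2]; decide⟩, by rw [a2]; decide⟩
      · rintro ⟨s, t⟩ h
        simp only [mem_filter, mem_univ, true_and, Prod.swap] at h ⊢
        obtain ⟨⟨⟨a1, a2⟩, a3⟩, a4⟩ := h
        exact ⟨⟨by omega, by omega, a2⟩, by omega⟩
      · simp
      · simp
    omega
  let V := c fun p => k p.1 < k p.2 ∧ b p.2 < b p.1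
  -- The bijection is π. Images of zeros precede images of ones both for `k` and for `b`, so a pair
  -- on which the two disagree comes from equal symbols.
  have hV : V = Ie := by
    symm
    refine card_bij' (fun p _ => (π p.1, π p.2)) (fun p _ => (π.symm p.1, π.symm p.2)) ?_ ?_ ?_ ?_
    · rintro ⟨s, t⟩ h
      simp only [mem_filter, mem_univ, true_and] at h ⊢
      obtain ⟨⟨a1, a2⟩, a3⟩ := h
      rw [hk, hπ, swapPos_smallMod, swapPos_smallMod, hS.same _ _ a3, ← hπ, hb,
        binExp_map_lt_iff _ _ _ _ a3.symm]
      exact ⟨a1, a2⟩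
    · rintro ⟨s, t⟩ h
      simp only [mem_filter, mem_univ, true_and] at h ⊢
      obtain ⟨s, rfl⟩ := π.surjective s
      obtain ⟨t, rfl⟩ := π.surjective t
      simp only [Equiv.symm_apply_apply]
      rw [hk, hπ, swapPos_smallMod, swapPos_smallMod, ← hπ] at h
      have a3 : δ s = δ t := by
        rcases fin_two_cases (δ s) with e1 | e1 <;> rcases fin_two_cases (δ t) with e2 | e2
        · rw [e1, e2]
        · exact absurd h.2 (not_lt.2 (binExp_zero_one δ π e1 e2).le)
        · exact absurd h.1 (not_lt.2 (hS.zero_one _ _ e2 e1).le)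
        · rw [e1, e2]
      rw [hS.same _ _ a3, hb, binExp_map_lt_iff _ _ _ _ a3.symm] at h
      exact ⟨h, a3⟩
    · simp
    · simp
  -- After the common part `B` is removed, `I` and `V` differ only in pairs that the interchange of
  -- x and y reverses.
  let B := c fun p => (κ p.1 < κ p.2 ∧ b p.2 < b p.1) ∧ k p.1 < k p.2
  let Li := c fun p => (κ p.1 < κ p.2 ∧ b p.2 < b p.1) ∧ ¬ k p.1 < k p.2
  let Ls := c fun p => (k p.1 < k p.2 ∧ b p.2 < b p.1) ∧ ¬ κ p.1 < κ p.2
  have hI2 : I = B + Li := F _ _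
  have hV2 : V = B + Ls := by
    rw [show B = c fun p => (k p.1 < k p.2 ∧ b p.2 < b p.1) ∧ κ p.1 < κ p.2 from
      cc _ _ fun p => by tauto]
    exact F _ _
  let W := c fun p => ((δ p.1 = 0 ∧ δ p.2 = 1 ∧ κ p.1 < κ p.2) ∧ ¬ b p.1 < b p.2) ∧ k p.1 < k p.2
  let Li1 := c fun p => ((δ p.1 = 0 ∧ δ p.2 = 1 ∧ κ p.1 < κ p.2) ∧ ¬ b p.1 < b p.2) ∧
    ¬ k p.1 < k p.2
  have hP : P = W + Li1 := F _ _
  let L0 := c fun p => (κ p.1 < κ p.2 ∧ k p.2 < k p.1) ∧ δ p.1 = δ p.2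
  let L1 := c fun p => (κ p.1 < κ p.2 ∧ k p.2 < k p.1) ∧ (δ p.1 = 0 ∧ δ p.2 = 1)
  have hL : L1 = L0 + 1 := by
    have := card_reversed hS.inj hxy hx hy
    simp only [L1, L0, c]
    convert this
  have hsym : ∀ {s t}, κ s < κ t → k t < k s → δ s = δ t ∨ (δ s = 0 ∧ δ t = 1) := by
    intro s t h1 h2
    rcases (reversed_cases hS.inj hxy).1 ⟨h1, h2⟩ with ⟨rfl, -⟩ | ⟨rfl, -⟩
    · rcases fin_two_cases (δ t) with e | e <;> simp [e, hx]
    · rcases fin_two_cases (δ s) with e | e <;> simp [e, hy]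
  have hknlt : ∀ {s t : T}, κ s < κ t → ¬ k s < k t → k t < k s := by
    intro s t h1 h2
    refine lt_of_le_of_ne (not_lt.1 h2) fun h => ?_
    rw [hkinj h] at h1
    exact lt_irrefl _ h1
  have hκnlt : ∀ {s t : T}, k s < k t → ¬ κ s < κ t → κ t < κ s := by
    intro s t h1 h2
    refine lt_of_le_of_ne (not_lt.1 h2) fun h => ?_
    rw [hS.inj h] at h1
    exact lt_irrefl _ h1
  let Li0 := c fun p => ((κ p.1 < κ p.2 ∧ k p.2 < k p.1) ∧ δ p.1 = δ p.2) ∧ b p.2 < b p.1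
  let Ln0 := c fun p => ((κ p.1 < κ p.2 ∧ k p.2 < k p.1) ∧ δ p.1 = δ p.2) ∧ ¬ b p.2 < b p.1
  have hL0 : L0 = Li0 + Ln0 := F _ _
  have hLi : Li = Li0 + Li1 := by
    have h1 : Li = _ + _ := F _ fun p => δ p.1 = δ p.2
    rw [h1]
    refine congrArg₂ _ (cc _ _ fun p => ⟨?_, ?_⟩) (cc _ _ fun p => ⟨?_, ?_⟩)
    · rintro ⟨⟨⟨a1, a2⟩, a3⟩, a4⟩
      exact ⟨⟨⟨a1, hknlt a1 a3⟩, a4⟩, a2⟩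
    · rintro ⟨⟨⟨a1, a2⟩, a3⟩, a4⟩
      exact ⟨⟨⟨a1, a4⟩, not_lt.2 a2.le⟩, a3⟩
    · rintro ⟨⟨⟨a1, a2⟩, a3⟩, a4⟩
      rcases hsym a1 (hknlt a1 a3) with h | h
      · exact absurd h a4
      · exact ⟨⟨⟨h.1, h.2, a1⟩, not_lt.2 a2.le⟩, a3⟩
    · rintro ⟨⟨⟨a1, a2, a3⟩, a4⟩, a5⟩
      exact ⟨⟨⟨a3, lt_of_le_of_ne (not_lt.1 a4) (tie a1 a2).symm⟩, a5⟩, by rw [a1, a2]; decide⟩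
  let Lt := c fun p => ((κ p.1 < κ p.2 ∧ k p.2 < k p.1) ∧ δ p.1 = δ p.2) ∧ b p.1 < b p.2
  have hLt : Lt ≤ Ln0 := by
    refine card_le_card fun p => ?_
    simp only [mem_filter, mem_univ, true_and]
    rintro ⟨a1, a2⟩
    exact ⟨a1, not_lt.2 a2.le⟩
  let Ls1 := c fun p => ((κ p.1 < κ p.2 ∧ k p.2 < k p.1) ∧ (δ p.1 = 0 ∧ δ p.2 = 1)) ∧ b p.1 < b p.2
  have hL1 : L1 = Ls1 + Li1 := by
    have h1 : L1 = _ + _ := F _ fun p => b p.1 < b p.2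
    rw [h1]
    refine congrArg₂ _ rfl (cc _ _ fun p => ⟨?_, ?_⟩)
    · rintro ⟨⟨⟨a1, a2⟩, a3, a4⟩, a5⟩
      exact ⟨⟨⟨a3, a4, a1⟩, a5⟩, not_lt.2 a2.le⟩
    · rintro ⟨⟨⟨a1, a2, a3⟩, a4⟩, a5⟩
      exact ⟨⟨⟨a3, hknlt a3 a5⟩, a1, a2⟩, a4⟩
  have hLs : Ls = Lt + Ls1 := by
    have h0 : Ls = c fun p => (κ p.1 < κ p.2 ∧ k p.2 < k p.1) ∧ b p.1 < b p.2 := by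
      refine card_bij' (fun p _ => p.swap) (fun p _ => p.swap) ?_ ?_ ?_ ?_
      · rintro ⟨s, t⟩ h
        simp only [mem_filter, mem_univ, true_and, Prod.swap] at h ⊢
        obtain ⟨⟨a1, a2⟩, a3⟩ := h
        exact ⟨⟨hκnlt a1 a3, a1⟩, a2⟩
      · rintro ⟨s, t⟩ h
        simp only [mem_filter, mem_univ, true_and, Prod.swap] at h ⊢
        obtain ⟨⟨a1, a2⟩, a3⟩ := h
        exact ⟨⟨a2, a3⟩, not_lt.2 a1.le⟩
      · simp
      · simp
    rw [h0]
    refine (F _ fun p => δ p.1 = δ p.2).trans ?_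
    refine congrArg₂ _ (cc _ _ fun p => by tauto) (cc _ _ fun p => ⟨?_, ?_⟩)
    · rintro ⟨⟨⟨a1, a2⟩, a3⟩, a4⟩
      rcases hsym a1 a2 with h | h
      · exact absurd h a4
      · exact ⟨⟨⟨a1, a2⟩, h⟩, a3⟩
    · rintro ⟨⟨⟨a1, a2⟩, a3, a4⟩, a5⟩
      exact ⟨⟨⟨a1, a2⟩, a5⟩, by rw [a3, a4]; decide⟩
  -- The identity of the drop. As `Lt ≤ Ln0`, the excess over 1 vanishes iff `W` and `Ln0` do.
  have main : R + P = R + Q + 1 + 2 * W + Ln0 + Lt := by omega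
  suffices h : R + Q + 1 ≤ R + P ∧ (R + Q + 1 = R + P ↔ IsGood κ δ π₀ x y) by
    rw [← hN, ← hN'] at h
    simp only [c] at h
    convert h
  refine ⟨by omega, ?_⟩
  have hW0 : W = 0 ↔ ∀ s t, κ s < κ t → δ s = 0 → δ t = 1 → b t < b s → k t < k s := by
    rw [hc0]
    constructor
    · intro h s t a1 a2 a3 a4
      have := h (s, t)
      exact hknlt a1 fun a5 => this ⟨⟨⟨a2, a3, a1⟩, not_lt.2 a4.le⟩, a5⟩
    · rintro h ⟨s, t⟩ ⟨⟨⟨a1, a2, a3⟩, a4⟩, a5⟩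
      exact absurd (h s t a3 a1 a2 (lt_of_le_of_ne (not_lt.1 a4) (tie a1 a2).symm)) (not_lt.2 a5.le)
  have hLn : Ln0 = 0 ↔ ∀ s t, κ s < κ t → k t < k s → δ s = δ t → b t < b s := by
    rw [hc0]
    constructor
    · intro h s t a1 a2 a3
      by_contra a4
      exact h (s, t) ⟨⟨⟨a1, a2⟩, a3⟩, a4⟩
    · rintro h ⟨s, t⟩ ⟨⟨⟨a1, a2⟩, a3⟩, a4⟩
      exact a4 (h s t a1 a2 a3)
  constructor
  · intro h
    exact ⟨hW0.1 (by omega), hLn.1 (by omega)⟩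
  · rintro ⟨h1, h2⟩
    have e1 := hW0.2 h1
    have e2 := hLn.2 h2
    omega

/-! ### The order of A ⊕ B in explicit positions. -/

theorem sortBy_lt_iff {T : Type} (o : LinearOrder T) (b : T → Lex (ℕ → Fin 2)) (s t : T) :
    (sortBy o b).lt s t ↔ b s < b t ∨ b s = b t ∧ o.lt s t := by
  let := o
  exact Prod.Lex.lt_iff (x := (toLex (b s, s))) (y := (toLex (b t, t)))

theorem simple_π_val (m n : ℕ) (k : Fin (m + n)) :
    ((simple m n).π k : ℕ) = if (k : ℕ) < m then k + n else k - m := by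
  refine Fin.addCases (fun i => ?_) (fun i => ?_) k
  · simp [simple, Nat.add_comm]
  · simp [simple]

theorem simple_δ (m n : ℕ) (k : Fin (m + n)) :
    (simple m n).δ k = if (k : ℕ) < m then 1 else 0 := rfl

/-- Positions in `A ⊕ B` when `m₁ < n₁` and `n₂ < m₂`. -/
def pos (m₁ n₁ m₂ n₂ : ℕ) : Fin (m₁ + n₁) ⊕ Fin (m₂ + n₂) → ℕ :=
  Sum.elim (fun k => if (k : ℕ) < n₁ then k else k + n₂)
    (fun k => if (k : ℕ) < n₂ then n₁ + k else m₁ + n₁ + k)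

section

variable {m₁ n₁ m₂ n₂ : ℕ}

theorem pos_inl (k : Fin (m₁ + n₁)) :
    pos m₁ n₁ m₂ n₂ (.inl k) = if (k : ℕ) < n₁ then (k : ℕ) else k + n₂ := rfl

theorem pos_inr (k : Fin (m₂ + n₂)) :
    pos m₁ n₁ m₂ n₂ (.inr k) = if (k : ℕ) < n₂ then n₁ + (k : ℕ) else m₁ + n₁ + k := rfl

theorem twoSegment_δ_inl (k : Fin (m₁ + n₁)) :
    (twoSegment m₁ n₁ m₂ n₂).δ (.inl k) = if (k : ℕ) < m₁ then 1 else 0 := rfl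

theorem twoSegment_δ_inr (k : Fin (m₂ + n₂)) :
    (twoSegment m₁ n₁ m₂ n₂).δ (.inr k) = if (k : ℕ) < m₂ then 1 else 0 := rfl

theorem twoSegment_π_inl (k : Fin (m₁ + n₁)) :
    (twoSegment m₁ n₁ m₂ n₂).π (.inl k) = .inl ((simple m₁ n₁).π k) := rfl

theorem twoSegment_π_inr (k : Fin (m₂ + n₂)) :
    (twoSegment m₁ n₁ m₂ n₂).π (.inr k) = .inr ((simple m₂ n₂).π k) := rfl

/-- Images of zeros fill the first two zones, images of ones the last two. Because m₁ < n₁ and n₂ <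
m₂, among elements with a given symbol those of A precede those of B, and π₀ keeps them in this
order. -/
theorem isStable_pos (h₁ : m₁ < n₁) (h₂ : n₂ < m₂) :
    IsStable (pos m₁ n₁ m₂ n₂) (twoSegment m₁ n₁ m₂ n₂).δ (twoSegment m₁ n₁ m₂ n₂).π where
  inj := by
    rintro (k | k) (l | l) h <;> simp only [pos_inl, pos_inr] at h <;> have := k.2 <;>
      have := l.2
    · exact congrArg Sum.inl (Fin.ext (by split_ifs at h <;> omega))
    · split_ifs at h <;> omega
    · split_ifs at h <;> omega
    · exact congrArg Sum.inr (Fin.ext (by split_ifs at h <;> omega))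
  zero_one := by
    rintro (k | k) (l | l) hk hl <;>
      simp only [twoSegment_δ_inl, twoSegment_δ_inr, ite_eq_left_iff, ite_eq_right_iff,
        zero_ne_one, one_ne_zero, imp_false, not_not] at hk hl <;>
      simp only [twoSegment_π_inl, twoSegment_π_inr, pos_inl, pos_inr, simple_π_val, hl, hk,
        if_true, if_false] <;>
      have := k.2 <;> have := l.2 <;> split_ifs <;> omega
  same := by
    rintro (k | k) (l | l) h <;>
      simp only [twoSegment_δ_inl, twoSegment_δ_inr] at h <;>
      simp only [twoSegment_π_inl, twoSegment_π_inr, pos_inl, pos_inr, simple_π_val] <;>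
      have := k.2 <;> have := l.2 <;> split_ifs at h ⊢ <;> omega

end

/-- In a stable position function, larger positions have larger expansions. -/
theorem IsStable.binExp_le {T : Type} {κ : T → ℕ} {δ : T → Fin 2} {π₀ : Equiv.Perm T}
    (hS : IsStable κ δ π₀) {s t : T} (h : κ s < κ t) : binExp δ π₀ s ≤ binExp δ π₀ t := by
  by_contra hb
  rw [not_le] at hb
  obtain ⟨d, h1, h2⟩ : ∃ d, (∀ j < d, binExp δ π₀ t j = binExp δ π₀ s j) ∧
    binExp δ π₀ t d < binExp δ π₀ s d := hb
  change ∀ j < d, δ ((π₀⁻¹ ^ (j + 1)) t) = δ ((π₀⁻¹ ^ (j + 1)) s) at h1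
  change δ ((π₀⁻¹ ^ (d + 1)) t) < δ ((π₀⁻¹ ^ (d + 1)) s) at h2
  have e : ∀ j u, π₀ ((π₀⁻¹ ^ (j + 1)) u) = (π₀⁻¹ ^ j) u := fun j u => by
    rw [pow_succ', Equiv.Perm.mul_apply]
    exact π₀.apply_symm_apply _
  have key : ∀ j ≤ d, κ ((π₀⁻¹ ^ j) s) < κ ((π₀⁻¹ ^ j) t) := by
    intro j
    induction j with
    | zero => intro _; simpa using h
    | succ j ih =>
      intro hj
      rw [← hS.same _ _ (h1 j (by omega)).symm]
      rw [e, e]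
      exact ih (by omega)
  have h3 := hS.zero_one ((π₀⁻¹ ^ (d + 1)) t) ((π₀⁻¹ ^ (d + 1)) s) (by omega) (by omega)
  have h4 := key d le_rfl
  rw [e, e] at h3
  omega

/-- Stability makes expansions weakly monotone in the position, so only ties need care. They are
broken in favour of A, which can disagree with the positions only for an element of B in front of an
element of A. -/
theorem twoSegment_lt_iff {m₁ n₁ m₂ n₂ : ℕ} (h₁ : m₁ < n₁) (h₂ : n₂ < m₂)
    (s t : Fin (m₁ + n₁) ⊕ Fin (m₂ + n₂)) :
    (twoSegment m₁ n₁ m₂ n₂).ord.lt s t ↔ pos m₁ n₁ m₂ n₂ s < pos m₁ n₁ m₂ n₂ t := by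
  have hS := isStable_pos h₁ h₂
  have fwd : ∀ s t, pos m₁ n₁ m₂ n₂ s < pos m₁ n₁ m₂ n₂ t →
      (twoSegment m₁ n₁ m₂ n₂).ord.lt s t := by
    intro s t h
    have hle := hS.binExp_le h
    refine (sortBy_lt_iff _ _ s t).2 ?_
    rcases hle.lt_or_eq with h1 | h1
    · exact Or.inl h1
    refine Or.inr ⟨h1, ?_⟩
    change toLex s < toLex t
    rcases s with k | k <;> rcases t with l | l <;> have := k.2 <;> have := l.2
    · rw [Sum.Lex.inl_lt_inl_iff]
      change (k : ℕ) < l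
      simp only [pos_inl] at h
      split_ifs at h <;> omega
    · exact Sum.Lex.inl_lt_inr _ _
    -- The element of B is then in the second zone and that of A in the third, so their first digits
    -- are 0 and 1 and there is no tie.
    · exfalso
      simp only [pos_inl, pos_inr] at h
      have hk : (k : ℕ) < n₂ := by split_ifs at h <;> omega
      have hl : n₁ ≤ (l : ℕ) := by split_ifs at h <;> omega
      have e : (twoSegment m₁ n₁ m₂ n₂).δ ((twoSegment m₁ n₁ m₂ n₂).π⁻¹ (.inr k))
          = (twoSegment m₁ n₁ m₂ n₂).δ ((twoSegment m₁ n₁ m₂ n₂).π⁻¹ (.inl l)) := by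
        exact congrFun (congrArg ofLex h1) 0
      have e1 : (twoSegment m₁ n₁ m₂ n₂).π⁻¹ (.inr k) = .inr ⟨k + m₂, by omega⟩ := by
        rw [Equiv.Perm.inv_eq_iff_eq, twoSegment_π_inr]
        exact congrArg Sum.inr (Fin.ext (by rw [simple_π_val, if_neg (by simp)]; simp))
      have e2 : (twoSegment m₁ n₁ m₂ n₂).π⁻¹ (.inl l) = .inl ⟨l - n₁, by omega⟩ := by
        rw [Equiv.Perm.inv_eq_iff_eq, twoSegment_π_inl]
        refine congrArg Sum.inl (Fin.ext ?_)
        rw [simple_π_val, if_pos (by simp; omega)]; simp; omega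
      rw [e1, e2, twoSegment_δ_inl, twoSegment_δ_inr, if_neg (by simp),
        if_pos (by simp; omega)] at e
      exact absurd e (by decide)
    · rw [Sum.Lex.inr_lt_inr_iff]
      change (k : ℕ) < l
      simp only [pos_inr] at h
      split_ifs at h <;> omega
  refine ⟨fun h => ?_, fwd s t⟩
  rcases lt_trichotomy (pos m₁ n₁ m₂ n₂ s) (pos m₁ n₁ m₂ n₂ t) with h1 | h1 | h1
  · exact h1
  · rw [hS.inj h1] at h
    exact absurd h (@lt_irrefl _ (twoSegment m₁ n₁ m₂ n₂).ord.toPreorder t)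
  · exact absurd h (@lt_asymm _ (twoSegment m₁ n₁ m₂ n₂).ord.toPreorder t s (fwd t s h1))

open Classical in
theorem length_spec {T : Type} [Fintype T] [DecidableEq T] (S : ABS T) (x y : T) :
    (S.spec x y).length = (Finset.univ.filter fun p : T × T => S.δ p.1 = 0 ∧ S.δ p.2 = 1 ∧
      binExp S.δ (smallMod S.π x y) p.1 < binExp S.δ (smallMod S.π x y) p.2).card := by
  unfold length
  refine congrArg Finset.card (Finset.ext fun p => ?_)
  simp only [Finset.mem_filter, Finset.mem_univ, true_and]
  change (S.δ p.1 = 0 ∧ S.δ p.2 = 1 ∧ _) ↔ _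
  refine and_congr_right fun h0 => and_congr_right fun h1 => ?_
  rw [spec_lt_iff]
  refine ⟨?_, Or.inl⟩
  rintro (h | ⟨h, -⟩)
  · exact h
  · have := δ_eq_of_binExp_eq _ _ _ _ h
    rw [h0, h1] at this
    exact absurd this (by decide)

/-- The length of the exchange, in terms of positions. -/
theorem length_spec_twoSegment {m₁ n₁ m₂ n₂ : ℕ} (h₁ : m₁ < n₁) (h₂ : n₂ < m₂)
    {x y : Fin (m₁ + n₁) ⊕ Fin (m₂ + n₂)} (hxy : pos m₁ n₁ m₂ n₂ x < pos m₁ n₁ m₂ n₂ y)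
    (hx : (twoSegment m₁ n₁ m₂ n₂).δ x = 0) (hy : (twoSegment m₁ n₁ m₂ n₂).δ y = 1) :
    ((twoSegment m₁ n₁ m₂ n₂).spec x y).length + 1 ≤ (twoSegment m₁ n₁ m₂ n₂).length ∧
    (((twoSegment m₁ n₁ m₂ n₂).spec x y).length + 1 = (twoSegment m₁ n₁ m₂ n₂).length ↔
      IsGood (pos m₁ n₁ m₂ n₂) (twoSegment m₁ n₁ m₂ n₂).δ (twoSegment m₁ n₁ m₂ n₂).π x y) := by
  have h := count_drop (isStable_pos h₁ h₂) hxy hx hy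
  have e : (twoSegment m₁ n₁ m₂ n₂).length = (Finset.univ.filter
      fun p : (Fin (m₁ + n₁) ⊕ Fin (m₂ + n₂)) × (Fin (m₁ + n₁) ⊕ Fin (m₂ + n₂)) =>
        (twoSegment m₁ n₁ m₂ n₂).δ p.1 = 0 ∧ (twoSegment m₁ n₁ m₂ n₂).δ p.2 = 1 ∧
        pos m₁ n₁ m₂ n₂ p.1 < pos m₁ n₁ m₂ n₂ p.2).card := by
    unfold length
    simp only [twoSegment_lt_iff h₁ h₂]
  rw [length_spec, e]
  convert h

/-! ### Following pairs along the orbits of the modified π. -/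

/-- If a pair of elements with equal symbols is reversed by the expansions, then its image is
reversed with respect to the order in which `x` and `y` are interchanged. -/
theorem IsStable.step {T : Type} [DecidableEq T] {κ : T → ℕ} {δ : T → Fin 2} {π₀ : Equiv.Perm T}
    (hS : IsStable κ δ π₀) {x y s t : T} (h : κ s < κ t)
    (hb : binExp δ (smallMod π₀ x y) t < binExp δ (smallMod π₀ x y) s) (hδ : δ s = δ t) :
    swapPos κ x y (smallMod π₀ x y s) < swapPos κ x y (smallMod π₀ x y t) ∧
      binExp δ (smallMod π₀ x y) (smallMod π₀ x y t)
        < binExp δ (smallMod π₀ x y) (smallMod π₀ x y s) := by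
  rw [swapPos_smallMod, swapPos_smallMod, hS.same _ _ hδ, binExp_map_lt_iff _ _ _ _ hδ.symm]
  exact ⟨h, hb⟩

/-- Subtracting m and adding n agree modulo m + n, so π is a rotation by n. -/
theorem simple_π_pow_val (m n N : ℕ) (k : Fin (m + n)) :
    (((simple m n).π ^ N) k : ℕ) = (k + N * n) % (m + n) := by
  induction N with
  | zero => simp [Nat.mod_eq_of_lt k.2]
  | succ N ih =>
    have e : ∀ l : Fin (m + n), (((simple m n).π l : Fin (m + n)) : ℕ) = (l + n) % (m + n) := by
      intro l
      have := l.2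
      rw [simple_π_val]
      split_ifs with h
      · rw [Nat.mod_eq_of_lt (by omega)]
      · rw [Nat.mod_eq_sub_mod (by omega), Nat.mod_eq_of_lt (by omega)]; omega
    rw [pow_succ', Equiv.Perm.mul_apply, e, ih, Nat.mod_add_mod]
    congr 1; ring

/-- `π` is a single cycle on `N_{m,n}`. -/
theorem exists_simple_π_pow {m n : ℕ} (hc : Nat.Coprime m n) (k l : Fin (m + n)) :
    ∃ N, ((simple m n).π ^ (N + 1)) k = l := by
  have hpos : 0 < m + n := lt_of_le_of_lt (Nat.zero_le _) k.2
  have : NeZero (m + n) := ⟨hpos.ne'⟩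
  have hc' : Nat.Coprime n (m + n) := by simpa [Nat.coprime_comm] using hc
  -- `c` solves k + c n = l modulo m + n, where n is invertible. A full turn is added below so that
  -- the exponent is positive even when k = l.
  set c : ZMod (m + n) := ((l : ℕ) - (k : ℕ)) * (n : ZMod (m + n))⁻¹ with hcdef
  refine ⟨c.val + (m + n - 1), Fin.ext ?_⟩
  rw [simple_π_pow_val, ← Nat.mod_eq_of_lt l.2]
  change _ ≡ _ [MOD _]
  rw [← ZMod.natCast_eq_natCast_iff]
  have e : c.val + (m + n - 1) + 1 = c.val + (m + n) := by omega
  rw [e]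
  push_cast
  have h0 : (m : ZMod (m + n)) + n = 0 := by
    have := ZMod.natCast_self (m + n)
    push_cast at this
    exact this
  rw [ZMod.natCast_zmod_val, h0, add_zero, hcdef, mul_assoc, mul_comm (_⁻¹),
    ZMod.coe_mul_inv_eq_one _ hc']
  ring

section

variable {m₁ n₁ m₂ n₂ : ℕ}

theorem smallMod_inl (i : Fin (m₁ + n₁)) (j : Fin (m₂ + n₂)) (a : Fin (m₁ + n₁)) :
    smallMod (twoSegment m₁ n₁ m₂ n₂).π (.inl i) (.inr j) (.inl a)
      = if (simple m₁ n₁).π a = i then .inr j else .inl ((simple m₁ n₁).π a) := by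
  simp only [smallMod, Equiv.trans_apply, twoSegment_π_inl, Equiv.swap_apply_def,
    Sum.inl.injEq, reduceCtorEq, if_false]

theorem smallMod_inr (i : Fin (m₁ + n₁)) (j : Fin (m₂ + n₂)) (b : Fin (m₂ + n₂)) :
    smallMod (twoSegment m₁ n₁ m₂ n₂).π (.inl i) (.inr j) (.inr b)
      = if (simple m₂ n₂).π b = j then .inl i else .inr ((simple m₂ n₂).π b) := by
  simp only [smallMod, Equiv.trans_apply, twoSegment_π_inr, Equiv.swap_apply_def,
    Sum.inr.injEq, reduceCtorEq, if_false]

theorem swapPos_inl (i : Fin (m₁ + n₁)) (j : Fin (m₂ + n₂)) {a : Fin (m₁ + n₁)}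
    (h : a ≠ i) : swapPos (pos m₁ n₁ m₂ n₂) (.inl i) (.inr j) (.inl a) = pos m₁ n₁ m₂ n₂ (.inl a) :=
  swapPos_of_ne _ (by simpa using h) (by simp)

theorem swapPos_inr (i : Fin (m₁ + n₁)) (j : Fin (m₂ + n₂)) {b : Fin (m₂ + n₂)}
    (h : b ≠ j) : swapPos (pos m₁ n₁ m₂ n₂) (.inl i) (.inr j) (.inr b) = pos m₁ n₁ m₂ n₂ (.inr b) :=
  swapPos_of_ne _ (by simp) (by simpa using h)

end

/-! ### Part (ii): y in the last zone. -/

section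

variable {m₁ n₁ m₂ n₂ : ℕ} {i : Fin (m₁ + n₁)} {j : Fin (m₂ + n₂)}

local notation "κ" => pos m₁ n₁ m₂ n₂
local notation "κ₀" => swapPos (pos m₁ n₁ m₂ n₂) (Sum.inl i) (Sum.inr j)
local notation "ψ" => smallMod (ABS.π (twoSegment m₁ n₁ m₂ n₂)) (Sum.inl i) (Sum.inr j)
local notation "𝔟" => binExp (ABS.δ (twoSegment m₁ n₁ m₂ n₂))
  (smallMod (ABS.π (twoSegment m₁ n₁ m₂ n₂)) (Sum.inl i) (Sum.inr j))
local notation "δ₀" => ABS.δ (twoSegment m₁ n₁ m₂ n₂)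
local notation "𝔾" => IsGood (pos m₁ n₁ m₂ n₂) (ABS.δ (twoSegment m₁ n₁ m₂ n₂))
  (ABS.π (twoSegment m₁ n₁ m₂ n₂)) (Sum.inl i) (Sum.inr j)

theorem IsGood.not_zero_one (hG : 𝔾) {s t : Fin (m₁ + n₁) ⊕ Fin (m₂ + n₂)} (h : κ s < κ t)
    (h0 : κ₀ s < κ₀ t) (hb : 𝔟 t < 𝔟 s) (hs : δ₀ s = 0) (ht : δ₀ t = 1) : False := by
  have := hG.no_loss s t h hs ht hb
  omega

theorem δ_inl_of_lt {a : Fin (m₁ + n₁)} (h : (a : ℕ) < m₁) : δ₀ (.inl a) = 1 := if_pos h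
theorem δ_inl_of_le {a : Fin (m₁ + n₁)} (h : m₁ ≤ (a : ℕ)) : δ₀ (.inl a) = 0 :=
  if_neg (not_lt.2 h)
theorem δ_inr_of_lt {b : Fin (m₂ + n₂)} (h : (b : ℕ) < m₂) : δ₀ (.inr b) = 1 := if_pos h
theorem δ_inr_of_le {b : Fin (m₂ + n₂)} (h : m₂ ≤ (b : ℕ)) : δ₀ (.inr b) = 0 :=
  if_neg (not_lt.2 h)

theorem val_of_lt {m n : ℕ} {a : Fin (m + n)} (h : (a : ℕ) < m) :
    ((simple m n).π a : ℕ) = a + n := by rw [simple_π_val, if_pos h]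
theorem val_of_le {m n : ℕ} {a : Fin (m + n)} (h : m ≤ (a : ℕ)) :
    ((simple m n).π a : ℕ) = a - m := by rw [simple_π_val, if_neg (not_lt.2 h)]

theorem pos_inl_of_lt {a : Fin (m₁ + n₁)} (h : (a : ℕ) < n₁) : κ (.inl a) = a := if_pos h
theorem pos_inl_of_le {a : Fin (m₁ + n₁)} (h : n₁ ≤ (a : ℕ)) : κ (.inl a) = a + n₂ :=
  if_neg (not_lt.2 h)
theorem pos_inr_of_lt {b : Fin (m₂ + n₂)} (h : (b : ℕ) < n₂) : κ (.inr b) = n₁ + b := if_pos h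
theorem pos_inr_of_le {b : Fin (m₂ + n₂)} (h : n₂ ≤ (b : ℕ)) : κ (.inr b) = m₁ + n₁ + b :=
  if_neg (not_lt.2 h)

/-- For `y` in the last zone, following an element of `A` and an element of `B` in the wrong
order leads to a contradiction. -/
theorem IsGood.false_of_pair_of_le (hG : 𝔾) (h₁ : m₁ < n₁) (h₂ : n₂ < m₂)
    (hi : m₁ ≤ (i : ℕ) ∧ (i : ℕ) < n₁) (hj : n₂ ≤ (j : ℕ) ∧ (j : ℕ) < m₂) (N : ℕ) :
    ∀ (a : Fin (m₁ + n₁)) (b : Fin (m₂ + n₂)), ((simple m₁ n₁).π ^ (N + 1)) a = i →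
      κ (.inl a) < κ (.inr b) → κ₀ (.inl a) < κ₀ (.inr b) → 𝔟 (.inr b) < 𝔟 (.inl a) →
      (((a : ℕ) < n₁ ∧ (b : ℕ) < m₂) ∨ (m₁ ≤ (a : ℕ) ∧ n₂ ≤ (b : ℕ))) → False := by
  have hS := isStable_pos h₁ h₂
  have hκi : κ (.inl i) = i := pos_inl_of_lt hi.2
  have hκj : κ (.inr j) = m₁ + n₁ + j := pos_inr_of_le hj.1
  have hδi : δ₀ (.inl i) = 0 := δ_inl_of_le hi.1
  have hδj : δ₀ (.inr j) = 1 := δ_inr_of_lt hj.2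
  induction N using Nat.strong_induction_on with
  | _ N ih =>
  intro a b hN hκ hκ0 hb hz
  have ha2 := a.2
  have hb2 := b.2
  -- The induction is on the number of steps from `a` to x along π₀. It drops unless π₀ sends `a` to
  -- x, in which case π sends `a` to y.
  have next : (simple m₁ n₁).π a ≠ i →
      ∃ M < N, ((simple m₁ n₁).π ^ (M + 1)) ((simple m₁ n₁).π a) = i := by
    intro h
    rcases N with _ | M
    · rw [zero_add, pow_one] at hN
      exact absurd hN h
    · exact ⟨M, Nat.lt_succ_self M, by rwa [pow_succ, Equiv.Perm.mul_apply] at hN⟩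
  rcases hz with ⟨ha, hb'⟩ | ⟨ha, hb'⟩
  · by_cases ha' : (a : ℕ) < m₁
    · have hσ := val_of_lt ha'
      have hai : (simple m₁ n₁).π a ≠ i := fun h => by rw [h] at hσ; omega
      obtain ⟨M, hM, hM'⟩ := next hai
      have hst := hS.step hκ hb (by rw [δ_inl_of_lt ha', δ_inr_of_lt hb'])
      rw [smallMod_inl, if_neg hai, smallMod_inr] at hst
      have hκa := pos_inl_of_le (m₂ := m₂) (n₂ := n₂)
        (a := (simple m₁ n₁).π a) (by omega)
      by_cases hbj : (simple m₂ n₂).π b = j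
      · rw [if_pos hbj] at hst
        -- The image of `b` is x, and the image of `a` is a zero between x and y. The interchange
        -- reverses this pair, so `reversed` forces the opposite order of expansions.
        refine lt_asymm hst.2 (hG.reversed _ _ ?_ ?_ ?_)
        · omega
        · rw [swapPos_left, swapPos_inl i j hai]; omega
        · rw [hδi, δ_inl_of_le (by omega)]
      · rw [if_neg hbj] at hst
        have hτ := val_of_lt hb'
        refine ih M hM _ _ hM' ?_ hst.1 hst.2 (Or.inr ⟨by omega, by omega⟩)
        rw [swapPos_inl i j hai, swapPos_inr i j hbj] at hst
        exact hst.1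
    · exact hG.not_zero_one hκ hκ0 hb (δ_inl_of_le (by omega)) (δ_inr_of_lt hb')
  · by_cases hb1 : (b : ℕ) < m₂
    · exact hG.not_zero_one hκ hκ0 hb (δ_inl_of_le (by omega)) (δ_inr_of_lt hb1)
    · have hτ := val_of_le (not_lt.1 hb1)
      have hσ := val_of_le (n := n₁) (a := a) (by omega)
      have hbj : (simple m₂ n₂).π b ≠ j := fun h => by rw [h] at hτ; omega
      have hst := hS.step hκ hb (by rw [δ_inl_of_le (by omega), δ_inr_of_le (by omega)])
      rw [smallMod_inl, smallMod_inr, if_neg hbj] at hst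
      have hκb := pos_inr_of_lt (m₁ := m₁) (n₁ := n₁) (b := (simple m₂ n₂).π b) (by omega)
      by_cases hai : (simple m₁ n₁).π a = i
      · rw [if_pos hai] at hst
        refine lt_asymm hst.2 (hG.reversed _ _ ?_ ?_ ?_)
        · omega
        · rw [swapPos_right, swapPos_inr i j hbj]; omega
        · rw [hδj, δ_inr_of_lt (by omega)]
      · rw [if_neg hai] at hst
        obtain ⟨M, hM, hM'⟩ := next hai
        refine ih M hM _ _ hM' ?_ hst.1 hst.2 (Or.inl ⟨by omega, by omega⟩)
        rw [swapPos_inl i j hai, swapPos_inr i j hbj] at hst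
        exact hst.1

/-- No exchange with `y` in the last zone is good. -/
theorem not_isGood_of_le (hc : Nat.Coprime m₁ n₁) (h₁ : m₁ < n₁) (h₂ : n₂ < m₂)
    (hpos : 0 < m₁ ∨ 0 < n₂)
    (hi : m₁ ≤ (i : ℕ) ∧ (i : ℕ) < n₁) (hj : n₂ ≤ (j : ℕ) ∧ (j : ℕ) < m₂) : ¬ 𝔾 := by
  intro hG
  have hS := isStable_pos h₁ h₂
  have hκi : κ (.inl i) = i := pos_inl_of_lt hi.2
  have hκj : κ (.inr j) = m₁ + n₁ + j := pos_inr_of_le hj.1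
  have hδi : δ₀ (.inl i) = 0 := δ_inl_of_le hi.1
  have hδj : δ₀ (.inr j) = 1 := δ_inr_of_lt hj.2
  have hi2 := i.2
  have hj2 := j.2
  have hσi := val_of_le hi.1
  have hτj := val_of_lt hj.2
  -- For m₁ = 0 the predecessor of x is x itself and gives no pair. Then n₂ > 0 and the predecessor
  -- of y, a one between x and y, is used instead.
  by_cases hm : 0 < m₁
  · let w : Fin (m₁ + n₁) := ⟨i + m₁, by omega⟩
    have hwi : w ≠ i := fun h => by have := congrArg Fin.val h; simp [w] at this; omega
    have hσw : (simple m₁ n₁).π w = i := Fin.ext (by rw [val_of_le (by simp [w])]; simp [w])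
    have hκw : κ (.inl w) < m₁ + n₁ + n₂ ∧ i < κ (.inl w) := by
      rw [pos_inl]; simp only [w]; split_ifs <;> omega
    have hσii : (simple m₁ n₁).π i ≠ i := fun h => by rw [h] at hσi; omega
    have hδw : δ₀ (.inl w) = 0 := δ_inl_of_le (by simp [w])
    have hb := hG.reversed (.inl i) (.inl w) (by omega)
      (by rw [swapPos_left, swapPos_inl i j hwi]; omega) (by rw [hδi, hδw])
    have hst := hS.step (by omega) hb (by rw [hδi, hδw])
    rw [smallMod_inl, smallMod_inl, if_neg hσii, if_pos hσw] at hst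
    obtain ⟨N, hN⟩ := exists_simple_π_pow hc ((simple m₁ n₁).π i) i
    refine hG.false_of_pair_of_le h₁ h₂ hi hj N _ _ hN ?_ hst.1 hst.2
      (Or.inl ⟨by omega, hj.2⟩)
    rw [pos_inl_of_lt (by omega)]; omega
  · let v : Fin (m₂ + n₂) := ⟨j - n₂, by omega⟩
    have hvj : v ≠ j := fun h => by have := congrArg Fin.val h; simp [v] at this; omega
    have hτv : (simple m₂ n₂).π v = j :=
      Fin.ext (by rw [val_of_lt (by simp [v]; omega)]; simp [v]; omega)
    have hκv : κ (.inr v) < m₁ + n₁ + j ∧ i < κ (.inr v) := by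
      rw [pos_inr]; simp only [v]; split_ifs <;> omega
    have hτjj : (simple m₂ n₂).π j ≠ j := fun h => by rw [h] at hτj; omega
    have hδv : δ₀ (.inr v) = 1 := δ_inr_of_lt (by simp [v]; omega)
    have hb := hG.reversed (.inr v) (.inr j) (by omega)
      (by rw [swapPos_right, swapPos_inr i j hvj]; omega) (by rw [hδj, hδv])
    have hst := hS.step (by omega) hb (by rw [hδj, hδv])
    rw [smallMod_inr, smallMod_inr, if_neg hτjj, if_pos hτv] at hst
    have hκτ := pos_inr_of_le (m₁ := m₁) (n₁ := n₁) (b := (simple m₂ n₂).π j) (by omega)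
    obtain ⟨N, hN⟩ := exists_simple_π_pow hc i i
    exact hG.false_of_pair_of_le h₁ h₂ hi hj N _ _ hN (by omega) hst.1 hst.2
      (Or.inr ⟨hi.1, by omega⟩)

end

/-! ### Survivors, arcs, and the origin of order violations. -/

section

variable {T : Type}

/-- The elements of `E` transported by `π ^ n`, as long as their symbols agree with those met on
the way from `x`. -/
def survivors (π : Equiv.Perm T) (δ : T → Fin 2) (E : Set T) (x : T) (n : ℕ) : Set T :=
  {t | ∃ z ∈ E, (π ^ n) z = t ∧ ∀ r ≤ n, δ ((π ^ r) z) = δ ((π ^ r) x)}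

theorem perm_pow_succ_apply (π : Equiv.Perm T) (n : ℕ) (t : T) :
    (π ^ (n + 1)) t = π ((π ^ n) t) := by
  rw [pow_succ', Equiv.Perm.mul_apply]

/-- `D` is the arc from `x` to `w` in the orbit of `x` under `π`. -/
structure IsArc (π : Equiv.Perm T) (D : Set T) (x w : T) : Prop where
  start_mem : x ∈ D
  end_mem : w ∈ D
  step : ∀ t ∈ D, t ≠ w → π t ∈ D
  ne_start : ∀ t ∈ D, π t ≠ x
  reach : ∀ t ∈ D, ∃ q, (π ^ q) x = t ∧ ∀ r < q, (π ^ r) x ≠ w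

namespace IsArc

variable {π : Equiv.Perm T} {D : Set T} {x w : T}

/-- On the arc, z lies at or after x, so x needs at least as many steps as z to reach w. -/
theorem pow_start_ne_end (h : IsArc π D x w) {z : T} (hz : z ∈ D) {n : ℕ}
    (hn : ∀ r < n, (π ^ r) z ≠ w) : ∀ r < n, (π ^ r) x ≠ w := by
  intro r hr hw
  obtain ⟨q, rfl, hq⟩ := h.reach z hz
  have hqr : q ≤ r := not_lt.1 fun h' => hq r h' hw
  apply hn (r - q) (by omega)
  rw [← Equiv.Perm.mul_apply, ← pow_add, Nat.sub_add_cancel hqr, hw]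

theorem exists_pow_eq_end (h : IsArc π D x w) {z : T} (hz : z ∈ D) : ∃ k, (π ^ k) z = w := by
  obtain ⟨q, rfl, hq⟩ := h.reach z hz
  obtain ⟨l, hl, -⟩ := h.reach w h.end_mem
  have hql : q ≤ l := not_lt.1 fun h' => hq l h' hl
  exact ⟨l - q, by rw [← Equiv.Perm.mul_apply, ← pow_add, Nat.sub_add_cancel hql, hl]⟩

theorem pow_mem (h : IsArc π D x w) {z : T} (hz : z ∈ D) {n : ℕ}
    (hn : ∀ r < n, (π ^ r) z ≠ w) : ∀ r ≤ n, (π ^ r) z ∈ D := by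
  intro r
  induction r with
  | zero => intro _; simpa using hz
  | succ r ih =>
    intro hr
    rw [perm_pow_succ_apply]
    exact h.step _ (ih (by omega)) (hn r (by omega))

theorem pow_ne_start (h : IsArc π D x w) {z : T} (hz : z ∈ D) {n : ℕ}
    (hn : ∀ r < n, (π ^ r) z ≠ w) : ∀ r ≤ n, 1 ≤ r → (π ^ r) z ≠ x := by
  intro r hr h1
  obtain ⟨r, rfl⟩ : ∃ s, r = s + 1 := ⟨r - 1, by omega⟩
  rw [perm_pow_succ_apply]
  exact h.ne_start _ (h.pow_mem hz hn r (by omega))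

/-- An arc obtained by changing the image of one element of an orbit. -/
theorem of_orbit {π₀ : Equiv.Perm T} (hx : x ∈ D) (hw : w ∈ D) (hD : ∀ t ∈ D, π₀ t ∈ D)
    (hwx : π₀ w = x) (hπ : ∀ t ∈ D, t ≠ w → π t = π₀ t) (hw' : π w ≠ x)
    (hr : ∀ t ∈ D, ∃ q, (π₀ ^ q) x = t) : IsArc π D x w where
  start_mem := hx
  end_mem := hw
  step := fun t ht h => by rw [hπ t ht h]; exact hD t ht
  ne_start := fun t ht h => by
    by_cases htw : t = w
    · rw [htw] at h; exact hw' h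
    · rw [hπ t ht htw, ← hwx] at h
      exact htw (π₀.injective h)
  reach := by
    classical
    intro t ht
    -- A minimal exponent cannot pass w: since π₀ w = x, the orbit would start again and a smaller
    -- exponent would do.
    have hmin : ∀ r < Nat.find (hr t ht), (π₀ ^ r) x ≠ w := by
      intro r hlt hrw
      refine Nat.find_min (hr t ht) (m := Nat.find (hr t ht) - (r + 1)) (by omega) ?_
      have e : (π₀ ^ (r + 1)) x = x := by rw [perm_pow_succ_apply, hrw, hwx]
      have e' := congrArg (π₀ ^ (Nat.find (hr t ht) - (r + 1))) e
      rw [← e', ← Equiv.Perm.mul_apply, ← pow_add, Nat.sub_add_cancel (by omega)]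
      exact Nat.find_spec (hr t ht)
    have heq : ∀ r ≤ Nat.find (hr t ht), (π ^ r) x = (π₀ ^ r) x ∧ (π₀ ^ r) x ∈ D := by
      intro r
      induction r with
      | zero => intro _; exact ⟨rfl, hx⟩
      | succ r ih =>
        intro hle
        obtain ⟨h1, h2⟩ := ih (by omega)
        rw [perm_pow_succ_apply, perm_pow_succ_apply, h1, hπ _ h2 (hmin r (by omega))]
        exact ⟨rfl, hD _ h2⟩
    refine ⟨Nat.find (hr t ht), ?_, fun r hlt => ?_⟩
    · rw [(heq _ le_rfl).1]; exact Nat.find_spec (hr t ht)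
    · rw [(heq r hlt.le).1]; exact hmin r hlt

end IsArc

theorem binExp_map_eq {δ : T → Fin 2} {π : Equiv.Perm T} {s t : T} (hδ : δ s = δ t)
    (h : binExp δ π s = binExp δ π t) : binExp δ π (π s) = binExp δ π (π t) := by
  rcases lt_trichotomy (binExp δ π (π s)) (binExp δ π (π t)) with h1 | h1 | h1
  · exact absurd h (ne_of_lt ((binExp_map_lt_iff _ _ _ _ hδ).1 h1))
  · exact h1
  · exact absurd h (ne_of_gt ((binExp_map_lt_iff _ _ _ _ hδ.symm).1 h1))

/-- An expansion records the past of an element; as π has finite order, it also determines the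
present symbol, and by induction all future ones. -/
theorem δ_pow_eq_of_binExp_eq [Finite T] {δ : T → Fin 2} {π : Equiv.Perm T} {s t : T}
    (h : binExp δ π s = binExp δ π t) (r : ℕ) : δ ((π ^ r) s) = δ ((π ^ r) t) := by
  have key : binExp δ π ((π ^ r) s) = binExp δ π ((π ^ r) t) := by
    induction r with
    | zero => simpa using h
    | succ r ih =>
      rw [perm_pow_succ_apply, perm_pow_succ_apply]
      exact binExp_map_eq (δ_eq_of_binExp_eq _ _ _ _ ih) ih
  exact δ_eq_of_binExp_eq _ _ _ _ key

/-- A pair whose expansions violate the order with `x` and `y` interchanged arises from a pair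
reversed by the interchange. -/
theorem IsStable.descent [DecidableEq T] {κ : T → ℕ} {δ : T → Fin 2} {π₀ : Equiv.Perm T}
    (hS : IsStable κ δ π₀) {x y s t : T} (h : swapPos κ x y s < swapPos κ x y t)
    (hb : binExp δ (smallMod π₀ x y) t < binExp δ (smallMod π₀ x y) s) :
    ∃ k l₁ l₂, ((smallMod π₀ x y) ^ (k + 1)) l₁ = s ∧ ((smallMod π₀ x y) ^ (k + 1)) l₂ = t ∧
      κ l₁ < κ l₂ ∧ swapPos κ x y l₂ < swapPos κ x y l₁ ∧
      ∀ r ≤ k, δ (((smallMod π₀ x y) ^ r) l₁) = δ (((smallMod π₀ x y) ^ r) l₂) := by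
  set π := smallMod π₀ x y with hπ
  obtain ⟨d, h1, h2⟩ : ∃ d, (∀ j < d, binExp δ π t j = binExp δ π s j) ∧
    binExp δ π t d < binExp δ π s d := hb
  change ∀ j < d, δ ((π⁻¹ ^ (j + 1)) t) = δ ((π⁻¹ ^ (j + 1)) s) at h1
  change δ ((π⁻¹ ^ (d + 1)) t) < δ ((π⁻¹ ^ (d + 1)) s) at h2
  induction d generalizing s t with
  | zero =>
    obtain ⟨s, rfl⟩ := π.surjective s
    obtain ⟨t, rfl⟩ := π.surjective t
    simp only [zero_add, pow_one] at h2
    have e : ∀ u, π⁻¹ (π u) = u := π.symm_apply_apply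
    rw [e, e] at h2
    rw [hπ, swapPos_smallMod, swapPos_smallMod] at h
    have := hS.zero_one t s (by omega) (by omega)
    omega
  | succ d ih =>
    obtain ⟨s, rfl⟩ := π.surjective s
    obtain ⟨t, rfl⟩ := π.surjective t
    have e : ∀ (u : T) (k : ℕ), (π⁻¹ ^ (k + 1)) (π u) = (π⁻¹ ^ k) u := by
      intro u k
      rw [pow_succ, Equiv.Perm.mul_apply]
      exact congrArg _ (π.symm_apply_apply u)
    have hδ : δ s = δ t := by
      have := h1 0 (by omega)
      rw [e, e] at this
      exact this.symm
    rw [hπ, swapPos_smallMod, swapPos_smallMod, hS.same _ _ hδ] at h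
    -- If the interchange reverses the preimages, the source of the violation is found. Otherwise
    -- the preimages violate the order `swapPos` one digit earlier.
    by_cases h0 : swapPos κ x y t < swapPos κ x y s
    · refine ⟨0, s, t, by simp, by simp, h, h0, fun r hr => ?_⟩
      obtain rfl : r = 0 := by omega
      simpa using hδ
    · have hne : swapPos κ x y s ≠ swapPos κ x y t := fun h' => by
        have := swapPos_injective hS.inj x y h'
        rw [this] at h
        exact lt_irrefl _ h
      obtain ⟨k, l₁, l₂, a1, a2, a3, a4, a5⟩ := ih (s := s) (t := t) (by omega)
        (fun j hj => by have h3 := h1 (j + 1) (by omega); rw [e, e] at h3; exact h3)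
        (by have h3 := h2; rw [e, e] at h3; exact h3)
      refine ⟨k + 1, l₁, l₂, ?_, ?_, a3, a4, fun r hr => ?_⟩
      · rw [perm_pow_succ_apply, a1]
      · rw [perm_pow_succ_apply, a2]
      · rcases Nat.lt_or_ge k r with h' | h'
        · obtain rfl : r = k + 1 := by omega
          rw [a1, a2, hδ]
        · exact a5 r h'

end

/-! ### Part (i): goodness in terms of survivors. -/

section

variable {m₁ n₁ m₂ n₂ : ℕ} {i : Fin (m₁ + n₁)} {j : Fin (m₂ + n₂)}

local notation "κ" => pos m₁ n₁ m₂ n₂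
local notation "κ₀" => swapPos (pos m₁ n₁ m₂ n₂) (Sum.inl i) (Sum.inr j)
local notation "ψ" => smallMod (ABS.π (twoSegment m₁ n₁ m₂ n₂)) (Sum.inl i) (Sum.inr j)
local notation "𝔟" => binExp (ABS.δ (twoSegment m₁ n₁ m₂ n₂))
  (smallMod (ABS.π (twoSegment m₁ n₁ m₂ n₂)) (Sum.inl i) (Sum.inr j))
local notation "δ₀" => ABS.δ (twoSegment m₁ n₁ m₂ n₂)
local notation "𝔾" => IsGood (pos m₁ n₁ m₂ n₂) (ABS.δ (twoSegment m₁ n₁ m₂ n₂))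
  (ABS.π (twoSegment m₁ n₁ m₂ n₂)) (Sum.inl i) (Sum.inr j)

/-- Coprimality makes A a single π₀-cycle. On A, π changes only the image of the predecessor of x,
sending it out of A to y, and so cuts the cycle open. -/
theorem isArc_inl (hc : Nat.Coprime m₁ n₁) {w : Fin (m₁ + n₁)} (hw : (simple m₁ n₁).π w = i) :
    IsArc ψ (Set.range Sum.inl) (.inl i) (.inl w) := by
  refine IsArc.of_orbit (π₀ := (twoSegment m₁ n₁ m₂ n₂).π) ⟨i, rfl⟩ ⟨w, rfl⟩ ?_ ?_ ?_ ?_ ?_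
  · rintro _ ⟨a, rfl⟩
    exact ⟨_, rfl⟩
  · rw [twoSegment_π_inl, hw]
  · rintro _ ⟨a, rfl⟩ ha
    rw [smallMod_inl, if_neg, twoSegment_π_inl]
    rw [← hw]
    exact fun h => ha (congrArg Sum.inl ((simple m₁ n₁).π.injective h))
  · rw [smallMod_inl, if_pos hw]
    simp
  · rintro _ ⟨a, rfl⟩
    obtain ⟨N, hN⟩ := exists_simple_π_pow hc i a
    refine ⟨N + 1, ?_⟩
    rw [← hN]
    generalize N + 1 = M
    induction M with
    | zero => rfl
    | succ M ih => rw [perm_pow_succ_apply, ih, perm_pow_succ_apply, twoSegment_π_inl]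

theorem isArc_inr (hc : Nat.Coprime m₂ n₂) {v : Fin (m₂ + n₂)} (hv : (simple m₂ n₂).π v = j) :
    IsArc ψ (Set.range Sum.inr) (.inr j) (.inr v) := by
  refine IsArc.of_orbit (π₀ := (twoSegment m₁ n₁ m₂ n₂).π) ⟨j, rfl⟩ ⟨v, rfl⟩ ?_ ?_ ?_ ?_ ?_
  · rintro _ ⟨a, rfl⟩
    exact ⟨_, rfl⟩
  · rw [twoSegment_π_inr, hv]
  · rintro _ ⟨a, rfl⟩ ha
    rw [smallMod_inr, if_neg, twoSegment_π_inr]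
    rw [← hv]
    exact fun h => ha (congrArg Sum.inr ((simple m₂ n₂).π.injective h))
  · rw [smallMod_inr, if_pos hv]
    simp
  · rintro _ ⟨a, rfl⟩
    obtain ⟨N, hN⟩ := exists_simple_π_pow hc j a
    refine ⟨N + 1, ?_⟩
    rw [← hN]
    generalize N + 1 = M
    induction M with
    | zero => rfl
    | succ M ih => rw [perm_pow_succ_apply, ih, perm_pow_succ_apply, twoSegment_π_inr]

/-- For `x` and `y` in the first two zones, following an element of `A` to the right of the
predecessor of `x` and an element of `B` in the wrong order leads to a contradiction. -/
theorem IsGood.false_of_pair_of_lt (hG : 𝔾) (h₁ : m₁ < n₁) (h₂ : n₂ < m₂)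
    (hi : m₁ ≤ (i : ℕ) ∧ (i : ℕ) < n₁) (hj : (j : ℕ) < n₂) (N : ℕ) :
    ∀ (a : Fin (m₁ + n₁)) (b : Fin (m₂ + n₂)), ((simple m₁ n₁).π ^ (N + 1)) a = i →
      κ (.inl a) < κ (.inr b) → κ₀ (.inl a) < κ₀ (.inr b) → 𝔟 (.inr b) < 𝔟 (.inl a) →
      (((a : ℕ) < n₁ ∧ (b : ℕ) < n₂ ∧ (i : ℕ) + m₁ < a + n₁) ∨
        (n₁ ≤ (a : ℕ) ∧ n₂ ≤ (b : ℕ) ∧ (i : ℕ) + m₁ < a)) → False := by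
  have hS := isStable_pos h₁ h₂
  have hκi : κ (.inl i) = i := pos_inl_of_lt hi.2
  have hκj : κ (.inr j) = n₁ + j := pos_inr_of_lt hj
  have hδi : δ₀ (.inl i) = 0 := δ_inl_of_le hi.1
  have hδj : δ₀ (.inr j) = 1 := δ_inr_of_lt (by omega)
  induction N using Nat.strong_induction_on with
  | _ N ih =>
  intro a b hN hκ hκ0 hb hz
  have ha2 := a.2
  have hb2 := b.2
  have next : (simple m₁ n₁).π a ≠ i →
      ∃ M < N, ((simple m₁ n₁).π ^ (M + 1)) ((simple m₁ n₁).π a) = i := by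
    intro h
    rcases N with _ | M
    · rw [zero_add, pow_one] at hN
      exact absurd hN h
    · exact ⟨M, Nat.lt_succ_self M, by rwa [pow_succ, Equiv.Perm.mul_apply] at hN⟩
  -- The bounds on `a` ensure at every step that its image is not x, so the element of A is never
  -- replaced by y.
  rcases hz with ⟨ha, hb', hai'⟩ | ⟨ha, hb', hai'⟩
  · by_cases ha' : (a : ℕ) < m₁
    · have hσ := val_of_lt ha'
      have hτ := val_of_lt (m := m₂) (a := b) (by omega)
      have hai : (simple m₁ n₁).π a ≠ i := fun h => by rw [h] at hσ; omega
      have hbj : (simple m₂ n₂).π b ≠ j := fun h => by rw [h] at hτ; omega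
      obtain ⟨M, hM, hM'⟩ := next hai
      have hst := hS.step hκ hb (by rw [δ_inl_of_lt ha', δ_inr_of_lt (by omega)])
      rw [smallMod_inl, if_neg hai, smallMod_inr, if_neg hbj] at hst
      refine ih M hM _ _ hM' ?_ hst.1 hst.2 (Or.inr ⟨by omega, by omega, by omega⟩)
      rw [swapPos_inl i j hai, swapPos_inr i j hbj] at hst
      exact hst.1
    · exact hG.not_zero_one hκ hκ0 hb (δ_inl_of_le (by omega)) (δ_inr_of_lt (by omega))
  · by_cases hb1 : (b : ℕ) < m₂
    · exact hG.not_zero_one hκ hκ0 hb (δ_inl_of_le (by omega)) (δ_inr_of_lt hb1)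
    · have hτ := val_of_le (not_lt.1 hb1)
      have hσ := val_of_le (n := n₁) (a := a) (by omega)
      have hai : (simple m₁ n₁).π a ≠ i := fun h => by rw [h] at hσ; omega
      have hst := hS.step hκ hb (by rw [δ_inl_of_le (by omega), δ_inr_of_le (by omega)])
      rw [smallMod_inl, smallMod_inr, if_neg hai] at hst
      have hκa := pos_inl_of_lt (m₂ := m₂) (n₂ := n₂)
        (a := (simple m₁ n₁).π a) (by omega)
      by_cases hbj : (simple m₂ n₂).π b = j
      · rw [if_pos hbj] at hst
        refine lt_asymm hst.2 (hG.reversed _ _ ?_ ?_ ?_)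
        · omega
        · rw [swapPos_left, swapPos_inl i j hai]; omega
        · rw [hδi, δ_inl_of_le (by omega)]
      · rw [if_neg hbj] at hst
        obtain ⟨M, hM, hM'⟩ := next hai
        refine ih M hM _ _ hM' ?_ hst.1 hst.2 (Or.inl ⟨by omega, by omega, by omega⟩)
        rw [swapPos_inl i j hai, swapPos_inr i j hbj] at hst
        exact hst.1

/-- If the predecessor of `x` survives on the way from `x`, the exchange is not good. -/
theorem not_isGood_of_survivors_inl (hc : Nat.Coprime m₁ n₁) (h₁ : m₁ < n₁) (h₂ : n₂ < m₂)
    (hi : m₁ ≤ (i : ℕ) ∧ (i : ℕ) < n₁) (hj : (j : ℕ) < n₂) {w : Fin (m₁ + n₁)}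
    (hw : (w : ℕ) = i + m₁) {n : ℕ}
    (h : .inl w ∈ survivors ψ δ₀ {t | ∃ z : Fin (m₁ + n₁), t = .inl z ∧ i < z ∧ (z : ℕ) < n₁}
      (.inl i) n) : ¬ 𝔾 := by
  classical
  intro hG
  have hS := isStable_pos h₁ h₂
  have hκi : κ (.inl i) = i := pos_inl_of_lt hi.2
  have hκj : κ (.inr j) = n₁ + j := pos_inr_of_lt hj
  have hδi : δ₀ (.inl i) = 0 := δ_inl_of_le hi.1
  have hδj : δ₀ (.inr j) = 1 := δ_inr_of_lt (by omega)
  obtain ⟨_, ⟨z, rfl, hiz, hzn⟩, hz, hδ⟩ := h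
  have hiz' : (i : ℕ) < z := hiz
  -- Only the first visit to w counts: up to then neither of the two orbits has left A.
  have hex : ∃ n, (ψ ^ n) (.inl z) = .inl w := ⟨n, hz⟩
  set k := Nat.find hex with hk
  have hkw : (ψ ^ k) (.inl z) = .inl w := Nat.find_spec hex
  have hkn : k ≤ n := Nat.find_min' hex hz
  have hmin : ∀ r < k, (ψ ^ r) (.inl z) ≠ .inl w := fun r hr => Nat.find_min hex hr
  have hσw : (simple m₁ n₁).π w = i := Fin.ext (by rw [val_of_le (by omega)]; omega)
  have harc := isArc_inl (n₂ := n₂) (j := j) hc hσw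
  have hmin' := harc.pow_start_ne_end ⟨z, rfl⟩ hmin
  have hzi : z ≠ i := hiz.ne'
  have hκz : κ (.inl z) = z := pos_inl_of_lt hzn
  -- With equal symbols, π₀ translates both elements by the same amount, so the offset z - i is
  -- constant. The bound needed at the end uses this and not just the order.
  have key : ∀ r ≤ k, ∃ a c : Fin (m₁ + n₁), (ψ ^ r) (.inl i) = .inl a ∧
      (ψ ^ r) (.inl z) = .inl c ∧ (c : ℕ) + i = a + z ∧ 𝔟 (.inl c) < 𝔟 (.inl a) := by
    intro r
    induction r with
    | zero =>
      intro _
      refine ⟨i, z, by simp, by simp, by omega, hG.reversed _ _ (by omega) ?_ ?_⟩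
      · rw [swapPos_left, swapPos_inl i j hzi]; omega
      · rw [hδi, δ_inl_of_le (by omega)]
    | succ r ih =>
      intro hr
      obtain ⟨a, c, ha, hc', hac, hb⟩ := ih (by omega)
      have hδr := hδ r (by omega)
      have hwa := hmin' r (by omega)
      have hwc := hmin r (by omega)
      rw [ha] at hwa hδr
      rw [hc'] at hwc hδr
      have hai : (simple m₁ n₁).π a ≠ i := fun h' =>
        hwa (congrArg Sum.inl ((simple m₁ n₁).π.injective (h'.trans hσw.symm)))
      have hci : (simple m₁ n₁).π c ≠ i := fun h' =>
        hwc (congrArg Sum.inl ((simple m₁ n₁).π.injective (h'.trans hσw.symm)))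
      have hκ : κ (.inl a) < κ (.inl c) := by
        rw [pos_inl, pos_inl]; split_ifs <;> omega
      have hst := hS.step hκ hb hδr.symm
      rw [smallMod_inl, if_neg hai, smallMod_inl, if_neg hci] at hst
      refine ⟨(simple m₁ n₁).π a, (simple m₁ n₁).π c, ?_, ?_, ?_, hst.2⟩
      · rw [perm_pow_succ_apply, ha, smallMod_inl, if_neg hai]
      · rw [perm_pow_succ_apply, hc', smallMod_inl, if_neg hci]
      · rw [twoSegment_δ_inl, twoSegment_δ_inl] at hδr
        rw [simple_π_val, simple_π_val]
        split_ifs at hδr ⊢ <;> omega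
  obtain ⟨a, c, ha, hc', hac, hb⟩ := key k le_rfl
  obtain rfl : c = w := Sum.inl_injective (hc'.symm.trans hkw)
  have hδr := hδ k hkn
  rw [ha, hc', δ_inl_of_le (by omega)] at hδr
  have ham : m₁ ≤ (a : ℕ) := by
    by_contra h'
    rw [δ_inl_of_lt (by omega)] at hδr
    exact absurd hδr (by decide)
  have hσa := val_of_le ham
  have hai : (simple m₁ n₁).π a ≠ i := fun h' => by
    rw [h'] at hσa
    omega
  have hκ : κ (.inl a) < κ (.inl c) := by
    rw [pos_inl, pos_inl]; split_ifs <;> omega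
  have hst := hS.step hκ hb (by rw [δ_inl_of_le ham, δ_inl_of_le (by omega)])
  rw [smallMod_inl, if_neg hai, smallMod_inl, if_pos hσw] at hst
  -- Now w has gone to y, and `a` is w - (z - i). Since z - i < n₁ - m₁, the image of `a` satisfies
  -- the bound required of the pair to be followed.
  obtain ⟨N, hN⟩ := exists_simple_π_pow hc ((simple m₁ n₁).π a) i
  refine hG.false_of_pair_of_lt h₁ h₂ hi hj N _ _ hN ?_ hst.1 hst.2
    (Or.inl ⟨by omega, hj, by omega⟩)
  rw [pos_inl_of_lt (by omega)]; omega

/-- If the predecessor of `y` survives on the way from `y`, the exchange is not good. -/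
theorem not_isGood_of_survivors_inr (hc : Nat.Coprime m₂ n₂) (h₁ : m₁ < n₁) (h₂ : n₂ < m₂)
    (hi : m₁ ≤ (i : ℕ) ∧ (i : ℕ) < n₁) (hj : (j : ℕ) < n₂) {v : Fin (m₂ + n₂)}
    (hv : (v : ℕ) = j + m₂) {n : ℕ}
    (h : .inr v ∈ survivors ψ δ₀ {t | ∃ z : Fin (m₂ + n₂), t = .inr z ∧ z < j} (.inr j) n) :
    ¬ 𝔾 := by
  classical
  intro hG
  have hS := isStable_pos h₁ h₂
  have hκi : κ (.inl i) = i := pos_inl_of_lt hi.2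
  have hκj : κ (.inr j) = n₁ + j := pos_inr_of_lt hj
  have hδi : δ₀ (.inl i) = 0 := δ_inl_of_le hi.1
  have hδj : δ₀ (.inr j) = 1 := δ_inr_of_lt (by omega)
  obtain ⟨_, ⟨z, rfl, hzj⟩, hz, hδ⟩ := h
  have hzj' : (z : ℕ) < j := hzj
  have hex : ∃ n, (ψ ^ n) (.inr z) = .inr v := ⟨n, hz⟩
  set k := Nat.find hex with hk
  have hkv : (ψ ^ k) (.inr z) = .inr v := Nat.find_spec hex
  have hkn : k ≤ n := Nat.find_min' hex hz
  have hmin : ∀ r < k, (ψ ^ r) (.inr z) ≠ .inr v := fun r hr => Nat.find_min hex hr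
  have hτv : (simple m₂ n₂).π v = j := Fin.ext (by rw [val_of_le (by omega)]; omega)
  have harc := isArc_inr (n₁ := n₁) (i := i) hc hτv
  have hmin' := harc.pow_start_ne_end ⟨z, rfl⟩ hmin
  have hzj0 : z ≠ j := hzj.ne
  have hκz : κ (.inr z) = n₁ + z := pos_inr_of_lt (by omega)
  have key : ∀ r ≤ k, ∃ d c : Fin (m₂ + n₂), (ψ ^ r) (.inr j) = .inr d ∧
      (ψ ^ r) (.inr z) = .inr c ∧ (c : ℕ) < d ∧ 𝔟 (.inr d) < 𝔟 (.inr c) := by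
    intro r
    induction r with
    | zero =>
      intro _
      refine ⟨j, z, by simp, by simp, by omega, hG.reversed _ _ (by omega) ?_ ?_⟩
      · rw [swapPos_right, swapPos_inr i j hzj0]; omega
      · rw [hδj, δ_inr_of_lt (by omega)]
    | succ r ih =>
      intro hr
      obtain ⟨d, c, hd, hc', hcd, hb⟩ := ih (by omega)
      have hδr := hδ r (by omega)
      have hwd := hmin' r (by omega)
      have hwc := hmin r (by omega)
      rw [hd] at hwd hδr
      rw [hc'] at hwc hδr
      have hdj : (simple m₂ n₂).π d ≠ j := fun h' =>
        hwd (congrArg Sum.inr ((simple m₂ n₂).π.injective (h'.trans hτv.symm)))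
      have hcj : (simple m₂ n₂).π c ≠ j := fun h' =>
        hwc (congrArg Sum.inr ((simple m₂ n₂).π.injective (h'.trans hτv.symm)))
      have hκ : κ (.inr c) < κ (.inr d) := by
        rw [pos_inr, pos_inr]; split_ifs <;> omega
      have hst := hS.step hκ hb hδr
      rw [smallMod_inr, if_neg hcj, smallMod_inr, if_neg hdj] at hst
      refine ⟨(simple m₂ n₂).π d, (simple m₂ n₂).π c, ?_, ?_, ?_, hst.2⟩
      · rw [perm_pow_succ_apply, hd, smallMod_inr, if_neg hdj]
      · rw [perm_pow_succ_apply, hc', smallMod_inr, if_neg hcj]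
      · rw [twoSegment_δ_inr, twoSegment_δ_inr] at hδr
        rw [simple_π_val, simple_π_val]
        split_ifs at hδr ⊢ <;> omega
  obtain ⟨d, c, hd, hc', hcd, hb⟩ := key k le_rfl
  obtain rfl : c = v := Sum.inr_injective (hc'.symm.trans hkv)
  have hτd := val_of_le (n := n₂) (a := d) (by omega)
  have hd2 := d.2
  have hdj : (simple m₂ n₂).π d ≠ j := fun h' => by
    rw [h'] at hτd
    omega
  have hκ : κ (.inr c) < κ (.inr d) := by
    rw [pos_inr, pos_inr]; split_ifs <;> omega
  have hst := hS.step hκ hb (by rw [δ_inr_of_le (by omega), δ_inr_of_le (by omega)])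
  rw [smallMod_inr, if_pos hτv, smallMod_inr, if_neg hdj] at hst
  have hκd := pos_inr_of_lt (m₁ := m₁) (n₁ := n₁) (b := (simple m₂ n₂).π d) (by omega)
  -- Here v has gone to x and `d` to a one of B on the right of y: a lost (0,1)-pair that the
  -- interchange does not reverse.
  exact hG.not_zero_one (by omega) hst.1 hst.2 hδi (δ_inr_of_lt (by omega))

/-- The reversed pairs with equal symbols, for `x` and `y` in the first two zones. -/
theorem reversed_cases_twoSegment (h₁ : m₁ < n₁) (h₂ : n₂ < m₂)
    (hi : m₁ ≤ (i : ℕ) ∧ (i : ℕ) < n₁) (hj : (j : ℕ) < n₂)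
    {s t : Fin (m₁ + n₁) ⊕ Fin (m₂ + n₂)} (h : κ s < κ t) (h0 : κ₀ t < κ₀ s) (hδ : δ₀ s = δ₀ t) :
    (s = .inl i ∧ ∃ z : Fin (m₁ + n₁), t = .inl z ∧ i < z ∧ (z : ℕ) < n₁) ∨
      (t = .inr j ∧ ∃ z : Fin (m₂ + n₂), s = .inr z ∧ z < j) := by
  have hS := isStable_pos h₁ h₂
  have hκi : κ (.inl i) = i := pos_inl_of_lt hi.2
  have hκj : κ (.inr j) = n₁ + j := pos_inr_of_lt hj
  have hδi : δ₀ (.inl i) = 0 := δ_inl_of_le hi.1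
  have hδj : δ₀ (.inr j) = 1 := δ_inr_of_lt (by omega)
  rcases (reversed_cases hS.inj (by omega)).1 ⟨h, h0⟩ with ⟨rfl, h3, h4⟩ | ⟨rfl, h3, h4⟩
  · left
    refine ⟨rfl, ?_⟩
    rcases t with z | z
    · refine ⟨z, rfl, ?_, ?_⟩
      · rw [Fin.lt_def]
        rw [hκi, pos_inl] at h3; rw [hκj, pos_inl] at h4
        split_ifs at h3 h4 <;> omega
      · rw [pos_inl] at h4
        split_ifs at h4 <;> omega
    · exfalso
      rw [pos_inr] at h4
      have : (z : ℕ) < n₂ := by split_ifs at h4 <;> omega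
      rw [hδi, δ_inr_of_lt (by omega)] at hδ
      exact absurd hδ (by decide)
  · right
    refine ⟨rfl, ?_⟩
    rcases s with z | z
    · exfalso
      have : (i : ℕ) < z := by
        rw [hκi, pos_inl] at h3; rw [hκj, pos_inl] at h4
        split_ifs at h3 h4 <;> omega
      rw [hδj, δ_inl_of_le (by omega)] at hδ
      exact absurd hδ (by decide)
    · refine ⟨z, rfl, ?_⟩
      rw [Fin.lt_def]
      rw [pos_inr] at h4
      split_ifs at h4 <;> omega

/-- If neither predecessor survives, the exchange is good. -/
theorem isGood_of_survivors (hc₁ : Nat.Coprime m₁ n₁) (hc₂ : Nat.Coprime m₂ n₂)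
    (h₁ : m₁ < n₁) (h₂ : n₂ < m₂)
    (hi : m₁ ≤ (i : ℕ) ∧ (i : ℕ) < n₁) (hj : (j : ℕ) < n₂)
    {w : Fin (m₁ + n₁)} (hw : (w : ℕ) = i + m₁) {v : Fin (m₂ + n₂)} (hv : (v : ℕ) = j + m₂)
    (hA : ∀ n, .inl w ∉ survivors ψ δ₀
      {t | ∃ z : Fin (m₁ + n₁), t = .inl z ∧ i < z ∧ (z : ℕ) < n₁} (.inl i) n)
    (hB : ∀ n, .inr v ∉ survivors ψ δ₀ {t | ∃ z : Fin (m₂ + n₂), t = .inr z ∧ z < j} (.inr j) n) :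
    𝔾 := by
  have hS := isStable_pos h₁ h₂
  have hκi : κ (.inl i) = i := pos_inl_of_lt hi.2
  have hκj : κ (.inr j) = n₁ + j := pos_inr_of_lt hj
  have hδi : δ₀ (.inl i) = 0 := δ_inl_of_le hi.1
  have hδj : δ₀ (.inr j) = 1 := δ_inr_of_lt (by omega)
  have hσw : (simple m₁ n₁).π w = i := Fin.ext (by rw [val_of_le (by omega)]; omega)
  have hτv : (simple m₂ n₂).π v = j := Fin.ext (by rw [val_of_le (by omega)]; omega)
  have arcA := isArc_inl (n₂ := n₂) (j := j) hc₁ hσw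
  have arcB := isArc_inr (n₁ := n₁) (i := i) hc₂ hτv
  -- the orbits of a pair in `A` stay in `A`, in the same order, as long as the symbols agree
  have chainA : ∀ z : Fin (m₁ + n₁), i < z → (z : ℕ) < n₁ → ∀ k,
      (∀ r ≤ k, δ₀ ((ψ ^ r) (.inl i)) = δ₀ ((ψ ^ r) (.inl z))) →
      ∃ a c : Fin (m₁ + n₁), (ψ ^ (k + 1)) (.inl i) = .inl a ∧ (ψ ^ (k + 1)) (.inl z) = .inl c ∧
        a < c ∧ c ≠ i := by
    intro z hiz hzn k hk
    have hz : ∀ r < k + 1, (ψ ^ r) (.inl z) ≠ .inl w := fun r hr h =>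
      hA r ⟨_, ⟨z, rfl, hiz, hzn⟩, h, fun q hq => (hk q (by omega)).symm⟩
    have hx := arcA.pow_start_ne_end ⟨z, rfl⟩ hz
    have key : ∀ r ≤ k + 1, ∃ a c : Fin (m₁ + n₁), (ψ ^ r) (.inl i) = .inl a ∧
        (ψ ^ r) (.inl z) = .inl c ∧ (a : ℕ) < c := by
      intro r
      induction r with
      | zero => intro _; exact ⟨i, z, by simp, by simp, hiz⟩
      | succ r ih =>
        intro hr
        obtain ⟨a, c, ha, hc, hac⟩ := ih (by omega)
        have hδr := hk r (by omega)
        have hwa := hx r (by omega)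
        have hwc := hz r (by omega)
        rw [ha] at hwa hδr
        rw [hc] at hwc hδr
        have hai : (simple m₁ n₁).π a ≠ i := fun h' =>
          hwa (congrArg Sum.inl ((simple m₁ n₁).π.injective (h'.trans hσw.symm)))
        have hci : (simple m₁ n₁).π c ≠ i := fun h' =>
          hwc (congrArg Sum.inl ((simple m₁ n₁).π.injective (h'.trans hσw.symm)))
        refine ⟨(simple m₁ n₁).π a, (simple m₁ n₁).π c, ?_, ?_, ?_⟩
        · rw [perm_pow_succ_apply, ha, smallMod_inl, if_neg hai]
        · rw [perm_pow_succ_apply, hc, smallMod_inl, if_neg hci]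
        · rw [twoSegment_δ_inl, twoSegment_δ_inl] at hδr
          rw [simple_π_val, simple_π_val]
          split_ifs at hδr ⊢ <;> omega
    obtain ⟨a, c, ha, hc, hac⟩ := key (k + 1) le_rfl
    refine ⟨a, c, ha, hc, hac, ?_⟩
    rintro rfl
    exact arcA.pow_ne_start ⟨z, rfl⟩ hz (k + 1) le_rfl (by omega) hc
  have chainB : ∀ z : Fin (m₂ + n₂), z < j → ∀ k,
      (∀ r ≤ k, δ₀ ((ψ ^ r) (.inr z)) = δ₀ ((ψ ^ r) (.inr j))) →
      ∃ c d : Fin (m₂ + n₂), (ψ ^ (k + 1)) (.inr z) = .inr c ∧ (ψ ^ (k + 1)) (.inr j) = .inr d ∧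
        c < d ∧ c ≠ j := by
    intro z hzj k hk
    have hz : ∀ r < k + 1, (ψ ^ r) (.inr z) ≠ .inr v := fun r hr h =>
      hB r ⟨_, ⟨z, rfl, hzj⟩, h, fun q hq => (hk q (by omega))⟩
    have hx := arcB.pow_start_ne_end ⟨z, rfl⟩ hz
    have key : ∀ r ≤ k + 1, ∃ c d : Fin (m₂ + n₂), (ψ ^ r) (.inr z) = .inr c ∧
        (ψ ^ r) (.inr j) = .inr d ∧ (c : ℕ) < d := by
      intro r
      induction r with
      | zero => intro _; exact ⟨z, j, by simp, by simp, hzj⟩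
      | succ r ih =>
        intro hr
        obtain ⟨c, d, hc, hd, hcd⟩ := ih (by omega)
        have hδr := hk r (by omega)
        have hwd := hx r (by omega)
        have hwc := hz r (by omega)
        rw [hd] at hwd hδr
        rw [hc] at hwc hδr
        have hdj : (simple m₂ n₂).π d ≠ j := fun h' =>
          hwd (congrArg Sum.inr ((simple m₂ n₂).π.injective (h'.trans hτv.symm)))
        have hcj : (simple m₂ n₂).π c ≠ j := fun h' =>
          hwc (congrArg Sum.inr ((simple m₂ n₂).π.injective (h'.trans hτv.symm)))
        refine ⟨(simple m₂ n₂).π c, (simple m₂ n₂).π d, ?_, ?_, ?_⟩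
        · rw [perm_pow_succ_apply, hc, smallMod_inr, if_neg hcj]
        · rw [perm_pow_succ_apply, hd, smallMod_inr, if_neg hdj]
        · rw [twoSegment_δ_inr, twoSegment_δ_inr] at hδr
          rw [simple_π_val, simple_π_val]
          split_ifs at hδr ⊢ <;> omega
    obtain ⟨c, d, hc, hd, hcd⟩ := key (k + 1) le_rfl
    refine ⟨c, d, hc, hd, hcd, ?_⟩
    rintro rfl
    exact arcB.pow_ne_start ⟨z, rfl⟩ hz (k + 1) le_rfl (by omega) hc
  -- pairs violating the order with `x` and `y` interchanged
  have main : ∀ s t, κ₀ s < κ₀ t → 𝔟 t < 𝔟 s →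
      (∃ a c : Fin (m₁ + n₁), s = .inl a ∧ t = .inl c ∧ a < c ∧ c ≠ i) ∨
        (∃ c d : Fin (m₂ + n₂), s = .inr c ∧ t = .inr d ∧ c < d ∧ c ≠ j) := by
    intro s t h hb
    obtain ⟨k, l₁, l₂, rfl, rfl, h3, h4, h5⟩ := hS.descent h hb
    rcases reversed_cases_twoSegment h₁ h₂ hi hj h3 h4 (by simpa using h5 0 (by omega)) with
      ⟨rfl, z, rfl, hz, hz'⟩ | ⟨rfl, z, rfl, hz⟩
    · exact Or.inl (chainA z hz hz' k h5)
    · exact Or.inr (chainB z hz k h5)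
  constructor
  · intro s t h hs ht hb
    by_contra h0
    have hne : κ₀ s ≠ κ₀ t := fun h' => by
      rw [swapPos_injective hS.inj _ _ h'] at h
      exact lt_irrefl _ h
    -- In A and in B the ones come first, so an increasing pair inside one summand is never a
    -- (0,1)-pair.
    rcases main s t (by omega) hb with ⟨a, c, rfl, rfl, hac, -⟩ | ⟨c, d, rfl, rfl, hcd, -⟩
    · rw [twoSegment_δ_inl] at hs ht
      rw [Fin.lt_def] at hac
      split_ifs at hs ht <;> omega
    · rw [twoSegment_δ_inr] at hs ht
      rw [Fin.lt_def] at hcd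
      split_ifs at hs ht <;> omega
  · intro s t h h0 hδ
    rcases lt_trichotomy (𝔟 t) (𝔟 s) with hb | hb | hb
    · exact hb
    · exfalso
      -- Equal expansions would make the symbols agree forever, so z would survive until it reaches
      -- the end of its arc.
      have hδr := δ_pow_eq_of_binExp_eq hb
      rcases reversed_cases_twoSegment h₁ h₂ hi hj h h0 hδ with
        ⟨rfl, z, rfl, hz, hz'⟩ | ⟨rfl, z, rfl, hz⟩
      · obtain ⟨k, hk⟩ := arcA.exists_pow_eq_end (z := .inl z) ⟨z, rfl⟩
        exact hA k ⟨_, ⟨z, rfl, hz, hz'⟩, hk, fun r _ => hδr r⟩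
      · obtain ⟨k, hk⟩ := arcB.exists_pow_eq_end (z := .inr z) ⟨z, rfl⟩
        exact hB k ⟨_, ⟨z, rfl, hz⟩, hk, fun r _ => (hδr r).symm⟩
    · exfalso
      rcases reversed_cases_twoSegment h₁ h₂ hi hj h h0 hδ with
        ⟨rfl, z, rfl, hz, hz'⟩ | ⟨rfl, z, rfl, hz⟩
      · rcases main _ _ h0 hb with ⟨a, c, h3, h4, -, h5⟩ | ⟨c, d, h3, h4, -⟩
        · exact h5 (Sum.inl_injective h4).symm
        · simp at h3
      · rcases main _ _ h0 hb with ⟨a, c, h3, h4, -, h5⟩ | ⟨c, d, h3, h4, -, h5⟩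
        · simp at h3
        · exact h5 (Sum.inr_injective h3).symm

end

/-! ### An abstract theory of the successive moves. -/

/-- `r` is a strict total order. -/
structure StrictTotal {T : Type} (r : T → T → Prop) : Prop where
  irrefl : ∀ a, ¬ r a a
  trans : ∀ {a b c}, r a b → r b c → r a c
  total : ∀ {a b}, a ≠ b → r a b ∨ r b a

namespace StrictTotal

variable {T : Type} {r : T → T → Prop}

theorem asymm (h : StrictTotal r) {a b : T} (hab : r a b) : ¬ r b a :=
  fun hba => h.irrefl a (h.trans hab hba)

theorem ne (h : StrictTotal r) {a b : T} (hab : r a b) : a ≠ b := by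
  rintro rfl
  exact h.irrefl _ hab

theorem of_not (h : StrictTotal r) {a b : T} (hne : a ≠ b) (hab : ¬ r a b) : r b a :=
  (h.total hne).resolve_left hab

theorem of_linearOrder (o : LinearOrder T) : StrictTotal o.lt where
  irrefl := fun a => lt_irrefl a
  trans := fun h h' => lt_trans h h'
  total := fun h => lt_or_gt_of_ne h

theorem flip (h : StrictTotal r) : StrictTotal fun a b => r b a where
  irrefl := h.irrefl
  trans := fun h1 h2 => h.trans h2 h1
  total := fun hne => (h.total hne).symm

end StrictTotal

section

variable {T : Type}

/-- The sequence of orders `lt n` in which `π ^ n x` is successively moved to the right, past the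
image of the largest element of `E n`; `C` is the set to which the `E n` are restricted. -/
structure MoveProcess (π : Equiv.Perm T) (δ : T → Fin 2) (C : Set T) (x : T)
    (lt : ℕ → T → T → Prop) (E : ℕ → Set T) : Prop where
  order : ∀ n, StrictTotal (lt n)
  mem_zero : ∀ t, t ∈ E 0 ↔ t ∈ C ∧ lt 0 t x ∧ lt 0 (π x) (π t) ∧ δ t = δ x
  mem_succ : ∀ n, (E n).Nonempty → ∀ t, t ∈ E (n + 1) ↔ t ∈ C ∧ lt (n + 1) t ((π ^ (n + 1)) x) ∧
    lt (n + 1) (π ((π ^ (n + 1)) x)) (π t) ∧ δ t = δ ((π ^ (n + 1)) x)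
  empty_succ : ∀ n, ¬ (E n).Nonempty → ¬ (E (n + 1)).Nonempty
  move : ∀ n, (E n).Nonempty → ∃ m ∈ E n, (∀ t ∈ E n, t ≠ m → lt n t m) ∧
    (∀ s t, s ≠ (π ^ (n + 1)) x → t ≠ (π ^ (n + 1)) x → (lt (n + 1) s t ↔ lt n s t)) ∧
    ∀ t, t ≠ (π ^ (n + 1)) x → (lt (n + 1) t ((π ^ (n + 1)) x) ↔ t = π m ∨ lt n t (π m))

/-- The only pairs of elements with equal symbols meeting `D` whose order `π` does not preserve
are formed by `x` and elements of `D` on its left; `D` is the arc from `x` to `w`. -/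
structure MoveSetup (π : Equiv.Perm T) (δ : T → Fin 2) (C D : Set T) (x w : T)
    (lt : T → T → Prop) : Prop where
  arc : IsArc π D x w
  subset : D ⊆ C
  lt_iff : ∀ s t, s ≠ x → t ≠ x → δ s = δ t → (s ∈ D ∨ t ∈ D) → (lt s t ↔ lt (π s) (π t))
  lt_of_start : ∀ t, lt x t → δ t = δ x → lt (π x) (π t)
  between : ∀ s t u, s ∈ D → t ∈ D → s ≠ w → t ≠ w → δ s = δ t → lt (π s) (π u) →
    lt (π u) (π t) → δ u = δ s ∧ u ∈ C
  mem : ∀ t, lt t x → lt (π x) (π t) → δ t = δ x → t ∈ D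

theorem mem_survivors_succ {π : Equiv.Perm T} {δ : T → Fin 2} {E : Set T} {x : T} {n : ℕ} {b : T} :
    b ∈ survivors π δ E x (n + 1) ↔
      ∃ t ∈ survivors π δ E x n, b = π t ∧ δ b = δ ((π ^ (n + 1)) x) := by
  constructor
  · rintro ⟨z, hz, rfl, hr⟩
    exact ⟨_, ⟨z, hz, rfl, fun r hr' => hr r (by omega)⟩, perm_pow_succ_apply _ _ _, hr _ le_rfl⟩
  · rintro ⟨_, ⟨z, hz, rfl, hr⟩, rfl, h⟩
    refine ⟨z, hz, perm_pow_succ_apply _ _ _, fun r hr' => ?_⟩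
    rcases Nat.lt_or_ge n r with h' | h'
    · obtain rfl : r = n + 1 := by omega
      rw [perm_pow_succ_apply π n z, h]
    · exact hr r h'

theorem δ_of_mem_survivors {π : Equiv.Perm T} {δ : T → Fin 2} {E : Set T} {x : T} {n : ℕ} {b : T}
    (h : b ∈ survivors π δ E x n) : δ b = δ ((π ^ n) x) := by
  obtain ⟨z, hz, rfl, hr⟩ := h
  exact hr n le_rfl

theorem mem_survivors_zero {π : Equiv.Perm T} {δ : T → Fin 2} {E : Set T} {x b : T} :
    b ∈ survivors π δ E x 0 ↔ b ∈ E ∧ δ b = δ x := by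
  constructor
  · rintro ⟨z, hz, rfl, hr⟩
    exact ⟨by simpa using hz, by simpa using hr 0 le_rfl⟩
  · rintro ⟨h, h'⟩
    exact ⟨b, h, by simp, fun r hr => by obtain rfl : r = 0 := by omega
                                         simpa using h'⟩

variable {π : Equiv.Perm T} {δ : T → Fin 2} {C D : Set T} {x w : T}
  {lt : ℕ → T → T → Prop} {E : ℕ → Set T}

/-- The facts about survivors of level `n`, as long as `w` has not occurred before. -/
theorem MoveSetup.survivor (hS : MoveSetup π δ C D x w (lt 0)) (hP : MoveProcess π δ C x lt E)
    {n : ℕ} {t : T} (hw : ∀ r < n, w ∉ survivors π δ (E 0) x r)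
    (ht : t ∈ survivors π δ (E 0) x n) :
    t ∈ D ∧ (∀ r ≤ n, t ≠ (π ^ r) x) ∧ (∀ r ≤ n, (π ^ r) x ∈ D) ∧
      (∀ r ≤ n, 1 ≤ r → (π ^ r) x ≠ x) ∧ (∀ r < n, (π ^ r) x ≠ w) ∧
      lt 0 ((π ^ (n + 1)) x) (π t) := by
  obtain ⟨z, hz, rfl, hδ⟩ := ht
  have hz0 := (hP.mem_zero z).1 hz
  have hzD := hS.mem z hz0.2.1 hz0.2.2.1 hz0.2.2.2
  have hzw : ∀ r < n, (π ^ r) z ≠ w := fun r hr h =>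
    hw r hr ⟨z, hz, h, fun q hq => hδ q (by omega)⟩
  have hxw := hS.arc.pow_start_ne_end hzD hzw
  have hzne : z ≠ x := (hP.order 0).ne hz0.2.1
  refine ⟨hS.arc.pow_mem hzD hzw n le_rfl, fun r hr h => ?_, hS.arc.pow_mem hS.arc.start_mem hxw,
    hS.arc.pow_ne_start hS.arc.start_mem hxw, hxw, ?_⟩
  · have e : (π ^ (n - r)) z = x := by
      apply (π ^ r).injective
      rw [← Equiv.Perm.mul_apply, ← pow_add, Nat.add_sub_cancel' hr, h]
    rcases Nat.eq_zero_or_pos (n - r) with h0 | h0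
    · rw [h0] at e
      exact hzne (by simpa using e)
    · exact hS.arc.pow_ne_start hzD hzw (n - r) (by omega) h0 e
  · have key : ∀ r ≤ n, lt 0 ((π ^ (r + 1)) x) ((π ^ (r + 1)) z) := by
      intro r
      induction r with
      | zero => intro _; simpa using hz0.2.2.1
      | succ r ih =>
        intro hr
        rw [perm_pow_succ_apply π (r + 1) x, perm_pow_succ_apply π (r + 1) z, ← hS.lt_iff]
        · exact ih (by omega)
        · exact hS.arc.pow_ne_start hS.arc.start_mem hxw _ hr (by omega)
        · exact hS.arc.pow_ne_start hzD hzw _ hr (by omega)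
        · exact (hδ _ hr).symm
        · exact Or.inl (hS.arc.pow_mem hS.arc.start_mem hxw _ hr)
    rw [← perm_pow_succ_apply π n z]
    exact key n le_rfl

/-- The facts about images of survivors of level `n`, as long as `w` has not occurred. -/
theorem MoveSetup.survivor_map (hS : MoveSetup π δ C D x w (lt 0))
    (hP : MoveProcess π δ C x lt E) {n : ℕ} {t : T}
    (hw : ∀ r ≤ n, w ∉ survivors π δ (E 0) x r) (ht : t ∈ survivors π δ (E 0) x n) :
    π t ∈ D ∧ (∀ r ≤ n + 1, π t ≠ (π ^ r) x) ∧ (∀ r ≤ n + 1, (π ^ r) x ∈ D) ∧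
      (∀ r ≤ n + 1, 1 ≤ r → (π ^ r) x ≠ x) ∧ (∀ r ≤ n, (π ^ r) x ≠ w) ∧
      (∀ r s, r < s → s ≤ n + 1 → (π ^ s) x ≠ (π ^ r) x) := by
  obtain ⟨z, hz, rfl, hδ⟩ := ht
  have hz0 := (hP.mem_zero z).1 hz
  have hzD := hS.mem z hz0.2.1 hz0.2.2.1 hz0.2.2.2
  have hzw : ∀ r < n + 1, (π ^ r) z ≠ w := fun r hr h =>
    hw r (by omega) ⟨z, hz, h, fun q hq => hδ q (by omega)⟩
  have hxw := hS.arc.pow_start_ne_end hzD hzw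
  have hzne : z ≠ x := (hP.order 0).ne hz0.2.1
  rw [← perm_pow_succ_apply]
  have hne := hS.arc.pow_ne_start hS.arc.start_mem hxw
  refine ⟨hS.arc.pow_mem hzD hzw _ le_rfl, fun r hr h => ?_,
    hS.arc.pow_mem hS.arc.start_mem hxw, hne, fun r hr => hxw r (by omega), fun r s hrs hs h => ?_⟩
  · have e : (π ^ (n + 1 - r)) z = x := by
      apply (π ^ r).injective
      rw [← Equiv.Perm.mul_apply, ← pow_add, Nat.add_sub_cancel' hr, h]
    rcases Nat.eq_zero_or_pos (n + 1 - r) with h0 | h0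
    · rw [h0] at e
      exact hzne (by simpa using e)
    · exact hS.arc.pow_ne_start hzD hzw (n + 1 - r) (by omega) h0 e
  · refine hne (s - r) (by omega) (by omega) ?_
    apply (π ^ r).injective
    rw [← Equiv.Perm.mul_apply, ← pow_add, Nat.add_sub_cancel' hrs.le, h]

/-- The pairs reversed in the first `n` moves. -/
def movedPast (π : Equiv.Perm T) (δ : T → Fin 2) (E : Set T) (x : T) (n : ℕ) (a b : T) : Prop :=
  ∃ r < n, a = (π ^ (r + 1)) x ∧ ∃ t ∈ survivors π δ E x r, b = π t

/-- As long as w has not survived, everything followed stays in D, where π preserves order except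
for x. The move to level n + 1 takes α_{n+1} past the images of the survivors of level n and nothing
else in its way. Orders and sets must go through one induction: `E n` determines the next move, and
the new order identifies `E (n + 1)`. -/
theorem MoveProcess.invariant (hS : MoveSetup π δ C D x w (lt 0)) (hP : MoveProcess π δ C x lt E)
    (n : ℕ) (hw : ∀ r < n, w ∉ survivors π δ (E 0) x r)
    (hne : ∀ r < n, (survivors π δ (E 0) x r).Nonempty) :
    (∀ a b, lt 0 a b → ¬ movedPast π δ (E 0) x n a b → lt n a b) ∧
    (∀ a b, movedPast π δ (E 0) x n a b → lt n b a) ∧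
    E n = survivors π δ (E 0) x n := by
  induction n with
  | zero =>
    refine ⟨fun a b h _ => h, ?_, ?_⟩
    · rintro a b ⟨r, hr, -⟩
      omega
    · ext t
      rw [mem_survivors_zero]
      exact ⟨fun h => ⟨h, ((hP.mem_zero t).1 h).2.2.2⟩, fun h => h.1⟩
  | succ n ih =>
    obtain ⟨u1, u2, hE⟩ := ih (fun r hr => hw r (by omega)) (fun r hr => hne r (by omega))
    set K := survivors π δ (E 0) x with hK
    set M := movedPast π δ (E 0) x with hM
    have hw' : ∀ r < n, w ∉ K r := fun r hr => hw r (by omega)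
    have hwn : ∀ r ≤ n, w ∉ K r := fun r hr => hw r (by omega)
    have hEn : (E n).Nonempty := by rw [hE]; exact hne n (by omega)
    obtain ⟨m, hmE, hmax, hmv1, hmv2⟩ := hP.move n hEn
    have hmK : m ∈ K n := hE ▸ hmE
    obtain ⟨mD, m_ne, αD, α_ne, α_w, hm_lt⟩ := hS.survivor hP hw' hmK
    obtain ⟨πmD, πm_ne, αD', α_ne', α_w', α_inj⟩ := hS.survivor_map hP hwn hmK
    have mw : m ≠ w := fun h => hwn n le_rfl (h ▸ hmK)
    have mx : m ≠ x := by simpa using m_ne 0 (by omega)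
    have hO := hP.order n
    have hO0 := hP.order 0
    have hO' := hP.order (n + 1)
    set α' := (π ^ (n + 1)) x with hα'
    have hα'n : α' = π ((π ^ n) x) := perm_pow_succ_apply _ _ _
    have hEdef : ∀ t, t ∈ E n ↔ t ∈ C ∧ lt n t ((π ^ n) x) ∧ lt n α' (π t) ∧
        δ t = δ ((π ^ n) x) := by
      rcases n with _ | k
      · intro t
        simpa [hα'] using hP.mem_zero t
      · intro t
        rw [hα'n]
        refine hP.mem_succ k ?_ t
        by_contra h
        exact hP.empty_succ k h hEn
    have hmδ : δ m = δ ((π ^ n) x) := ((hEdef m).1 hmE).2.2.2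
    have hmα : lt n m ((π ^ n) x) := ((hEdef m).1 hmE).2.1
    have Mpm : ∀ b, ¬ M n (π m) b := by
      rintro b ⟨r, hr, h, -⟩
      exact πm_ne _ (by omega) h
    have Mα' : ∀ b, ¬ M n α' b := by
      rintro b ⟨r, hr, h, -⟩
      exact α_inj (r + 1) (n + 1) (by omega) le_rfl h
    have Mx1 : ∀ b, ¬ M n x b := by
      rintro b ⟨r, hr, h, -⟩
      exact α_ne (r + 1) (by omega) (by omega) h.symm
    have Mx2 : ∀ a, ¬ M n a x := by
      rintro a ⟨r, hr, -, t, ht, h⟩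
      exact hS.arc.ne_start t (hS.survivor hP (fun q hq => hw' q (by omega)) ht).1 h.symm
    have not_lt0 : ∀ {a b}, lt n a b → lt 0 b a → M n b a := by
      intro a b h h0
      by_contra hM'
      exact hO.asymm h (u1 b a h0 hM')
    have not_M : ∀ {a b}, lt n a b → ¬ M n a b := fun h hM' => hO.asymm h (u2 _ _ hM')
    have Msucc : ∀ {a b}, M (n + 1) a b ↔ M n a b ∨ (a = α' ∧ ∃ t ∈ K n, b = π t) := by
      intro a b
      constructor
      · rintro ⟨r, hr, h1, h2⟩
        rcases Nat.lt_or_ge r n with h | h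
        · exact Or.inl ⟨r, h, h1, h2⟩
        · obtain rfl : r = n := by omega
          exact Or.inr ⟨h1, h2⟩
      · rintro (⟨r, hr, h⟩ | h)
        · exact ⟨r, by omega, h⟩
        · exact ⟨n, by omega, h⟩
    -- `x` is not to the right of `α_n` unless `m` is an initial survivor
    have key_x : δ x = δ m → lt 0 (π x) (π m) → m ∉ K 0 → ¬ lt 0 ((π ^ n) x) x := by
      intro hδx h1 h2 h3
      have h4 : ¬ lt 0 m x := fun h => h2 (mem_survivors_zero.2
        ⟨(hP.mem_zero m).2 ⟨hS.subset mD, h, h1, hδx.symm⟩, hδx.symm⟩)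
      exact Mx1 m (not_lt0 (hO.trans hmα (u1 _ _ h3 (Mx2 _))) (hO0.of_not mx h4))
    -- the elements between `α_{n+1}` and the image of `m`
    have c1 : ∀ s, lt 0 α' (π s) → lt n (π s) (π m) → s ∈ K n := by
      intro s h1 h2
      have h3 : lt 0 (π s) (π m) := by
        by_contra h
        exact Mpm _ (not_lt0 h2 (hO0.of_not (hO.ne h2) h))
      have h4 := not_M h2
      obtain ⟨hδs, hsC⟩ := hS.between _ m s (αD n le_rfl) mD (α_w' n le_rfl) mw hmδ.symm
        (hα'n ▸ h1) h3
      rw [← hE, hEdef]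
      refine ⟨hsC, ?_, u1 _ _ h1 (Mα' _), hδs⟩
      by_cases hsx : s = x
      · exfalso
        rw [hsx] at h1 h3 h4 hδs
        rcases Nat.eq_zero_or_pos n with h0 | h0
        · rw [hα'n, h0] at h1
          exact hO0.irrefl _ (by simpa using h1)
        · refine key_x (hδs.trans hmδ.symm) h3 (fun h => h4 ⟨0, h0, by simp, m, h, rfl⟩) ?_
          refine hO0.of_not (α_ne n le_rfl h0).symm fun h => ?_
          have h5 := hS.lt_of_start _ h hδs.symm
          rw [hα'n] at h1
          exact hO0.asymm h1 h5
      · have h5 : lt 0 s m := (hS.lt_iff s m hsx mx (hδs.trans hmδ.symm) (Or.inr mD)).2 h3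
        by_cases h6 : M n s m
        · exfalso
          obtain ⟨r, hr, h7, m', hm', h8⟩ := h6
          have h9 : m ∈ K (r + 1) := mem_survivors_succ.2
            ⟨m', hm', h8, by rw [hmδ, ← hδs, h7]⟩
          rcases Nat.lt_or_ge (r + 1) n with h10 | h10
          · exact h4 ⟨r + 1, h10, by rw [perm_pow_succ_apply π (r + 1), h7], m, h9, rfl⟩
          · obtain rfl : n = r + 1 := by omega
            rw [hα'n, h7] at h1
            exact hO0.irrefl _ h1
        · exact hO.trans (u1 _ _ h5 h6) hmα
    -- an element that `α_{n+1}` has been moved past is not moved past again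
    have c2 : ∀ a, M n a α' → ¬ lt n a (π m) := by
      rintro a ⟨r, hr, rfl, s, hs, h1⟩ h2
      obtain rfl : (π ^ n) x = s := π.injective (hα'n ▸ h1)
      have hwr : ∀ q < r, w ∉ K q := fun q hq => hw' q (by omega)
      have h3 := (hS.survivor hP hwr hs).2.2.2.2.2
      rw [← hα'n] at h3
      have h4 := hO0.trans h3 hm_lt
      have h5 : m ∉ K r := fun h => not_M h2 ⟨r, hr, rfl, m, h, rfl⟩
      have h6 : δ m = δ ((π ^ r) x) := hmδ.trans (δ_of_mem_survivors hs)
      rcases r with _ | q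
      · have h7 := (hP.mem_zero _).1 (mem_survivors_zero.1 hs).1
        refine key_x (by simpa using h6.symm) (by simpa using h4) h5 h7.2.1
      -- For r > 0, α_r has itself been moved past α_n. Since m is now on the left of α_n, α_r has
      -- been moved past m as well, which makes m a survivor of level r.
      · obtain ⟨s', hs', h7, -⟩ := mem_survivors_succ.1 hs
        have h8 : M n ((π ^ (q + 1)) x) ((π ^ n) x) := ⟨q, by omega, rfl, s', hs', h7⟩
        have h9 : lt n m ((π ^ (q + 1)) x) := hO.trans hmα (u2 _ _ h8)
        have h10 : lt 0 ((π ^ (q + 1)) x) ((π ^ n) x) := by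
          rw [h7]
          exact (hS.survivor hP (fun p hp => hw' p (by omega)) hs').2.2.2.2.2
        have h11 : lt 0 ((π ^ n) x) m := by
          obtain ⟨k, rfl⟩ : ∃ k, n = k + 1 := ⟨n - 1, by omega⟩
          obtain ⟨m', hm', h12, -⟩ := mem_survivors_succ.1 hmK
          rw [h12]
          exact (hS.survivor hP (fun p hp => hw' p (by omega)) hm').2.2.2.2.2
        obtain ⟨p, hp, h12, m', hm', h13⟩ := not_lt0 h9 (hO0.trans h10 h11)
        obtain rfl : p = q := by
          rcases Nat.lt_trichotomy p q with h | h | h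
          · exact absurd h12 (α_inj _ _ (by omega) (by omega))
          · exact h
          · exact absurd h12.symm (α_inj _ _ (by omega) (by omega))
        exact h5 (mem_survivors_succ.2 ⟨m', hm', h13, h6⟩)
    have v1 : ∀ a b, lt 0 a b → ¬ M (n + 1) a b → lt (n + 1) a b := by
      intro a b h1 h2
      have hMn : ¬ M n a b := fun h => h2 (Msucc.2 (Or.inl h))
      by_cases ha : a = α'
      · subst ha
        refine hO'.of_not (hO0.ne h1).symm fun h => ?_
        obtain ⟨s, rfl⟩ := π.surjective b
        rcases (hmv2 _ (hO0.ne h1).symm).1 h with h3 | h3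
        · exact h2 (Msucc.2 (Or.inr ⟨rfl, m, hmK, h3⟩))
        · exact h2 (Msucc.2 (Or.inr ⟨rfl, s, c1 s h1 h3, rfl⟩))
      · by_cases hb : b = α'
        · subst hb
          exact (hmv2 a ha).2 (Or.inr (hO.trans (u1 _ _ h1 hMn) (u1 _ _ hm_lt (Mα' _))))
        · exact (hmv1 a b ha hb).2 (u1 _ _ h1 hMn)
    have v2 : ∀ a b, M (n + 1) a b → lt (n + 1) b a := by
      intro a b h
      rcases Msucc.1 h with h1 | ⟨rfl, s, hs, rfl⟩
      · have ha : a ≠ α' := fun h => Mα' b (h ▸ h1)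
        by_cases hb : b = α'
        · subst hb
          refine hO'.of_not ha fun h2 => ?_
          rcases (hmv2 a ha).1 h2 with h3 | h3
          · exact Mpm _ (h3 ▸ h1)
          · exact c2 a h1 h3
        · exact (hmv1 b a hb ha).2 (u2 _ _ h1)
      · obtain ⟨sD, s_ne, -⟩ := hS.survivor hP hw' hs
        obtain ⟨-, πs_ne, -⟩ := hS.survivor_map hP hwn hs
        refine (hmv2 _ (πs_ne _ le_rfl)).2 ?_
        by_cases hsm : s = m
        · exact Or.inl (by rw [hsm])
        right
        have h1 := hmax s (hE ▸ hs) hsm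
        have h2 : lt 0 s m := by
          by_contra h3
          obtain ⟨r, hr, h4, -⟩ := not_lt0 h1 (hO0.of_not hsm h3)
          exact m_ne _ (by omega) h4
        refine u1 _ _ ((hS.lt_iff s m (by simpa using s_ne 0 (by omega)) mx
          ((δ_of_mem_survivors hs).trans hmδ.symm) (Or.inr mD)).1 h2) ?_
        rintro ⟨r, hr, h4, -⟩
        exact πs_ne _ (by omega) h4
    refine ⟨v1, v2, ?_⟩
    have not_lt0' : ∀ {a b}, lt (n + 1) a b → lt 0 b a → M (n + 1) b a := by
      intro a b h h0
      by_contra hM'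
      exact hO'.asymm h (v1 b a h0 hM')
    have not_M' : ∀ {a b}, lt (n + 1) a b → ¬ M (n + 1) a b := fun h hM' =>
      hO'.asymm h (v2 _ _ hM')
    ext t
    rw [hP.mem_succ n hEn, ← hα']
    constructor
    · rintro ⟨htC, h1, h2, hδ⟩
      have htα := hO'.ne h1
      -- An element that was left of α_{n+1} from the start would have to have its image passed
      -- without being passed itself. So t has been passed, and by the last move.
      rcases hO0.total htα with h3 | h3
      · exfalso
        by_cases htx : t = x
        · subst htx
          have h4 := hS.lt_of_start _ h3 hδ.symm
          obtain ⟨r, hr, h5, s, hs, h6⟩ := not_lt0' h2 h4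
          rw [perm_pow_succ_apply] at h5
          rcases Nat.eq_zero_or_pos r with h0 | h0
          · subst h0
            rw [← π.injective h6] at hs
            exact hO0.asymm h3 ((hP.mem_zero _).1 (mem_survivors_zero.1 hs).1).2.1
          · exact α_ne r (by omega) h0 (π.injective h5).symm
        · have h4 := (hS.lt_iff t α' htx (α_ne' _ le_rfl (by omega)) hδ
            (Or.inr (αD' _ le_rfl))).1 h3
          obtain ⟨r, hr, h5, s, hs, h6⟩ := not_lt0' h2 h4
          rw [perm_pow_succ_apply] at h5
          have h5' := π.injective h5
          rw [← π.injective h6] at hs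
          rcases r with _ | q
          · exact htx (by simpa using h5')
          · obtain ⟨s', hs', h7, -⟩ := mem_survivors_succ.1 hs
            exact not_M' h1 ⟨q, by omega, h5', s', hs', h7⟩
      · obtain ⟨r, hr, h4, s, hs, rfl⟩ := not_lt0' h1 h3
        obtain rfl : r = n := by
          by_contra h
          exact α_inj (r + 1) (n + 1) (by omega) le_rfl h4
        exact mem_survivors_succ.2 ⟨s, hs, rfl, hδ⟩
    · intro ht
      obtain ⟨s, hs, h1, h2⟩ := mem_survivors_succ.1 ht
      obtain ⟨tD, -, -, -, -, h3⟩ := hS.survivor hP hw ht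
      refine ⟨hS.subset tD, v2 _ _ (Msucc.2 (Or.inr ⟨rfl, s, hs, h1⟩)), ?_, h2⟩
      rw [perm_pow_succ_apply π (n + 1) x] at h3
      refine v1 _ _ h3 ?_
      rintro ⟨r, hr, h4, -⟩
      rw [perm_pow_succ_apply π r] at h4
      exact α_inj r (n + 1) hr le_rfl (π.injective h4)

/-- `w` occurs in one of the sets iff it survives. -/
theorem MoveProcess.exists_mem_iff (hS : MoveSetup π δ C D x w (lt 0))
    (hP : MoveProcess π δ C x lt E) :
    (∃ n, w ∈ E n) ↔ ∃ n, w ∈ survivors π δ (E 0) x n := by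
  classical
  have down : ∀ k r, (survivors π δ (E 0) x (r + k)).Nonempty →
      (survivors π δ (E 0) x r).Nonempty := by
    intro k r
    induction k with
    | zero => exact id
    | succ k ih =>
      rintro ⟨t, ht⟩
      obtain ⟨s, hs, -⟩ := mem_survivors_succ.1 ht
      exact ih ⟨s, hs⟩
  constructor
  · rintro ⟨n, hn⟩
    by_contra! h
    have hEne : ∀ r ≤ n, (E r).Nonempty := by
      intro r hr
      by_contra h0
      have : ∀ k, ¬ (E (r + k)).Nonempty := by
        intro k
        induction k with
        | zero => exact h0
        | succ k ih => exact hP.empty_succ _ ih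
      exact this (n - r) (by rw [Nat.add_sub_cancel' hr]; exact ⟨w, hn⟩)
    have key : ∀ r ≤ n, E r = survivors π δ (E 0) x r := by
      intro r
      induction r using Nat.strong_induction_on with
      | _ r ih =>
        intro hr
        refine (hP.invariant hS r (fun q _ => h q) fun q hq => ?_).2.2
        rw [← ih q hq (by omega)]
        exact hEne q (by omega)
    exact h n (key n le_rfl ▸ hn)
  · intro h
    -- The invariant is available only up to the first survival of w, which is enough.
    refine ⟨Nat.find h, ?_⟩
    rw [(hP.invariant hS (Nat.find h) (fun r hr => Nat.find_min h hr) fun r hr => ?_).2.2]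
    · exact Nat.find_spec h
    · refine down (Nat.find h - r) r ?_
      rw [Nat.add_sub_cancel' hr.le]
      exact ⟨w, Nat.find_spec h⟩

end

section

variable {T : Type} {π : Equiv.Perm T} {δ : T → Fin 2} {C D : Set T} {x w : T}
  {lt : ℕ → T → T → Prop} {E : ℕ → Set T}

theorem MoveProcess.eq_survivors (hS : MoveSetup π δ C D x w (lt 0))
    (hP : MoveProcess π δ C x lt E) (hw : ∀ n, w ∉ E n) {n : ℕ} (hne : ∀ r < n, (E r).Nonempty) :
    (∀ r, w ∉ survivors π δ (E 0) x r) ∧ ∀ r ≤ n, E r = survivors π δ (E 0) x r := by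
  have h : ∀ r, w ∉ survivors π δ (E 0) x r := fun r hr =>
    let ⟨k, hk⟩ := (hP.exists_mem_iff hS).2 ⟨r, hr⟩
    hw k hk
  refine ⟨h, fun r => ?_⟩
  induction r using Nat.strong_induction_on with
  | _ r ih =>
    intro hr
    refine (hP.invariant hS r (fun q _ => h q) fun q hq => ?_).2.2
    rw [← ih q hq (by omega)]
    exact hne q (by omega)

/-- If `w` never occurs, the process stops. -/
theorem MoveProcess.exists_eq_empty [Finite T] (hS : MoveSetup π δ C D x w (lt 0))
    (hP : MoveProcess π δ C x lt E) (hw : ∀ n, w ∉ E n) : ∃ n, E n = ∅ := by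
  by_contra! h
  -- After as many steps as the order of π, x is back at x, which a survivor of that level excludes.
  obtain ⟨n, hn, hp⟩ := (isOfFinOrder_of_finite π).exists_pow_eq_one
  obtain ⟨h1, h2⟩ := hP.eq_survivors hS hw (n := n) fun r _ => h r
  obtain ⟨t, ht⟩ := h n
  rw [h2 n le_rfl] at ht
  exact (hS.survivor hP (fun r _ => h1 r) ht).2.2.2.1 n le_rfl hn (by rw [hp]; rfl)

/-- Pairs which do not lie in `D` are not moved. -/
theorem MoveProcess.lt_iff_of_notMem (hS : MoveSetup π δ C D x w (lt 0))
    (hP : MoveProcess π δ C x lt E) (hw : ∀ n, w ∉ E n) {n : ℕ} (hne : ∀ r < n, (E r).Nonempty)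
    {a b : T} (hab : a ∉ D ∨ b ∉ D) : lt n a b ↔ lt 0 a b := by
  obtain ⟨h1, h2⟩ := hP.eq_survivors hS hw hne
  obtain ⟨u1, -, -⟩ := hP.invariant hS n (fun r _ => h1 r) fun r hr => by
    rw [← h2 r hr.le]; exact hne r hr
  have hM : ∀ c d, c ∉ D ∨ d ∉ D → ¬ movedPast π δ (E 0) x n c d := by
    rintro c d hcd ⟨r, hr, rfl, t, ht, rfl⟩
    have := hS.survivor_map hP (fun r _ => h1 r) ht
    rcases hcd with h | h
    · exact h (this.2.2.1 _ le_rfl)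
    · exact h this.1
  refine ⟨fun h => ?_, fun h => u1 _ _ h (hM _ _ hab)⟩
  by_contra h0
  have hne := (hP.order n).ne h
  exact (hP.order n).asymm h (u1 _ _ ((hP.order 0).of_not hne h0) (hM _ _ hab.symm))

/-- When the process has stopped, `π` preserves the order of elements with equal symbols, apart
from the pairs for which it failed to do so independently of `x`. -/
theorem MoveProcess.lt_map_of_eq_empty (hS : MoveSetup π δ C D x w (lt 0))
    (hP : MoveProcess π δ C x lt E) (hw : ∀ n, w ∉ E n) {n : ℕ} (hne : ∀ r < n, (E r).Nonempty)
    (hn : E n = ∅) {s t : T} (hδ : δ s = δ t)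
    (h0 : s ≠ x → t ≠ x → (lt 0 s t ↔ lt 0 (π s) (π t))) (h : lt n s t) : lt n (π s) (π t) := by
  obtain ⟨h1, h2⟩ := hP.eq_survivors hS hw hne
  have h2' : ∀ r < n, (survivors π δ (E 0) x r).Nonempty := fun r hr => by
    rw [← h2 r hr.le]; exact hne r hr
  obtain ⟨u1, u2, -⟩ := hP.invariant hS n (fun r _ => h1 r) h2'
  have hO := hP.order n
  have hO0 := hP.order 0
  have facts := fun r (t) (ht : t ∈ survivors π δ (E 0) x r) =>
    hS.survivor_map hP (n := r) (fun r _ => h1 r) ht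
  have facts' := fun r (t) (ht : t ∈ survivors π δ (E 0) x r) =>
    hS.survivor hP (n := r) (fun r _ => h1 r) ht
  have not_lt0 : ∀ {a b}, lt n a b → lt 0 b a → movedPast π δ (E 0) x n b a := by
    intro a b h h0
    by_contra hM'
    exact hO.asymm h (u1 b a h0 hM')
  have not_M : ∀ {a b}, lt n a b → ¬ movedPast π δ (E 0) x n a b :=
    fun h hM' => hO.asymm h (u2 _ _ hM')
  have Mx1 : ∀ b, ¬ movedPast π δ (E 0) x n x b := by
    rintro b ⟨r, hr, h, t, ht, -⟩
    exact (facts r t ht).2.2.2.1 (r + 1) le_rfl (by omega) h.symm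
  have Mx2 : ∀ a, ¬ movedPast π δ (E 0) x n a x := by
    rintro a ⟨r, hr, -, t, ht, h⟩
    exact hS.arc.ne_start t (facts' r t ht).1 h.symm
  by_cases hs : s = x
  · subst hs
    have h3 : lt 0 s t := by
      by_contra h3
      exact Mx2 _ (not_lt0 h (hO0.of_not (hO.ne h) h3))
    refine u1 _ _ (hS.lt_of_start t h3 hδ.symm) ?_
    rintro ⟨r, hr, h4, t', ht', h5⟩
    rw [perm_pow_succ_apply] at h4
    rcases Nat.eq_zero_or_pos r with h6 | h6
    · subst h6
      rw [← π.injective h5] at ht'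
      exact hO0.asymm h3 ((hP.mem_zero t).1 (mem_survivors_zero.1 ht').1).2.1
    · exact (facts r t' ht').2.2.2.1 r (by omega) h6 (π.injective h4).symm
  by_cases ht : t = x
  · subst ht
    have h3 : lt 0 s t := by
      by_contra h3
      exact Mx1 _ (not_lt0 h (hO0.of_not (hO.ne h) h3))
    have hπ : π s ≠ π t := fun h' => hs (π.injective h')
    rcases hO0.total hπ with h4 | h4
    · refine u1 _ _ h4 ?_
      rintro ⟨r, hr, -, t', ht', h5⟩
      rw [← π.injective h5] at ht'
      exact (facts' r t ht').2.1 0 (by omega) (by simp)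
    · have hs0 : s ∈ E 0 :=
        (hP.mem_zero s).2 ⟨hS.subset (hS.mem s h3 h4 hδ), h3, h4, hδ⟩
      have hpos : 0 < n := by
        rcases Nat.eq_zero_or_pos n with h5 | h5
        · subst h5
          rw [hn] at hs0
          exact absurd hs0 (Set.notMem_empty s)
        · exact h5
      exact u2 _ _ ⟨0, hpos, by simp, s, mem_survivors_zero.2 ⟨hs0, hδ⟩, rfl⟩
  by_cases h3 : lt 0 s t
  · refine u1 _ _ ((h0 hs ht).1 h3) ?_
    rintro ⟨r, hr, h4, t', ht', h5⟩
    rw [perm_pow_succ_apply] at h4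
    have h4' := π.injective h4
    rw [← π.injective h5] at ht'
    rcases r with _ | q
    · exact hs (by simpa using h4')
    · obtain ⟨t'', ht'', h6, -⟩ := mem_survivors_succ.1 ht'
      exact not_M h ⟨q, by omega, h4', t'', ht'', h6⟩
  -- Here t is α_{r+1} and has been moved past s, a survivor of level r + 1. Since `E n` is empty, r
  -- + 1 < n, so the next move passes the image of s too.
  · obtain ⟨r, hr, h4, t', ht', h5⟩ := not_lt0 h (hO0.of_not (hO.ne h) h3)
    have h6 : s ∈ survivors π δ (E 0) x (r + 1) :=
      mem_survivors_succ.2 ⟨t', ht', h5, by rw [hδ, h4]⟩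
    have h7 : r + 1 < n := by
      by_contra h7
      obtain rfl : n = r + 1 := by omega
      rw [← h2 _ le_rfl, hn] at h6
      exact h6
    exact u2 _ _ ⟨r + 1, h7, by rw [perm_pow_succ_apply π (r + 1), ← h4], s, h6, rfl⟩

end

/-! ### The sets 𝒜 and ℬ as instances of the abstract moves. -/

theorem mem_setA {T : Type} [Fintype T] (A : Set T) {R : ABS T} {α t : T} :
    t ∈ R.setA A α ↔ t ∈ A ∧ R.ord.lt t α ∧ R.ord.lt (R.π α) (R.π t) ∧ R.δ t = R.δ α := by
  simp [setA]

theorem mem_setB {T : Type} [Fintype T] {R : ABS T} {β t : T} :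
    t ∈ R.setB β ↔ R.ord.lt β t ∧ R.ord.lt (R.π t) (R.π β) ∧ R.δ t = R.δ β := by
  simp [setB]

section

variable {T : Type} [DecidableEq T]

theorem initial_lt_iff (S : ABS T) (x y s t : T) :
    (S.initial x y).ord.lt s t ↔ S.ord.lt (Equiv.swap x y s) (Equiv.swap x y t) := Iff.rfl

theorem moveRight_lt_iff_of_ne (S : ABS T) {u v s t : T} (hs : s ≠ u) (ht : t ≠ u) :
    (S.moveRight u v).ord.lt s t ↔ S.ord.lt s t := by
  let := S.ord
  refine (Prod.Lex.lt_iff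
    (x := (toLex (if s = u then (v, 1) else (s, 0)) : T ×ₗ Fin 2))
    (y := (toLex (if t = u then (v, 1) else (t, 0)) : T ×ₗ Fin 2))).trans ?_
  simp [hs, ht]

theorem moveRight_lt_self_iff (S : ABS T) {u v t : T} (ht : t ≠ u) :
    (S.moveRight u v).ord.lt t u ↔ t = v ∨ S.ord.lt t v := by
  let := S.ord
  refine (Prod.Lex.lt_iff
    (x := (toLex (if t = u then (v, 1) else (t, 0)) : T ×ₗ Fin 2))
    (y := (toLex (if u = u then (v, 1) else (u, 0)) : T ×ₗ Fin 2))).trans ?_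
  simp [ht, or_comm]

theorem moveLeft_lt_iff_of_ne (S : ABS T) {u v s t : T} (hs : s ≠ u) (ht : t ≠ u) :
    (S.moveLeft u v).ord.lt s t ↔ S.ord.lt s t := by
  let := S.ord
  refine (Prod.Lex.lt_iff
    (x := (toLex (if s = u then (v, 0) else (s, 1)) : T ×ₗ Fin 2))
    (y := (toLex (if t = u then (v, 0) else (t, 1)) : T ×ₗ Fin 2))).trans ?_
  simp [hs, ht]

theorem moveLeft_self_lt_iff (S : ABS T) {u v t : T} (ht : t ≠ u) :
    (S.moveLeft u v).ord.lt u t ↔ t = v ∨ S.ord.lt v t := by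
  let := S.ord
  refine (Prod.Lex.lt_iff
    (x := (toLex (if u = u then (v, 0) else (u, 1)) : T ×ₗ Fin 2))
    (y := (toLex (if t = u then (v, 0) else (t, 1)) : T ×ₗ Fin 2))).trans ?_
  simp [ht, or_comm, eq_comm]

variable [Fintype T] (S : ABS T) (A : Set T) (x y : T)

theorem stageA_π_δ (n : ℕ) : (stageA S A x y n).1.π = smallMod S.π x y ∧
    (stageA S A x y n).1.δ = S.δ := by
  induction n with
  | zero => exact ⟨rfl, rfl⟩
  | succ n ih =>
    rw [stageA]
    dsimp only
    split_ifs
    · exact ih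
    · exact ih

theorem stageB_π_δ (n : ℕ) : (stageB S A x y n).1.π = smallMod S.π x y ∧
    (stageB S A x y n).1.δ = S.δ := by
  induction n with
  | zero => exact stageA_π_δ S A x y _
  | succ n ih =>
    rw [stageB]
    dsimp only
    split_ifs
    · exact ih
    · exact ih

theorem moveProcess_stageA : MoveProcess (smallMod S.π x y) S.δ A x
    (fun n => (stageA S A x y n).1.ord.lt) (fun n => ↑(stageA S A x y n).2) where
  order n := .of_linearOrder _
  mem_zero t := by
    rw [Finset.mem_coe, stageA]
    exact mem_setA A
  mem_succ n hn t := by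
    have h := stageA_π_δ S A x y n
    rw [Finset.mem_coe, stageA]
    dsimp only
    rw [dif_pos (Finset.coe_nonempty.1 hn), mem_setA]
    change _ ∧ _ ∧ (_ : ABS T).ord.lt ((stageA S A x y n).1.π _) ((stageA S A x y n).1.π _) ∧
      (stageA S A x y n).1.δ _ = (stageA S A x y n).1.δ _ ↔ _
    rw [h.1, h.2]
  empty_succ n hn := by
    rw [stageA]
    dsimp only
    rw [dif_neg (fun h => hn (Finset.coe_nonempty.2 h))]
    simp
  move n hn := by
    have h := stageA_π_δ S A x y n
    have hn' := Finset.coe_nonempty.1 hn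
    refine ⟨@Finset.max' T (stageA S A x y n).1.ord _ hn',
      @Finset.max'_mem T (stageA S A x y n).1.ord _ hn', fun t ht hne => ?_, ?_⟩
    · exact @lt_of_le_of_ne T (stageA S A x y n).1.ord.toPartialOrder _ _
        (@Finset.le_max' T (stageA S A x y n).1.ord _ t ht) hne
    · rw [← h.1]
      constructor
      · intro s t hs ht
        rw [stageA, dif_pos hn']
        exact moveRight_lt_iff_of_ne _ hs ht
      · intro t ht
        rw [stageA, dif_pos hn']
        exact moveRight_lt_self_iff _ ht

/-- Moving left past the image of a minimum is moving right past the image of a maximum in the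
reversed order. The restricting set is everything, since ℬ is not confined to one summand. -/
theorem moveProcess_stageB : MoveProcess (smallMod S.π x y) S.δ Set.univ y
    (fun n s t => (stageB S A x y n).1.ord.lt t s) (fun n => ↑(stageB S A x y n).2) where
  order n := (StrictTotal.of_linearOrder _).flip
  mem_zero t := by
    have h := stageA_π_δ S A x y (stopA S A x y)
    rw [Finset.mem_coe, stageB]
    dsimp only
    rw [mem_setB, h.1, h.2]
    simp
  mem_succ n hn t := by
    have h := stageB_π_δ S A x y n
    rw [Finset.mem_coe, stageB]
    dsimp only
    rw [dif_pos (Finset.coe_nonempty.1 hn), mem_setB]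
    change _ ∧ (_ : ABS T).ord.lt ((stageB S A x y n).1.π _) ((stageB S A x y n).1.π _) ∧
      (stageB S A x y n).1.δ _ = (stageB S A x y n).1.δ _ ↔ _
    rw [h.1, h.2]
    simp
  empty_succ n hn := by
    rw [stageB]
    dsimp only
    rw [dif_neg (fun h => hn (Finset.coe_nonempty.2 h))]
    simp
  move n hn := by
    have h := stageB_π_δ S A x y n
    have hn' := Finset.coe_nonempty.1 hn
    refine ⟨@Finset.min' T (stageB S A x y n).1.ord _ hn',
      @Finset.min'_mem T (stageB S A x y n).1.ord _ hn', fun t ht hne => ?_, ?_⟩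
    · exact @lt_of_le_of_ne T (stageB S A x y n).1.ord.toPartialOrder _ _
        (@Finset.min'_le T (stageB S A x y n).1.ord _ t ht) hne.symm
    · rw [← h.1]
      constructor
      · intro s t hs ht
        rw [stageB, dif_pos hn']
        exact moveLeft_lt_iff_of_ne _ ht hs
      · intro t ht
        rw [stageB, dif_pos hn']
        exact moveLeft_self_lt_iff _ ht

end

section

variable {m₁ n₁ m₂ n₂ : ℕ} {i : Fin (m₁ + n₁)} {j : Fin (m₂ + n₂)}

local notation "κ" => pos m₁ n₁ m₂ n₂
local notation "κ₀" => swapPos (pos m₁ n₁ m₂ n₂) (Sum.inl i) (Sum.inr j)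
local notation "ψ" => smallMod (ABS.π (twoSegment m₁ n₁ m₂ n₂)) (Sum.inl i) (Sum.inr j)
local notation "δ₀" => ABS.δ (twoSegment m₁ n₁ m₂ n₂)
local notation "𝔾" => IsGood (pos m₁ n₁ m₂ n₂) (ABS.δ (twoSegment m₁ n₁ m₂ n₂))
  (ABS.π (twoSegment m₁ n₁ m₂ n₂)) (Sum.inl i) (Sum.inr j)
local notation "𝔸" => stageA (twoSegment m₁ n₁ m₂ n₂) (Set.range Sum.inl) (Sum.inl i) (Sum.inr j)
local notation "𝔹" => stageB (twoSegment m₁ n₁ m₂ n₂) (Set.range Sum.inl) (Sum.inl i) (Sum.inr j)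

theorem stageA_zero_lt_iff (h₁ : m₁ < n₁) (h₂ : n₂ < m₂)
    (s t : Fin (m₁ + n₁) ⊕ Fin (m₂ + n₂)) : (𝔸 0).1.ord.lt s t ↔ κ₀ s < κ₀ t :=
  (initial_lt_iff _ _ _ _ _).trans (twoSegment_lt_iff h₁ h₂ _ _)

/-- In `S^{(0)}`, `π` preserves the order of elements of `A` with equal symbols other than `x`. -/
theorem moveSetup_stageA (hc : Nat.Coprime m₁ n₁) (h₁ : m₁ < n₁) (h₂ : n₂ < m₂)
    (hi : m₁ ≤ (i : ℕ) ∧ (i : ℕ) < n₁) (hj : (j : ℕ) < n₂) {w : Fin (m₁ + n₁)}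
    (hw : (w : ℕ) = i + m₁) :
    MoveSetup ψ δ₀ (Set.range Sum.inl) (Set.range Sum.inl) (.inl i) (.inl w) (𝔸 0).1.ord.lt := by
  have hS := isStable_pos h₁ h₂
  have hκi : κ (.inl i) = i := pos_inl_of_lt hi.2
  have hκj : κ (.inr j) = n₁ + j := pos_inr_of_lt hj
  have hδi : δ₀ (.inl i) = 0 := δ_inl_of_le hi.1
  have hδj : δ₀ (.inr j) = 1 := δ_inr_of_lt (by omega)
  have hσw : (simple m₁ n₁).π w = i := Fin.ext (by rw [val_of_le (by omega)]; omega)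
  have yA : ∀ a : Fin (m₁ + n₁), δ₀ (.inr j) = δ₀ (.inl a) → (a : ℕ) < m₁ := by
    intro a h
    by_contra h'
    rw [hδj, δ_inl_of_le (by omega)] at h
    exact absurd h (by decide)
  refine ⟨isArc_inl hc hσw, subset_rfl, ?_, ?_, ?_, ?_⟩
  · intro s t hs ht hδ hst
    rw [stageA_zero_lt_iff h₁ h₂, stageA_zero_lt_iff h₁ h₂, swapPos_smallMod, swapPos_smallMod,
      hS.same _ _ hδ]
    by_cases hsy : s = .inr j
    · subst hsy
      obtain ⟨a, rfl⟩ : t ∈ Set.range Sum.inl := by simpa using hst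
      have := yA a hδ
      rw [swapPos_right, swapPos_of_ne _ ht (by simp), pos_inl_of_lt (a := a) (by omega)]
      omega
    by_cases hty : t = .inr j
    · subst hty
      obtain ⟨a, rfl⟩ : s ∈ Set.range Sum.inl := by simpa using hst
      have := yA a hδ.symm
      rw [swapPos_right, swapPos_of_ne _ hs (by simp), pos_inl_of_lt (a := a) (by omega)]
      omega
    · rw [swapPos_of_ne _ hs hsy, swapPos_of_ne _ ht hty]
  · intro t h hδ
    rw [stageA_zero_lt_iff h₁ h₂, swapPos_left] at h
    rw [stageA_zero_lt_iff h₁ h₂, swapPos_smallMod, swapPos_smallMod, hS.same _ _ hδ.symm]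
    have htx : t ≠ .inl i := fun h' => by rw [h', swapPos_left] at h; exact lt_irrefl _ h
    have hty : t ≠ .inr j := fun h' => by
      rw [h', hδi, hδj] at hδ
      exact absurd hδ (by decide)
    rw [swapPos_of_ne _ htx hty] at h
    omega
  · rintro _ _ u ⟨a, rfl⟩ ⟨c, rfl⟩ - - hδ h3 h4
    rw [stageA_zero_lt_iff h₁ h₂, swapPos_smallMod, swapPos_smallMod] at h3 h4
    have hδu : δ₀ u = δ₀ (.inl a) := by
      rcases fin_two_cases (δ₀ u) with e1 | e1 <;> rcases fin_two_cases (δ₀ (.inl a)) with e2 | e2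
      · rw [e1, e2]
      · have := hS.zero_one _ _ e1 e2
        omega
      · have := hS.zero_one _ _ (hδ ▸ e2) e1
        omega
      · rw [e1, e2]
    refine ⟨hδu, ?_⟩
    rw [hS.same _ _ hδu.symm] at h3
    rw [hS.same _ _ (hδu.trans hδ)] at h4
    rcases u with u | u
    · exact ⟨u, rfl⟩
    · exfalso
      have ha2 := a.2
      have hc2 := c.2
      rw [twoSegment_δ_inr, twoSegment_δ_inl] at hδu
      rw [twoSegment_δ_inl, twoSegment_δ_inl] at hδ
      rw [pos_inl, pos_inr] at h3
      rw [pos_inr, pos_inl] at h4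
      split_ifs at hδ hδu h3 h4 <;> omega
  · intro t h3 h4 hδ
    rw [stageA_zero_lt_iff h₁ h₂] at h3
    rw [stageA_zero_lt_iff h₁ h₂, swapPos_smallMod, swapPos_smallMod, hS.same _ _ hδ.symm] at h4
    rcases reversed_cases_twoSegment h₁ h₂ hi hj h4 h3 hδ.symm with ⟨-, z, rfl, -⟩ | ⟨rfl, -⟩
    · exact ⟨z, rfl⟩
    · rw [hδi, hδj] at hδ
      exact absurd hδ (by decide)

theorem coe_stageA_zero (h₁ : m₁ < n₁) (h₂ : n₂ < m₂)
    (hi : m₁ ≤ (i : ℕ) ∧ (i : ℕ) < n₁) (hj : (j : ℕ) < n₂) :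
    ((𝔸 0).2 : Set (Fin (m₁ + n₁) ⊕ Fin (m₂ + n₂)))
      = {t | ∃ z : Fin (m₁ + n₁), t = .inl z ∧ i < z ∧ (z : ℕ) < n₁} := by
  have hS := isStable_pos h₁ h₂
  have hκi : κ (.inl i) = i := pos_inl_of_lt hi.2
  have hκj : κ (.inr j) = n₁ + j := pos_inr_of_lt hj
  have hδi : δ₀ (.inl i) = 0 := δ_inl_of_le hi.1
  have hδj : δ₀ (.inr j) = 1 := δ_inr_of_lt (by omega)
  ext t
  rw [(moveProcess_stageA _ _ _ _).mem_zero t, Set.mem_ofPred_eq]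
  simp only [stageA_zero_lt_iff h₁ h₂, swapPos_smallMod]
  constructor
  · rintro ⟨-, h3, h4, hδ⟩
    rw [hS.same _ _ hδ.symm] at h4
    rcases reversed_cases_twoSegment h₁ h₂ hi hj h4 h3 hδ.symm with ⟨-, h⟩ | ⟨rfl, -⟩
    · exact h
    · rw [hδi, hδj] at hδ
      exact absurd hδ (by decide)
  · rintro ⟨z, rfl, hiz, hzn⟩
    rw [Fin.lt_def] at hiz
    have hδ : δ₀ (.inl z) = δ₀ (.inl i) := by rw [hδi, δ_inl_of_le (by omega)]
    have hκz : κ (.inl z) = z := pos_inl_of_lt hzn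
    rw [hS.same _ _ hδ.symm, swapPos_left, swapPos_inl i j (by rw [Ne, Fin.ext_iff]; omega)]
    exact ⟨⟨z, rfl⟩, by omega, by omega, hδ⟩

/-- `𝒜^{(n)}` contains the predecessor of `x` for some `n` iff it survives. -/
theorem exists_mem_stageA_iff (hc : Nat.Coprime m₁ n₁) (h₁ : m₁ < n₁) (h₂ : n₂ < m₂)
    (hi : m₁ ≤ (i : ℕ) ∧ (i : ℕ) < n₁) (hj : (j : ℕ) < n₂) {w : Fin (m₁ + n₁)}
    (hw : (w : ℕ) = i + m₁) :
    (∃ n, .inl w ∈ (𝔸 n).2) ↔ ∃ n, .inl w ∈ survivors ψ δ₀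
      {t | ∃ z : Fin (m₁ + n₁), t = .inl z ∧ i < z ∧ (z : ℕ) < n₁} (.inl i) n := by
  rw [← coe_stageA_zero h₁ h₂ hi hj]
  exact (moveProcess_stageA _ _ _ _).exists_mem_iff (moveSetup_stageA hc h₁ h₂ hi hj hw)

/-- `sInf` of the empty set is 0, so `stopA` has its meaning only once termination is known; that
the predecessor of x never occurs provides this. -/
theorem stopA_spec (hc : Nat.Coprime m₁ n₁) (h₁ : m₁ < n₁) (h₂ : n₂ < m₂)
    (hi : m₁ ≤ (i : ℕ) ∧ (i : ℕ) < n₁) (hj : (j : ℕ) < n₂) {w : Fin (m₁ + n₁)}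
    (hw : (w : ℕ) = i + m₁) (hA : ∀ n, .inl w ∉ (𝔸 n).2) :
    (𝔸 (stopA (twoSegment m₁ n₁ m₂ n₂) (Set.range Sum.inl) (.inl i) (.inr j))).2 = ∅ ∧
    ∀ r < stopA (twoSegment m₁ n₁ m₂ n₂) (Set.range Sum.inl) (.inl i) (.inr j),
      (𝔸 r).2.Nonempty := by
  obtain ⟨n, hn⟩ := (moveProcess_stageA _ _ _ _).exists_eq_empty
    (moveSetup_stageA (j := j) hc h₁ h₂ hi hj hw) hA
  have hne : {n | (𝔸 n).2 = ∅}.Nonempty := ⟨n, Finset.coe_eq_empty.1 hn⟩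
  refine ⟨Nat.sInf_mem hne, fun r hr => Finset.nonempty_iff_ne_empty.2 fun h => ?_⟩
  exact absurd (Nat.sInf_le (show r ∈ {n | (𝔸 n).2 = ∅} from h)) (not_le.2 hr)

/-- If the predecessor of `x` does not occur, the pairs meeting `B` keep their order until the
construction of the `𝒜^{(n)}` stops. -/
theorem stageB_zero_lt_iff (hc : Nat.Coprime m₁ n₁) (h₁ : m₁ < n₁) (h₂ : n₂ < m₂)
    (hi : m₁ ≤ (i : ℕ) ∧ (i : ℕ) < n₁) (hj : (j : ℕ) < n₂) {w : Fin (m₁ + n₁)}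
    (hw : (w : ℕ) = i + m₁) (hA : ∀ n, .inl w ∉ (𝔸 n).2) {s t : Fin (m₁ + n₁) ⊕ Fin (m₂ + n₂)}
    (hst : s ∈ Set.range Sum.inr ∨ t ∈ Set.range Sum.inr) :
    (𝔹 0).1.ord.lt s t ↔ κ₀ s < κ₀ t := by
  rw [← stageA_zero_lt_iff h₁ h₂]
  obtain ⟨-, hne⟩ := stopA_spec hc h₁ h₂ hi hj hw hA
  refine (moveProcess_stageA (twoSegment m₁ n₁ m₂ n₂) _ _ _).lt_iff_of_notMem
    (moveSetup_stageA hc h₁ h₂ hi hj hw) hA (fun r hr => Finset.coe_nonempty.2 (hne r hr)) ?_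
  refine hst.imp ?_ ?_ <;> rintro ⟨b, rfl⟩ ⟨a, ha⟩ <;> simp at ha

/-- The starting order is the one left by the first process. Pairs meeting B are untouched by it,
and `lt_map_of_eq_empty` shows that it has repaired the failures of π to preserve order at x, so
that only those at y remain. -/
theorem moveSetup_stageB (hc₁ : Nat.Coprime m₁ n₁) (hc₂ : Nat.Coprime m₂ n₂) (h₁ : m₁ < n₁)
    (h₂ : n₂ < m₂) (hi : m₁ ≤ (i : ℕ) ∧ (i : ℕ) < n₁) (hj : (j : ℕ) < n₂) {w : Fin (m₁ + n₁)}
    (hw : (w : ℕ) = i + m₁) (hA : ∀ n, .inl w ∉ (𝔸 n).2) {v : Fin (m₂ + n₂)}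
    (hv : (v : ℕ) = j + m₂) :
    MoveSetup ψ δ₀ Set.univ (Set.range Sum.inr) (.inr j) (.inr v)
      (fun s t => (𝔹 0).1.ord.lt t s) := by
  have hS := isStable_pos h₁ h₂
  have hκi : κ (.inl i) = i := pos_inl_of_lt hi.2
  have hκj : κ (.inr j) = n₁ + j := pos_inr_of_lt hj
  have hδi : δ₀ (.inl i) = 0 := δ_inl_of_le hi.1
  have hδj : δ₀ (.inr j) = 1 := δ_inr_of_lt (by omega)
  have hτv : (simple m₂ n₂).π v = j := Fin.ext (by rw [val_of_le (by omega)]; omega)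
  have arc := isArc_inr (n₁ := n₁) (i := i) hc₂ hτv
  have hvj : j ≠ v := fun h => by rw [Fin.ext_iff] at h; omega
  have hπj : ψ (.inr j) ∈ Set.range Sum.inr := arc.step _ arc.start_mem (by simpa using hvj)
  have hlt := fun {s t : Fin (m₁ + n₁) ⊕ Fin (m₂ + n₂)} =>
    stageB_zero_lt_iff hc₁ h₁ h₂ hi hj hw hA (s := s) (t := t)
  obtain ⟨hlast, hne⟩ := stopA_spec hc₁ h₁ h₂ hi hj hw hA
  have fwd : ∀ s t, s ≠ .inr j → t ≠ .inr j → δ₀ s = δ₀ t → (𝔹 0).1.ord.lt s t →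
      (𝔹 0).1.ord.lt (ψ s) (ψ t) := by
    intro s t hs ht hδ
    refine (moveProcess_stageA (twoSegment m₁ n₁ m₂ n₂) _ _ _).lt_map_of_eq_empty
      (moveSetup_stageA hc₁ h₁ h₂ hi hj hw) hA (fun r hr => Finset.coe_nonempty.2 (hne r hr))
      (Finset.coe_eq_empty.2 hlast) hδ fun hs' ht' => ?_
    rw [stageA_zero_lt_iff h₁ h₂, stageA_zero_lt_iff h₁ h₂, swapPos_smallMod, swapPos_smallMod,
      hS.same _ _ hδ, swapPos_of_ne _ hs' hs, swapPos_of_ne _ ht' ht]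
  have hO := StrictTotal.of_linearOrder (𝔹 0).1.ord
  refine ⟨arc, Set.subset_univ _, ?_, ?_, ?_, ?_⟩
  · intro s t hs ht hδ _
    refine ⟨fwd t s ht hs hδ.symm, fun h => ?_⟩
    have hne' : t ≠ s := fun h' => hO.ne h (by rw [h'])
    refine hO.of_not hne'.symm fun h' => ?_
    exact hO.asymm h (fwd s t hs ht hδ h')
  · intro t h hδ
    rw [hlt (Or.inr ⟨j, rfl⟩), swapPos_right] at h
    rw [hlt (Or.inr hπj), swapPos_smallMod, swapPos_smallMod, hS.same _ _ hδ]
    have htx : t ≠ .inl i := fun h' => by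
      rw [h', hδi, hδj] at hδ
      exact absurd hδ (by decide)
    have hty : t ≠ .inr j := fun h' => by rw [h', swapPos_right] at h; exact lt_irrefl _ h
    rw [swapPos_of_ne _ htx hty] at h
    omega
  · intro s t u hs ht hsv htv hδ h3 h4
    have hπs := arc.step s hs hsv
    have hπt := arc.step t ht htv
    rw [hlt (Or.inr hπs), swapPos_smallMod, swapPos_smallMod] at h3
    rw [hlt (Or.inl hπt), swapPos_smallMod, swapPos_smallMod] at h4
    refine ⟨?_, Set.mem_univ _⟩
    rcases fin_two_cases (δ₀ u) with e1 | e1 <;> rcases fin_two_cases (δ₀ s) with e2 | e2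
    · rw [e1, e2]
    · have := hS.zero_one _ _ e1 (hδ ▸ e2)
      omega
    · have := hS.zero_one _ _ e2 e1
      omega
    · rw [e1, e2]
  · intro t h3 h4 hδ
    rw [hlt (Or.inl ⟨j, rfl⟩)] at h3
    rw [hlt (Or.inr hπj), swapPos_smallMod, swapPos_smallMod, hS.same _ _ hδ] at h4
    rcases reversed_cases_twoSegment h₁ h₂ hi hj h4 h3 hδ with ⟨rfl, -⟩ | ⟨-, z, rfl, -⟩
    · rw [hδi, hδj] at hδ
      exact absurd hδ (by decide)
    · exact ⟨z, rfl⟩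

theorem coe_stageB_zero (hc₁ : Nat.Coprime m₁ n₁) (hc₂ : Nat.Coprime m₂ n₂) (h₁ : m₁ < n₁)
    (h₂ : n₂ < m₂) (hi : m₁ ≤ (i : ℕ) ∧ (i : ℕ) < n₁) (hj : (j : ℕ) < n₂) {w : Fin (m₁ + n₁)}
    (hw : (w : ℕ) = i + m₁) (hA : ∀ n, .inl w ∉ (𝔸 n).2) {v : Fin (m₂ + n₂)}
    (hv : (v : ℕ) = j + m₂) :
    ((𝔹 0).2 : Set (Fin (m₁ + n₁) ⊕ Fin (m₂ + n₂)))
      = {t | ∃ z : Fin (m₂ + n₂), t = .inr z ∧ z < j} := by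
  have hS := isStable_pos h₁ h₂
  have hκi : κ (.inl i) = i := pos_inl_of_lt hi.2
  have hκj : κ (.inr j) = n₁ + j := pos_inr_of_lt hj
  have hδi : δ₀ (.inl i) = 0 := δ_inl_of_le hi.1
  have hδj : δ₀ (.inr j) = 1 := δ_inr_of_lt (by omega)
  have hτv : (simple m₂ n₂).π v = j := Fin.ext (by rw [val_of_le (by omega)]; omega)
  have arc := isArc_inr (n₁ := n₁) (i := i) hc₂ hτv
  have hvj : j ≠ v := fun h => by rw [Fin.ext_iff] at h; omega
  have hπj : ψ (.inr j) ∈ Set.range Sum.inr := arc.step _ arc.start_mem (by simpa using hvj)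
  have hlt := fun {s t : Fin (m₁ + n₁) ⊕ Fin (m₂ + n₂)} =>
    stageB_zero_lt_iff hc₁ h₁ h₂ hi hj hw hA (s := s) (t := t)
  ext t
  rw [(moveProcess_stageB _ _ _ _).mem_zero t, Set.mem_ofPred_eq, hlt (Or.inl ⟨j, rfl⟩),
    hlt (Or.inr hπj), swapPos_smallMod, swapPos_smallMod]
  constructor
  · rintro ⟨-, h3, h4, hδ⟩
    rw [hS.same _ _ hδ] at h4
    rcases reversed_cases_twoSegment h₁ h₂ hi hj h4 h3 hδ with ⟨rfl, -⟩ | ⟨-, h⟩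
    · rw [hδi, hδj] at hδ
      exact absurd hδ (by decide)
    · exact h
  · rintro ⟨z, rfl, hzj⟩
    rw [Fin.lt_def] at hzj
    have hδ : δ₀ (.inr z) = δ₀ (.inr j) := by rw [hδj, δ_inr_of_lt (by omega)]
    have hκz : κ (.inr z) = n₁ + z := pos_inr_of_lt (by omega)
    rw [hS.same _ _ hδ, swapPos_right, swapPos_inr i j (by rw [Ne, Fin.ext_iff]; omega)]
    exact ⟨Set.mem_univ _, by omega, by omega, hδ⟩

/-- If the predecessor of `x` does not occur, `ℬ^{(n)}` contains the predecessor of `y` for some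
`n` iff it survives. -/
theorem exists_mem_stageB_iff (hc₁ : Nat.Coprime m₁ n₁) (hc₂ : Nat.Coprime m₂ n₂) (h₁ : m₁ < n₁)
    (h₂ : n₂ < m₂) (hi : m₁ ≤ (i : ℕ) ∧ (i : ℕ) < n₁) (hj : (j : ℕ) < n₂) {w : Fin (m₁ + n₁)}
    (hw : (w : ℕ) = i + m₁) (hA : ∀ n, .inl w ∉ (𝔸 n).2) {v : Fin (m₂ + n₂)}
    (hv : (v : ℕ) = j + m₂) :
    (∃ n, .inr v ∈ (𝔹 n).2) ↔ ∃ n, .inr v ∈ survivors ψ δ₀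
      {t | ∃ z : Fin (m₂ + n₂), t = .inr z ∧ z < j} (.inr j) n := by
  rw [← coe_stageB_zero hc₁ hc₂ h₁ h₂ hi hj hw hA hv]
  exact (moveProcess_stageB _ _ _ _).exists_mem_iff
    (moveSetup_stageB hc₁ hc₂ h₁ h₂ hi hj hw hA hv)

/-- If the predecessor of x occurs in some 𝒜, the exchange is not good whatever the ℬ are. Otherwise
the first process stops properly, and the ℬ can be computed by survivors. -/
theorem isGood_iff (hc₁ : Nat.Coprime m₁ n₁) (hc₂ : Nat.Coprime m₂ n₂) (h₁ : m₁ < n₁)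
    (h₂ : n₂ < m₂) (hi : m₁ ≤ (i : ℕ) ∧ (i : ℕ) < n₁) (hj : (j : ℕ) < n₂) {w : Fin (m₁ + n₁)}
    (hw : (w : ℕ) = i + m₁) {v : Fin (m₂ + n₂)} (hv : (v : ℕ) = j + m₂) :
    𝔾 ↔ ¬ ∃ n, .inl w ∈ (𝔸 n).2 ∨ .inr v ∈ (𝔹 n).2 := by
  rw [exists_or, not_or]
  by_cases hA : ∃ n, .inl w ∈ (𝔸 n).2
  · refine iff_of_false ?_ fun h => h.1 hA
    obtain ⟨n, hn⟩ := (exists_mem_stageA_iff hc₁ h₁ h₂ hi hj hw).1 hA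
    exact not_isGood_of_survivors_inl hc₁ h₁ h₂ hi hj hw hn
  · have hA' : ∀ n, .inl w ∉ (𝔸 n).2 := fun n hn => hA ⟨n, hn⟩
    rw [exists_mem_stageB_iff hc₁ hc₂ h₁ h₂ hi hj hw hA' hv]
    constructor
    · rintro hG
      exact ⟨hA, fun ⟨n, hn⟩ => not_isGood_of_survivors_inr hc₂ h₁ h₂ hi hj hv hn hG⟩
    · rintro ⟨-, hB⟩
      rw [exists_mem_stageA_iff hc₁ h₁ h₂ hi hj hw] at hA
      exact isGood_of_survivors hc₁ hc₂ h₁ h₂ hi hj hw hv (fun n hn => hA ⟨n, hn⟩)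
        (fun n hn => hB ⟨n, hn⟩)

end

/-! ### Part (iii): duality. -/

theorem sub_δ_eq_zero (a : Fin 2) : 1 - a = 0 ↔ a = 1 := by revert a; decide
theorem sub_δ_eq_one (a : Fin 2) : 1 - a = 1 ↔ a = 0 := by revert a; decide
theorem sub_δ_lt (a b : Fin 2) : 1 - a < 1 - b ↔ b < a := by revert a b; decide

open Classical in
/-- The number of pairs `(0, 1)` in the order given by the binary expansions. -/
noncomputable def binCount {T : Type} [Fintype T] (δ : T → Fin 2) (π : Equiv.Perm T) : ℕ :=
  (Finset.univ.filter fun p : T × T => δ p.1 = 0 ∧ δ p.2 = 1 ∧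
    binExp δ π p.1 < binExp δ π p.2).card

/-- Frees the length from the breaking of ties, which the dual sum, with its summands in the other
order, may do differently. -/
theorem length_eq_binCount {T : Type} [Fintype T] (S : ABS T)
    (h : ∀ s t, S.ord.lt s t → binExp S.δ S.π s ≤ binExp S.δ S.π t) :
    S.length = binCount S.δ S.π := by
  unfold length binCount
  refine congrArg Finset.card (Finset.ext fun p => ?_)
  simp only [Finset.mem_filter, Finset.mem_univ, true_and]
  refine and_congr_right fun h0 => and_congr_right fun h1 => ?_
  have hne : binExp S.δ S.π p.1 ≠ binExp S.δ S.π p.2 := fun h => by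
    have := δ_eq_of_binExp_eq _ _ _ _ h
    rw [h0, h1] at this
    exact absurd this (by decide)
  have hne' : p.1 ≠ p.2 := fun h => hne (by rw [h])
  refine ⟨fun h2 => lt_of_le_of_ne (h _ _ h2) hne, fun h2 => ?_⟩
  refine (StrictTotal.of_linearOrder S.ord).of_not hne'.symm fun h3 => ?_
  exact absurd (h _ _ h3) (not_le.2 h2)

theorem sortBy_le {T : Type} (o : LinearOrder T) (b : T → Lex (ℕ → Fin 2)) (s t : T)
    (h : (sortBy o b).lt s t) : b s ≤ b t := by
  rcases (sortBy_lt_iff o b s t).1 h with h | ⟨h, -⟩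
  · exact h.le
  · exact h.le

theorem twoSegment_length (m₁ n₁ m₂ n₂ : ℕ) : (twoSegment m₁ n₁ m₂ n₂).length
    = binCount (twoSegment m₁ n₁ m₂ n₂).δ (twoSegment m₁ n₁ m₂ n₂).π :=
  length_eq_binCount _ fun _ _ h => sortBy_le _ _ _ _ h

theorem spec_length {T : Type} [Fintype T] [DecidableEq T] (S : ABS T) (x y : T) :
    (S.spec x y).length = binCount S.δ (smallMod S.π x y) :=
  length_eq_binCount (S.spec x y) fun _ _ h => sortBy_le _ _ _ _ h

theorem dual_length {T : Type} [Fintype T] (S : ABS T) : S.dual.length = S.length := by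
  unfold length
  refine Finset.card_bij' (fun p _ => p.swap) (fun p _ => p.swap) ?_ ?_ ?_ ?_
  · rintro ⟨s, t⟩ h
    simp only [Finset.mem_filter, Finset.mem_univ, true_and, Prod.swap] at h ⊢
    exact ⟨(sub_δ_eq_one _).1 h.2.1, (sub_δ_eq_zero _).1 h.1, h.2.2⟩
  · rintro ⟨s, t⟩ h
    simp only [Finset.mem_filter, Finset.mem_univ, true_and, Prod.swap] at h ⊢
    exact ⟨(sub_δ_eq_zero _).2 h.2.1, (sub_δ_eq_one _).2 h.1, h.2.2⟩
  · simp
  · simp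

/-- An isomorphism exchanging the symbols preserves the number of pairs. -/
theorem binCount_dual {T U : Type} [Fintype T] [Fintype U] {δ : T → Fin 2} {π : Equiv.Perm T}
    {δ' : U → Fin 2} {π' : Equiv.Perm U} (φ : T ≃ U) (hδ : ∀ t, δ' (φ t) = 1 - δ t)
    (hπ : ∀ t, π' (φ t) = φ (π t)) : binCount δ' π' = binCount δ π := by
  have hinv : ∀ (k : ℕ) t, (π'⁻¹ ^ k) (φ t) = φ ((π⁻¹ ^ k) t) := by
    intro k
    induction k with
    | zero => intro t; rfl
    | succ k ih =>
      intro t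
      rw [pow_succ', Equiv.Perm.mul_apply, ih, Equiv.Perm.inv_eq_iff_eq, hπ, pow_succ',
        Equiv.Perm.mul_apply]
      exact congrArg φ (π.apply_symm_apply _).symm
  have hb : ∀ s t, binExp δ' π' (φ s) < binExp δ' π' (φ t) ↔ binExp δ π t < binExp δ π s := by
    intro s t
    have e : ∀ u k, binExp δ' π' (φ u) k = 1 - binExp δ π u k := by
      intro u k
      change δ' ((π'⁻¹ ^ (k + 1)) (φ u)) = 1 - δ ((π⁻¹ ^ (k + 1)) u)
      rw [hinv, hδ]
    have e' : ∀ a b : Fin 2, 1 - a = 1 - b ↔ b = a := by decide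
    change (∃ k, (∀ l < k, binExp δ' π' (φ s) l = binExp δ' π' (φ t) l) ∧
        binExp δ' π' (φ s) k < binExp δ' π' (φ t) k) ↔
      ∃ k, (∀ l < k, binExp δ π t l = binExp δ π s l) ∧ binExp δ π t k < binExp δ π s k
    simp only [e, sub_δ_lt, e']
  unfold binCount
  refine Finset.card_bij' (fun p _ => (φ.symm p.2, φ.symm p.1)) (fun p _ => (φ p.2, φ p.1))
    ?_ ?_ ?_ ?_
  · rintro ⟨s, t⟩ h
    obtain ⟨s, rfl⟩ := φ.surjective s
    obtain ⟨t, rfl⟩ := φ.surjective t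
    simp only [Finset.mem_filter, Finset.mem_univ, true_and, Equiv.symm_apply_apply, hb, hδ] at h ⊢
    exact ⟨(sub_δ_eq_one _).1 h.2.1, (sub_δ_eq_zero _).1 h.1, h.2.2⟩
  · rintro ⟨s, t⟩ h
    simp only [Finset.mem_filter, Finset.mem_univ, true_and, hb, hδ] at h ⊢
    exact ⟨(sub_δ_eq_zero _).2 h.2.1, (sub_δ_eq_one _).2 h.1, h.2.2⟩
  · simp
  · simp

/-- The order-reversing bijection between `N_{m,n}` and `N_{n,m}`. -/
def simpleDual (m n : ℕ) : Fin (m + n) ≃ Fin (n + m) :=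
  Fin.revPerm.trans (finCongr (Nat.add_comm m n))

theorem simpleDual_val (m n : ℕ) (k : Fin (m + n)) :
    (simpleDual m n k : ℕ) = m + n - (k + 1) := by
  simp [simpleDual]

theorem simple_δ_dual (m n : ℕ) (k : Fin (m + n)) :
    (simple n m).δ (simpleDual m n k) = 1 - (simple m n).δ k := by
  have := k.2
  rw [simple_δ, simple_δ, simpleDual_val]
  split_ifs <;> omega

theorem simple_π_dual (m n : ℕ) (k : Fin (m + n)) :
    (simple n m).π (simpleDual m n k) = simpleDual m n ((simple m n).π k) := by
  have := k.2
  refine Fin.ext ?_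
  rw [simple_π_val, simpleDual_val, simpleDual_val, simple_π_val]
  split_ifs <;> omega

/-- The bijection between `A ⊕ B` and the sum of the duals of `B` and `A`. -/
def twoSegmentDual (m₁ n₁ m₂ n₂ : ℕ) :
    Fin (m₁ + n₁) ⊕ Fin (m₂ + n₂) ≃ Fin (n₂ + m₂) ⊕ Fin (n₁ + m₁) :=
  (Equiv.sumComm _ _).trans (Equiv.sumCongr (simpleDual m₂ n₂) (simpleDual m₁ n₁))

theorem twoSegment_δ_dual (m₁ n₁ m₂ n₂ : ℕ) (t : Fin (m₁ + n₁) ⊕ Fin (m₂ + n₂)) :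
    (twoSegment n₂ m₂ n₁ m₁).δ (twoSegmentDual m₁ n₁ m₂ n₂ t)
      = 1 - (twoSegment m₁ n₁ m₂ n₂).δ t := by
  rcases t with k | k
  · exact simple_δ_dual m₁ n₁ k
  · exact simple_δ_dual m₂ n₂ k

theorem twoSegment_π_dual (m₁ n₁ m₂ n₂ : ℕ) (t : Fin (m₁ + n₁) ⊕ Fin (m₂ + n₂)) :
    (twoSegment n₂ m₂ n₁ m₁).π (twoSegmentDual m₁ n₁ m₂ n₂ t)
      = twoSegmentDual m₁ n₁ m₂ n₂ ((twoSegment m₁ n₁ m₂ n₂).π t) := by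
  rcases t with k | k
  · exact congrArg Sum.inr (simple_π_dual m₁ n₁ k)
  · exact congrArg Sum.inl (simple_π_dual m₂ n₂ k)

/-- A transposition is symmetric in its two elements, so x and y may trade roles, as they do when
the symbols are exchanged. -/
theorem smallMod_map {T U : Type} [DecidableEq T] [DecidableEq U] {π : Equiv.Perm T}
    {π' : Equiv.Perm U} (φ : T ≃ U) (hπ : ∀ t, π' (φ t) = φ (π t)) (x y t : T) :
    smallMod π' (φ y) (φ x) (φ t) = φ (smallMod π x y t) := by
  simp only [smallMod, Equiv.trans_apply, hπ]
  rw [Equiv.swap_comm, Equiv.swap_apply_def, Equiv.swap_apply_def]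
  simp only [φ.injective.eq_iff]
  split_ifs <;> rfl

end ABS

/-! ### Assembly of the three parts. -/

theorem proposition4p3 (m₁ n₁ m₂ n₂ : ℕ)
    (hc₁ : Nat.Coprime m₁ n₁) (hc₂ : Nat.Coprime m₂ n₂)
    (hl₂ : (n₂ : ℚ) / (m₂ + n₂) < 1 / 2) (hl₁ : (1 : ℚ) / 2 < n₁ / (m₁ + n₁)) :
    -- (i)
    (∀ (i j : ℕ) (hi : m₁ < i ∧ i ≤ n₁) (hj : 1 ≤ j ∧ j ≤ n₂),
      ((((ABS.twoSegment m₁ n₁ m₂ n₂).spec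
          (ABS.symA i (by omega)) (ABS.symB j (by omega))).length : ℤ)
          = (ABS.twoSegment m₁ n₁ m₂ n₂).length - 1) ↔
        ¬ ∃ n : ℕ,
          ABS.symA (i + m₁) (by omega) ∈ ABS.calA m₁ n₁ m₂ n₂
            (ABS.symA i (by omega)) (ABS.symB j (by omega)) n ∨
          ABS.symB (j + m₂) (by omega) ∈ ABS.calB m₁ n₁ m₂ n₂
            (ABS.symA i (by omega)) (ABS.symB j (by omega)) n) ∧
    -- (ii)
    (0 < m₁ ∨ 0 < n₂ →
      ∀ (i j : ℕ) (hi : m₁ < i ∧ i ≤ n₁) (hj : n₂ < j ∧ j ≤ m₂),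
        (((ABS.twoSegment m₁ n₁ m₂ n₂).spec
          (ABS.symA i (by omega)) (ABS.symB j (by omega))).length : ℤ)
          < (ABS.twoSegment m₁ n₁ m₂ n₂).length - 1) ∧
    -- (iii), for the dual ABS's and for the dual exchange in the ABS of the dual polygon
    (∀ (i j : ℕ) (hi : n₁ < i ∧ i ≤ m₁ + n₁) (hj : n₂ < j ∧ j ≤ m₂),
      (((((ABS.twoSegment m₁ n₁ m₂ n₂).spec
          (ABS.symA i (by omega)) (ABS.symB j (by omega))).length : ℤ)
          = (ABS.twoSegment m₁ n₁ m₂ n₂).length - 1) ↔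
        ((((ABS.twoSegment m₁ n₁ m₂ n₂).spec
          (ABS.symA i (by omega)) (ABS.symB j (by omega))).dual.length : ℤ)
          = (ABS.twoSegment m₁ n₁ m₂ n₂).dual.length - 1)) ∧
      (((((ABS.twoSegment m₁ n₁ m₂ n₂).spec
          (ABS.symA i (by omega)) (ABS.symB j (by omega))).length : ℤ)
          = (ABS.twoSegment m₁ n₁ m₂ n₂).length - 1) ↔
        ((((ABS.twoSegment n₂ m₂ n₁ m₁).spec
          (ABS.symA (m₂ + n₂ - j + 1) (by omega)) (ABS.symB (m₁ + n₁ - i + 1) (by omega))).length : ℤ)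
          = (ABS.twoSegment n₂ m₂ n₁ m₁).length - 1))) := by
  have h₁ : m₁ < n₁ := by
    by_contra h
    have hpos : (0 : ℚ) < m₁ + n₁ := by
      -- Division by 0 gives 0, so the bound on λ₁ excludes an empty A.
      by_contra h0
      have h0' : (m₁ : ℚ) + n₁ = 0 := le_antisymm (not_lt.1 h0) (by positivity)
      rw [h0', div_zero] at hl₁
      norm_num at hl₁
    rw [div_lt_div_iff₀ (by norm_num) hpos] at hl₁
    have : (n₁ : ℚ) ≤ m₁ := by exact_mod_cast not_lt.1 h
    linarith
  have h₂ : n₂ < m₂ := by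
    -- For an empty B the quotient 0 would satisfy the bound on λ₂; coprimality excludes it, as
    -- gcd(0, 0) = 0.
    have hpos : 0 < m₂ + n₂ := by
      by_contra h0
      obtain ⟨rfl, rfl⟩ : m₂ = 0 ∧ n₂ = 0 := by omega
      simp at hc₂
    have hpos' : (0 : ℚ) < m₂ + n₂ := by exact_mod_cast hpos
    rw [div_lt_div_iff₀ hpos' (by norm_num)] at hl₂
    have : (n₂ : ℚ) < m₂ := by linarith
    exact_mod_cast this
  have key : ∀ (i : Fin (m₁ + n₁)) (j : Fin (m₂ + n₂)), m₁ ≤ (i : ℕ) → (i : ℕ) < n₁ →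
      (j : ℕ) < m₂ →
      ((ABS.twoSegment m₁ n₁ m₂ n₂).spec (.inl i) (.inr j)).length + 1
        ≤ (ABS.twoSegment m₁ n₁ m₂ n₂).length ∧
      (((ABS.twoSegment m₁ n₁ m₂ n₂).spec (.inl i) (.inr j)).length + 1
        = (ABS.twoSegment m₁ n₁ m₂ n₂).length ↔
        ABS.IsGood (ABS.pos m₁ n₁ m₂ n₂) (ABS.twoSegment m₁ n₁ m₂ n₂).δ
          (ABS.twoSegment m₁ n₁ m₂ n₂).π (.inl i) (.inr j)) := by
    intro i j hi hi' hj
    refine ABS.length_spec_twoSegment h₁ h₂ ?_ (ABS.δ_inl_of_le hi) (ABS.δ_inr_of_lt hj)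
    rw [ABS.pos_inl, ABS.pos_inr]
    split_ifs <;> omega
  refine ⟨fun i j hi hj => ?_, fun hpos i j hi hj => ?_, fun i j hi hj => ⟨?_, ?_⟩⟩
  · have hk := (key ⟨i - 1, by omega⟩ ⟨j - 1, by omega⟩ (by simp; omega) (by simp; omega)
      (by simp; omega)).2
    rw [ABS.isGood_iff hc₁ hc₂ h₁ h₂ ⟨by simp; omega, by simp; omega⟩ (by simp; omega)
      (w := ⟨i + m₁ - 1, by omega⟩) (by simp; omega) (v := ⟨j + m₂ - 1, by omega⟩)
      (by simp; omega)] at hk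
    refine Iff.trans ?_ hk
    unfold ABS.symA ABS.symB
    omega
  · have hk := key ⟨i - 1, by omega⟩ ⟨j - 1, by omega⟩ (by simp; omega) (by simp; omega)
      (by simp; omega)
    have hng := mt hk.2.1 (ABS.not_isGood_of_le hc₁ h₁ h₂ hpos ⟨by simp; omega, by simp; omega⟩
      ⟨by simp; omega, by simp; omega⟩)
    have hle := hk.1
    unfold ABS.symA ABS.symB
    omega
  -- Reversing the order and exchanging the symbols matches (0,1)-pairs with (0,1)-pairs, so passing
  -- to the dual leaves every length unchanged.
  · rw [ABS.dual_length, ABS.dual_length]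
  · have hx : ∀ h h', (ABS.symA (m₂ + n₂ - j + 1) h : Fin (n₂ + m₂) ⊕ Fin (n₁ + m₁))
        = ABS.twoSegmentDual m₁ n₁ m₂ n₂ (ABS.symB j h') := by
      intro h h'
      refine congrArg Sum.inl (Fin.ext ?_)
      rw [ABS.simpleDual_val]
      simp only
      omega
    have hy : ∀ h h', (ABS.symB (m₁ + n₁ - i + 1) h : Fin (n₂ + m₂) ⊕ Fin (n₁ + m₁))
        = ABS.twoSegmentDual m₁ n₁ m₂ n₂ (ABS.symA i h') := by
      intro h h'
      refine congrArg Sum.inr (Fin.ext ?_)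
      rw [ABS.simpleDual_val]
      simp only
      omega
    rw [hx _ (by omega), hy _ (by omega), ABS.spec_length, ABS.spec_length, ABS.twoSegment_length,
      ABS.twoSegment_length, ABS.binCount_dual (ABS.twoSegmentDual m₁ n₁ m₂ n₂)
        (ABS.twoSegment_δ_dual m₁ n₁ m₂ n₂) (ABS.twoSegment_π_dual m₁ n₁ m₂ n₂),
      ABS.binCount_dual (ABS.twoSegmentDual m₁ n₁ m₂ n₂) (ABS.twoSegment_δ_dual m₁ n₁ m₂ n₂)
        (ABS.smallMod_map _ (ABS.twoSegment_π_dual m₁ n₁ m₂ n₂) _ _)]
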